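/- **Setting.** Let $\mathfrak q\ge 4$ be an even integer, $a>0$, and let $L\ge 1$ be an odd integer, $L_{\rm tp}=L^{A}$, $L_{\rm sp}=L^{B}$ with integers $A,B\geq 0$. Put $\varepsilon_j=L^{-j}$ and $$\mathcal X_j^{(n)}=\big(\varepsilon_j^2\mathbb Z/\varepsilon_{n+j}^2L_{\rm tp}\mathbb Z\big)\times\big(\varepsilon_j\mathbb Z^3/\varepsilon_{n+j}L_{\rm sp}\mathbb Z^3\big),\qquad \int_{\mathcal X_j^{(n)}}du=\varepsilon_j^5\sum_{u\in\mathcal X_j^{(n)}}.$$ Let $\mathcal H_j^{(n)}$ be the space of complex functions on $\mathcal X_j^{(n)}$ with the real inner product $\langle\alpha_1,\alpha_2\rangle_j=\int\alpha_1(u)\alpha_2(u)\,du$, with respect to which adjoints ${}^*$ are taken, and let $\mathcal H_n=\mathcal H_n^{(0)}$. Let $\mathbb L(u_0,\mathbf u)=(L^2u_0,L\mathbf u)$ as a bijection $\mathcal X_j^{(n)}\to\mathcal X_{j-1}^{(n)}$, and $(\mathbb L_*\alpha)(\mathbb Lu)=\alpha(u)$. For an operator with integral kernel $A(u,u')$,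 mapping functions on a lattice $\mathcal X$ to functions on a lattice $\mathcal Y$ in the same torus, put $$\|A\|_m=\max\Big\{\sup_{u\in\mathcal Y}\int_{\mathcal X}du'\,e^{m|u-u'|}|A(u,u')|,\ \sup_{u'\in\mathcal X}\int_{\mathcal Y}du\,e^{m|u-u'|}|A(u,u')|\Big\},$$ where $|u-u'|$ is the Euclidean distance on the torus. *Averaging.* Let $q=L^{-5\mathfrak q}\,1_\square*\cdots*1_\square$ ($\mathfrak q$ factors) on $\mathbb Z\times\mathbb Z^3$, where $\square=[-\frac{L^2-1}2,\frac{L^2-1}2]\times[-\frac{L-1}2,\frac{L-1}2]^3$. Let $Q:\mathcal H_0^{(n)}\to\mathcal H_{-1}^{(n+1)}$ be $(Q\psi)(y)=\sum_{x\in\mathbb Z\times\mathbb Z^3}q(x)\psi(y+[x])$, let $Q_j=(\mathbb L_*^{-1}Q)^j\mathbb L_*^j:\mathcal H_j^{(n-j)}\to\mathcal H_0^{(n)}$, and for $n\ge1$ let $\mathfrak Q_n=a\big(1+\sum_{j=1}^{n-1}L^{-2j}Q_jQ_j^*\big)^{-1}$ on $\mathcal H_0^{(n)}$. *Dynamics.*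 Let $\mathbf h_0$ be a translation invariant operator on $L^2(\mathbb Z^3)$ whose Fourier transform $\hat{\mathbf h}_0(\mathbf p)$ is entire, is invariant under $\mathbf p_\nu\to-\mathbf p_\nu$ for each $\nu$, is nonnegative for real $\mathbf p$, is strictly positive on $\mathbb R^3\setminus2\pi\mathbb Z^3$, and vanishes at $0$ together with its first derivatives, with $\big[\partial_{\mathbf p_\mu}\partial_{\mathbf p_\nu}\hat{\mathbf h}_0(0)\big]_{\mu,\nu}$ positive definite. Let $h_0$ be its periodization to $\mathbb Z^3/L_{\rm sp}\mathbb Z^3$, acting in the space variable on $\mathcal H_0$. Let $\partial_0$ be the forward time derivative, and let $D_0=1-e^{-h_0}-e^{-h_0}\partial_0$ on $\mathcal H_0$ and $D_n=L^{2n}\,\mathbb L_*^{-n}D_0\mathbb L_*^n$ on $\mathcal H_n$. *Operators of step $n+1$.* For $n\ge0$ with $A\ge2(n+1)$ and $B\ge n+1$ put $$\check Q_{n+1}=QQ_n:\mathcal H_n\to\mathcal H_{-1}^{(n+1)},\qquad \check{\mathfrak Q}_{n+1}=L^{-2}\,\mathbb L_*\mathfrak Q_{n+1}\mathbb L_*^{-1}\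 \text{ on }\mathcal H_{-1}^{(n+1)},$$ $$\check S_{n+1}=\big(D_n+\check Q_{n+1}^*\check{\mathfrak Q}_{n+1}\check Q_{n+1}\big)^{-1}\ \text{ on }\mathcal H_n.$$ **Statement.** For every even $\mathfrak q\ge4$ there is a constant $\Gamma_{17}$, depending only on $\mathfrak q$, and for all $a>0$ and $\mathbf h_0$ as above there are constants $m_9>0$ and $\Gamma_{18}$, depending only on $\mathfrak q$, $a$, $\mathbf h_0$ (in particular independent of $L$, $n$, $L_{\rm tp}$, $L_{\rm sp}$), such that for all odd $L>\Gamma_{17}$ and all $n\ge 0$, $A\ge 2(n+1)$, $B\ge n+1$, the operator $D_n+\check Q_{n+1}^*\check{\mathfrak Q}_{n+1}\check Q_{n+1}$ is invertible and $$\big\|\mathbb L_*^{-1}\check S_{n+1}\mathbb L_*\big\|_{m_9}\le L^2\,\Gamma_{18},\qquad \big\|\mathbb L_*^{-1}\check S_{n+1}\check Q_{n+1}^*\mathbb L_*\big\|_{m_9}\le L^2\,\Gamma_{18}.$$ -/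

import Mathlib

noncomputable section

namespace ParabolicBlockSpin

/-- The lattice spacing `ε_j = L^{-j}`. -/
def eps (L : ℕ) (j : ℤ) : ℝ := (L : ℝ) ^ (-j)

/-- The discrete torus
`X_j^{(n)} = (ε_j² ℤ / ε_{n+j}² L_tp ℤ) × (ε_j ℤ³ / ε_{n+j} L_sp ℤ³)`, where `L_tp = L ^ A` and
`L_sp = L ^ B`. A point is given by its integer coordinates in units of the lattice spacing: the
pair `(i₀, i)` stands for the class of `(ε_j² i₀, ε_j i)`. Hence the index type does not depend on
`j`; the subscript `j` is kept since it determines positions, volume elements and norms. -/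
abbrev Lat (L A B : ℕ) (_j : ℤ) (n : ℕ) : Type :=
  ZMod (L ^ (A - 2 * n)) × (Fin 3 → ZMod (L ^ (B - n)))

/-- Identification of `X_j^{(n)}` with `X_j^{(n')}` when `n = n'`. It is used only in that case,
for superscripts that are equal but written differently. -/
def relevel (L A B : ℕ) (j : ℤ) (n n' : ℕ) (u : Lat L A B j n) : Lat L A B j n' :=
  (ZMod.cast u.1, fun ν => ZMod.cast (u.2 ν))

/-- A representative in `ℝ × ℝ³` of a point of `X_j^{(n)}`. -/
def pos (L A B : ℕ) (j : ℤ) (n : ℕ) (u : Lat L A B j n) : Fin 4 → ℝ :=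
  Fin.cons (eps L j ^ 2 * (u.1.val : ℝ)) fun ν => eps L j * ((u.2 ν).val : ℝ)

/-- The periods of the torus `X_j^{(n)}`; they depend only on `N = n + j`. -/
def period (L A B : ℕ) (N : ℤ) : Fin 4 → ℝ :=
  Fin.cons (eps L N ^ 2 * (L : ℝ) ^ A) fun _ => eps L N * (L : ℝ) ^ B

/-- The Euclidean distance `|x - y|` on the torus with the periods `period L A B N`. -/
def torusDist (L A B : ℕ) (N : ℤ) (x y : Fin 4 → ℝ) : ℝ :=
  Real.sqrt (∑ ν, ‖((x ν - y ν : ℝ) : AddCircle (period L A B N ν))‖ ^ 2)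

section Operators

/- A linear operator from functions on `X_j^{(a)}` to functions on `X_k^{(b)}` is represented by its
matrix `M`, that is, `(M α)(u) = ∑ u', M u u' * α u'`. -/

variable (L A B : ℕ) [NeZero L]

/-- The integral kernel of an operator on functions on `X_j^{(a)}`:
`(M α)(u) = ∫ K(u, u') α(u') du'`, where `∫ du' = ε_j⁵ ∑_{u'}`. -/
def opKernel (j : ℤ) (a : ℕ) (k : ℤ) (b : ℕ)
    (M : Matrix (Lat L A B k b) (Lat L A B j a) ℂ) (u : Lat L A B k b) (u' : Lat L A B j a) : ℂ :=
  (((eps L j ^ 5)⁻¹ : ℝ) : ℂ) * M u u'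

/-- The norm `‖·‖_m` of an operator from functions on `X_j^{(a)}` to functions on `X_k^{(b)}`, for
two lattices in the same torus, that is, with `j + a = k + b`. -/
def opNorm (m : ℝ) (j : ℤ) (a : ℕ) (k : ℤ) (b : ℕ)
    (M : Matrix (Lat L A B k b) (Lat L A B j a) ℂ) : ℝ :=
  max
    (⨆ u : Lat L A B k b, eps L j ^ 5 * ∑ u' : Lat L A B j a,
      Real.exp (m * torusDist L A B (j + a) (pos L A B k b u) (pos L A B j a u')) *
        ‖opKernel L A B j a k b M u u'‖)
    (⨆ u' : Lat L A B j a, eps L k ^ 5 * ∑ u : Lat L A B k b,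
      Real.exp (m * torusDist L A B (j + a) (pos L A B k b u) (pos L A B j a u')) *
        ‖opKernel L A B j a k b M u u'‖)

/-- The adjoint with respect to the real inner products
`⟨α₁, α₂⟩_j = ε_j⁵ ∑_u α₁(u) α₂(u)` on source and target. -/
def adj (j : ℤ) (a : ℕ) (k : ℤ) (b : ℕ) (M : Matrix (Lat L A B k b) (Lat L A B j a) ℂ) :
    Matrix (Lat L A B j a) (Lat L A B k b) ℂ :=
  (((eps L k / eps L j) ^ 5 : ℝ) : ℂ) • M.transpose

/-- The scaling bijection `𝕃 : X_j^{(n)} → X_{j-1}^{(n)}`, `(u₀, 𝐮) ↦ (L² u₀, L 𝐮)`. Since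
`ε_{j-1} = L ε_j`, it preserves the integer coordinates. -/
def scaling (j : ℤ) (n : ℕ) : Lat L A B j n ≃ Lat L A B (j - 1) n := Equiv.refl _

/-- `𝕃_*⁻¹ M 𝕃_*`, where `(𝕃_* α)(𝕃 u) = α u`. An operator from functions on `X_{j-1}^{(a)}` to
functions on `X_{k-1}^{(b)}` becomes one from functions on `X_j^{(a)}` to functions on
`X_k^{(b)}`. -/
def scaleDown (j : ℤ) (a : ℕ) (k : ℤ) (b : ℕ)
    (M : Matrix (Lat L A B (k - 1) b) (Lat L A B (j - 1) a) ℂ) :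
    Matrix (Lat L A B k b) (Lat L A B j a) ℂ :=
  M.submatrix (scaling L A B k b) (scaling L A B j a)

/-- `𝕃_* M 𝕃_*⁻¹`, the inverse of `scaleDown`. -/
def scaleUp (j : ℤ) (a : ℕ) (k : ℤ) (b : ℕ)
    (M : Matrix (Lat L A B k b) (Lat L A B j a) ℂ) :
    Matrix (Lat L A B (k - 1) b) (Lat L A B (j - 1) a) ℂ :=
  M.submatrix (scaling L A B k b).symm (scaling L A B j a).symm

/-- The lattice points of the rectangle
`[-(L²-1)/2, (L²-1)/2] × [-(L-1)/2, (L-1)/2]³` (for odd `L`). -/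
def box : Finset (ℤ × (Fin 3 → ℤ)) :=
  Finset.Icc (-(((L : ℤ) ^ 2 - 1) / 2)) (((L : ℤ) ^ 2 - 1) / 2) ×ˢ
    Fintype.piFinset fun _ => Finset.Icc (-(((L : ℤ) - 1) / 2)) (((L : ℤ) - 1) / 2)

/-- The `r`-fold convolution power of the characteristic function of the rectangle. -/
def boxConv : ℕ → ℤ × (Fin 3 → ℤ) → ℝ
  | 0, x => if x = 0 then 1 else 0
  | r + 1, x => ∑ y ∈ box L, boxConv r (x - y)

/-- The averaging profile `q = L^{-5𝔮} 1_□ * ⋯ * 1_□`. -/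
def profile (qq : ℕ) (x : ℤ × (Fin 3 → ℤ)) : ℝ :=
  ((L : ℝ) ^ (5 * qq))⁻¹ * boxConv L qq x

/-- The class `[x]` in `X_0^{(n)}` of `x ∈ ℤ × ℤ³`. -/
def cls (n : ℕ) (x : ℤ × (Fin 3 → ℤ)) : Lat L A B 0 n :=
  ((x.1 : ZMod (L ^ (A - 2 * n))), fun ν => ((x.2 ν : ℤ) : ZMod (L ^ (B - n))))

/-- The inclusion `X_{-1}^{(n+1)} ⊂ X_0^{(n)}`; the spacings are `(L², L)` and `(1, 1)`. -/
def incl (n : ℕ) (y : Lat L A B (-1) (n + 1)) : Lat L A B 0 n :=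
  cls L A B n ((L : ℤ) ^ 2 * (y.1.val : ℤ), fun ν => (L : ℤ) * ((y.2 ν).val : ℤ))

/-- The block spin averaging operator `Q : H_0^{(n)} → H_{-1}^{(n+1)}`,
`(Q ψ)(y) = ∑_{x ∈ ℤ × ℤ³} q(x) ψ(y + [x])`. -/
def avgQ (qq n : ℕ) : Matrix (Lat L A B (-1) (n + 1)) (Lat L A B 0 n) ℂ :=
  Matrix.of fun y z =>
    ∑' x : ℤ × (Fin 3 → ℤ),
      if incl L A B n y + cls L A B n x = z then ((profile L qq x : ℝ) : ℂ) else 0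

/-- `Q_j : H_j^{(a)} → H_0^{(a+j)}`, `Q_0 = 1` and `Q_{j+1} = 𝕃_*⁻¹ Q Q_j 𝕃_*`, that is,
`Q_j = (𝕃_*⁻¹ Q)^j 𝕃_*^j`. -/
def iterQ (qq a : ℕ) : (j : ℕ) → Matrix (Lat L A B 0 (a + j)) (Lat L A B j a) ℂ
  | 0 => (1 : Matrix (Lat L A B 0 a) (Lat L A B 0 a) ℂ)
  | j + 1 =>
      scaleDown L A B ((j : ℤ) + 1) a 0 (a + j + 1) (avgQ L A B qq (a + j) * iterQ qq a j)

/-- `Q_n : H_n = H_n^{(0)} → H_0^{(n)}`. -/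
def Qn (qq n : ℕ) : Matrix (Lat L A B 0 n) (Lat L A B n 0) ℂ :=
  (iterQ L A B qq 0 n).submatrix (relevel L A B 0 n (0 + n)) id

/-- `Q_j Q_j^* : H_0^{(n)} → H_0^{(n)}`, where `Q_j : H_j^{(n-j)} → H_0^{(n)}` and `j ≤ n`. -/
def gramQ (qq n j : ℕ) : Matrix (Lat L A B 0 n) (Lat L A B 0 n) ℂ :=
  (iterQ L A B qq (n - j) j *
      adj L A B j (n - j) 0 (n - j + j) (iterQ L A B qq (n - j) j)).submatrix
    (relevel L A B 0 n (n - j + j)) (relevel L A B 0 n (n - j + j))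

/-- `𝔔_n = a (1 + ∑_{j=1}^{n-1} L^{-2j} Q_j Q_j^*)⁻¹` on `H_0^{(n)}`, `n ≥ 1`. -/
def fQ (qq : ℕ) (a : ℝ) (n : ℕ) : Matrix (Lat L A B 0 n) (Lat L A B 0 n) ℂ :=
  (a : ℂ) • (1 + ∑ j ∈ Finset.Ico 1 n, ((L : ℂ) ^ (2 * j))⁻¹ • gramQ L A B qq n j)⁻¹

end Operators

/-- A translation invariant operator `𝐡₀` on `L²(ℤ³)`, `(𝐡₀ f)(x) = ∑_y kernel (x - y) f y`, whose
Fourier transform `𝐩 ↦ ∑_x kernel x e^{-i𝐩·x}` is (the restriction to real `𝐩` of) the entire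
function `symbol` and has the properties of a single particle dispersion relation. -/
structure SingleParticle where
  kernel : (Fin 3 → ℤ) → ℂ
  symbol : (Fin 3 → ℂ) → ℂ
  summable_kernel : Summable kernel
  fourier : ∀ p : Fin 3 → ℝ, symbol (fun ν => (p ν : ℂ)) =
    ∑' x : Fin 3 → ℤ, kernel x * Complex.exp (-Complex.I * ∑ ν, (p ν : ℂ) * (x ν : ℂ))
  entire : Differentiable ℂ symbol
  even : ∀ (ν : Fin 3) (p : Fin 3 → ℂ), symbol (Function.update p ν (-p ν)) = symbol p
  nonneg : ∀ p : Fin 3 → ℝ,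
    (symbol fun ν => (p ν : ℂ)).im = 0 ∧ 0 ≤ (symbol fun ν => (p ν : ℂ)).re
  pos : ∀ p : Fin 3 → ℝ, (¬ ∃ z : Fin 3 → ℤ, ∀ ν, p ν = 2 * Real.pi * z ν) →
    0 < (symbol fun ν => (p ν : ℂ)).re
  zero : symbol 0 = 0
  deriv_zero : ∀ ν : Fin 3, fderiv ℂ symbol 0 (Pi.single ν 1) = 0
  hessian_pos : Matrix.PosDef (Matrix.of fun μ ν : Fin 3 =>
    (fderiv ℂ (fun p => fderiv ℂ symbol p (Pi.single ν 1)) 0 (Pi.single μ 1)).re)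

section Dynamics

variable (L A B : ℕ) [NeZero L]

/-- The periodization `h₀` of `𝐡₀` to `ℤ³ / L_sp ℤ³`, acting on the space variable of functions on
`X_0 = X_0^{(0)}`. -/
def h0 (h : SingleParticle) : Matrix (Lat L A B 0 0) (Lat L A B 0 0) ℂ :=
  Matrix.of fun x y =>
    if x.1 = y.1 then
      ∑' z : Fin 3 → ℤ,
        if (fun ν => ((z ν : ℤ) : ZMod (L ^ (B - 0)))) = x.2 - y.2 then h.kernel z else 0
    else 0

/-- The forward time derivative `(∂₀ α)(x) = α(x + e₀) - α(x)` on `X_0`. -/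
def timeDeriv : Matrix (Lat L A B 0 0) (Lat L A B 0 0) ℂ :=
  Matrix.of fun x y => (if y = x + (1, 0) then 1 else 0) - (if y = x then 1 else 0)

/-- `D_0 = 1 - e^{-h₀} - e^{-h₀} ∂₀`. -/
def D0 (h : SingleParticle) : Matrix (Lat L A B 0 0) (Lat L A B 0 0) ℂ :=
  1 - NormedSpace.exp (-h0 L A B h) - NormedSpace.exp (-h0 L A B h) * timeDeriv L A B

/-- `D_n = L^{2n} 𝕃_*^{-n} D_0 𝕃_*^n` on `H_n`, by `D_{n+1} = L² 𝕃_*⁻¹ D_n 𝕃_*`. -/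
def Dn (h : SingleParticle) : (n : ℕ) → Matrix (Lat L A B n 0) (Lat L A B n 0) ℂ
  | 0 => D0 L A B h
  | n + 1 => (L : ℂ) ^ 2 • scaleDown L A B ((n : ℤ) + 1) 0 ((n : ℤ) + 1) 0 (Dn h n)

/-- `Q̌_{n+1} = Q Q_n : H_n → H_{-1}^{(n+1)}`. -/
def checkQ (qq n : ℕ) : Matrix (Lat L A B (-1) (n + 1)) (Lat L A B n 0) ℂ :=
  avgQ L A B qq n * Qn L A B qq n

/-- `𝔔̌_{n+1} = L^{-2} 𝕃_* 𝔔_{n+1} 𝕃_*⁻¹` on `H_{-1}^{(n+1)}`. -/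
def checkfQ (qq : ℕ) (a : ℝ) (n : ℕ) :
    Matrix (Lat L A B (-1) (n + 1)) (Lat L A B (-1) (n + 1)) ℂ :=
  ((L : ℂ) ^ 2)⁻¹ • scaleUp L A B 0 (n + 1) 0 (n + 1) (fQ L A B qq a (n + 1))

/-- `Q̌_{n+1}^* : H_{-1}^{(n+1)} → H_n`. -/
def checkQadj (qq n : ℕ) : Matrix (Lat L A B n 0) (Lat L A B (-1) (n + 1)) ℂ :=
  adj L A B n 0 (-1) (n + 1) (checkQ L A B qq n)

/-- `D_n + Q̌_{n+1}^* 𝔔̌_{n+1} Q̌_{n+1}` on `H_n`. -/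
def checkSinv (h : SingleParticle) (qq : ℕ) (a : ℝ) (n : ℕ) :
    Matrix (Lat L A B n 0) (Lat L A B n 0) ℂ :=
  Dn L A B h n + checkQadj L A B qq n * checkfQ L A B qq a n * checkQ L A B qq n

/-- `Š_{n+1} = (D_n + Q̌_{n+1}^* 𝔔̌_{n+1} Q̌_{n+1})⁻¹` on `H_n`. -/
def checkS (h : SingleParticle) (qq : ℕ) (a : ℝ) (n : ℕ) :
    Matrix (Lat L A B n 0) (Lat L A B n 0) ℂ :=
  (checkSinv L A B h qq a n)⁻¹

/-- `𝕃_*⁻¹ Š_{n+1} 𝕃_* : H_{n+1} → H_{n+1}`. -/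
def scaledCheckS (h : SingleParticle) (qq : ℕ) (a : ℝ) (n : ℕ) :
    Matrix (Lat L A B ((n : ℤ) + 1) 0) (Lat L A B ((n : ℤ) + 1) 0) ℂ :=
  scaleDown L A B ((n : ℤ) + 1) 0 ((n : ℤ) + 1) 0 (checkS L A B h qq a n)

/-- `𝕃_*⁻¹ Š_{n+1} Q̌_{n+1}^* 𝕃_* : H_0^{(n+1)} → H_{n+1}`. -/
def scaledCheckSQadj (h : SingleParticle) (qq : ℕ) (a : ℝ) (n : ℕ) :
    Matrix (Lat L A B ((n : ℤ) + 1) 0) (Lat L A B 0 (n + 1)) ℂ :=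
  scaleDown L A B 0 (n + 1) ((n : ℤ) + 1) 0 (checkS L A B h qq a n * checkQadj L A B qq n)

end Dynamics

end ParabolicBlockSpin

end

noncomputable section

set_option linter.unusedSectionVars false

namespace ParabolicBlockSpin

open Metric

section Taylor

theorem norm_deriv_le_of_norm_le_closedBall {f : ℂ → ℂ} (hf : Differentiable ℂ f) {M r : ℝ}
    (hM : ∀ s : ℂ, ‖s‖ ≤ r + 1 → ‖f s‖ ≤ M) (s : ℂ) (hs : ‖s‖ ≤ r) : ‖deriv f s‖ ≤ M := by
  have := Complex.norm_deriv_le_of_forall_mem_sphere_norm_le (c := s) (R := 1) (C := M) one_pos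
    hf.diffContOnCl (fun z hz => hM z ?_)
  · simpa using this
  · have h1 : ‖z - s‖ = 1 := by simpa [dist_eq_norm] using hz
    calc ‖z‖ = ‖(z - s) + s‖ := by ring_nf
      _ ≤ ‖z - s‖ + ‖s‖ := norm_add_le _ _
      _ ≤ r + 1 := by linarith

theorem norm_sub_le_of_norm_deriv_le_closedBall {f : ℂ → ℂ} (hf : Differentiable ℂ f) {C : ℝ}
    (s : ℂ) (hC : ∀ z : ℂ, ‖z‖ ≤ ‖s‖ → ‖deriv f z‖ ≤ C) : ‖f s - f 0‖ ≤ C * ‖s‖ := by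
  have := (convex_closedBall (0 : ℂ) ‖s‖).norm_image_sub_le_of_norm_deriv_le (f := f) (C := C)
    (x := 0) (y := s) (fun z _ => hf z) (fun z hz => hC z (by simpa using hz)) (by simp) (by simp)
  simpa using this

theorem differentiable_deriv_of_differentiable {f : ℂ → ℂ} (hf : Differentiable ℂ f) :
    Differentiable ℂ (deriv f) := by
  have := hf.contDiff (n := 2)
  exact (this.differentiable_deriv_two)

theorem norm_taylor_one_le {f : ℂ → ℂ} (hf : Differentiable ℂ f) {M r : ℝ}
    (hM : ∀ s : ℂ, ‖s‖ ≤ r + 2 → ‖f s‖ ≤ M) (s : ℂ) (hs : ‖s‖ ≤ r) :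
    ‖f s - f 0 - s * deriv f 0‖ ≤ M * ‖s‖ ^ 2 := by
  have hf' := differentiable_deriv_of_differentiable hf
  have h1 : ∀ z : ℂ, ‖z‖ ≤ r + 1 → ‖deriv f z‖ ≤ M :=
    norm_deriv_le_of_norm_le_closedBall hf (r := r + 1) (fun z hz => hM z (by linarith))
  have h2 : ∀ z : ℂ, ‖z‖ ≤ r → ‖deriv (deriv f) z‖ ≤ M :=
    norm_deriv_le_of_norm_le_closedBall hf' h1
  have hM0 : 0 ≤ M := (norm_nonneg _).trans (h2 s hs)
  have hd : ∀ z, HasDerivAt (fun z => f z - z * deriv f 0) (deriv f z - deriv f 0) z := by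
    intro z
    have := (hf z).hasDerivAt.fun_sub ((hasDerivAt_id z).mul_const (deriv f 0))
    simpa using this
  have h3 := norm_sub_le_of_norm_deriv_le_closedBall (f := fun z => f z - z * deriv f 0)
    (C := M * ‖s‖) (fun z => (hd z).differentiableAt) s (fun z hz => by
      rw [(hd z).deriv]
      have := norm_sub_le_of_norm_deriv_le_closedBall hf' z (C := M)
        (fun w hw => h2 w (by linarith))
      exact this.trans (by gcongr))
  calc _ = ‖f s - s * deriv f 0 - (f 0 - 0 * deriv f 0)‖ := by congr 1; ring
    _ ≤ _ := h3
    _ = _ := by ring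

theorem norm_taylor_two_le {f : ℂ → ℂ} (hf : Differentiable ℂ f) {M r : ℝ}
    (hM : ∀ s : ℂ, ‖s‖ ≤ r + 3 → ‖f s‖ ≤ M) (s : ℂ) (hs : ‖s‖ ≤ r) :
    ‖f s - f 0 - s * deriv f 0 - s ^ 2 / 2 * deriv (deriv f) 0‖ ≤ M * ‖s‖ ^ 3 := by
  have hf' := differentiable_deriv_of_differentiable hf
  have h1 : ∀ z : ℂ, ‖z‖ ≤ r + 2 → ‖deriv f z‖ ≤ M :=
    norm_deriv_le_of_norm_le_closedBall hf (r := r + 2) (fun z hz => hM z (by linarith))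
  have hM0 : 0 ≤ M := (norm_nonneg _).trans (hM s (by linarith))
  have hd : ∀ z, HasDerivAt (fun z => f z - z * deriv f 0 - z ^ 2 / 2 * deriv (deriv f) 0)
      (deriv f z - deriv f 0 - z * deriv (deriv f) 0) z := by
    intro z
    have := ((hf z).hasDerivAt.fun_sub ((hasDerivAt_id z).mul_const (deriv f 0))).fun_sub
      ((((hasDerivAt_id z).fun_pow 2).div_const 2).mul_const (deriv (deriv f) 0))
    refine this.congr_deriv ?_
    simp [id]
  have h3 := norm_sub_le_of_norm_deriv_le_closedBall
    (f := fun z => f z - z * deriv f 0 - z ^ 2 / 2 * deriv (deriv f) 0)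
    (C := M * ‖s‖ ^ 2) (fun z => (hd z).differentiableAt) s (fun z hz => by
      rw [(hd z).deriv]
      have := norm_taylor_one_le hf' h1 z (hz.trans hs)
      exact this.trans (by gcongr))
  calc _ = ‖f s - s * deriv f 0 - s ^ 2 / 2 * deriv (deriv f) 0
        - (f 0 - 0 * deriv f 0 - 0 ^ 2 / 2 * deriv (deriv f) 0)‖ := by congr 1; ring
    _ ≤ _ := h3
    _ = _ := by ring

theorem im_deriv_zero_of_real {f : ℂ → ℂ} (hf : Differentiable ℂ f)
    (hr : ∀ x : ℝ, (f x).im = 0) : (deriv f 0).im = 0 := by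
  have h1 : HasDerivAt (fun x : ℝ => f x) (deriv f ((0 : ℝ) : ℂ)) 0 :=
    (hf ((0 : ℝ) : ℂ)).hasDerivAt.comp_ofReal
  have h2 := Complex.imCLM.hasFDerivAt.comp_hasDerivAt (0 : ℝ) h1
  have h3 : (Complex.imCLM ∘ fun x : ℝ => f x) = fun _ => 0 := by
    funext x; simpa using hr x
  rw [h3] at h2
  have := h2.unique (hasDerivAt_const (0 : ℝ) (0 : ℝ))
  simpa using this

end Taylor

section Symbol

variable (h : SingleParticle)

/-- The restriction of the symbol to real momenta. -/
def SingleParticle.hat (p : Fin 3 → ℝ) : ℝ := (h.symbol fun ν => (p ν : ℂ)).re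

theorem SingleParticle.symbol_ofReal (p : Fin 3 → ℝ) :
    h.symbol (fun ν => (p ν : ℂ)) = (h.hat p : ℂ) := by
  apply Complex.ext
  · simp [SingleParticle.hat]
  · simpa using (h.nonneg p).1

theorem SingleParticle.hat_nonneg (p : Fin 3 → ℝ) : 0 ≤ h.hat p := (h.nonneg p).2

theorem SingleParticle.continuous_hat : Continuous h.hat := by
  unfold SingleParticle.hat
  have := h.entire.continuous
  fun_prop

theorem SingleParticle.exists_hat_le : ∃ C : ℝ, ∀ p, h.hat p ≤ C := by
  refine ⟨∑' x, ‖h.kernel x‖, fun p => ?_⟩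
  have h1 : h.hat p ≤ ‖h.symbol (fun ν => (p ν : ℂ))‖ := Complex.re_le_norm _
  refine h1.trans ?_
  rw [h.fourier p]
  have hn : ∀ x : Fin 3 → ℤ,
      ‖h.kernel x * Complex.exp (-Complex.I * ∑ ν, (p ν : ℂ) * (x ν : ℂ))‖ = ‖h.kernel x‖ := by
    intro x
    rw [norm_mul, Complex.norm_exp]
    have : (-Complex.I * ∑ ν, (p ν : ℂ) * (x ν : ℂ)).re = 0 := by
      simp [Complex.mul_re, Fin.sum_univ_three]
    rw [this]; simp
  have hs : Summable fun x : Fin 3 → ℤ =>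
      ‖h.kernel x * Complex.exp (-Complex.I * ∑ ν, (p ν : ℂ) * (x ν : ℂ))‖ := by
    simp only [hn]; exact h.summable_kernel.norm
  calc _ ≤ _ := norm_tsum_le_tsum_norm hs
    _ = _ := by simp only [hn]

theorem SingleParticle.exists_norm_symbol_le (r : ℝ) :
    ∃ M : ℝ, ∀ p : Fin 3 → ℂ, ‖p‖ ≤ r → ‖h.symbol p‖ ≤ M := by
  obtain ⟨M, hM⟩ := (isCompact_closedBall (0 : Fin 3 → ℂ) r).exists_bound_of_continuousOn
    h.entire.continuous.continuousOn
  exact ⟨M, fun p hp => hM p (by simpa using hp)⟩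

/-- The quadratic form of the Hessian of the symbol at the origin. -/
def SingleParticle.hess (v : Fin 3 → ℝ) : ℝ :=
  ∑ μ, ∑ ν, v μ * v ν * (fderiv ℂ (fun p => fderiv ℂ h.symbol p (Pi.single ν 1)) 0
    (Pi.single μ 1)).re

theorem SingleParticle.hess_pos (v : Fin 3 → ℝ) (hv : v ≠ 0) : 0 < h.hess v := by
  have := h.hessian_pos.dotProduct_mulVec_pos hv
  simp only [dotProduct, Matrix.mulVec, Matrix.of_apply, star_trivial, Pi.star_apply,
    Finset.mul_sum] at this
  unfold SingleParticle.hess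
  refine this.trans_eq (Finset.sum_congr rfl fun μ _ => Finset.sum_congr rfl fun ν _ => ?_)
  ring

theorem SingleParticle.continuous_hess : Continuous h.hess := by
  unfold SingleParticle.hess; fun_prop

theorem fderiv_apply_eq_sum (f : (Fin 3 → ℂ) →L[ℂ] ℂ) (v : Fin 3 → ℂ) :
    f v = ∑ ν, v ν * f (Pi.single ν 1) := by
  conv_lhs => rw [← Finset.univ_sum_single v]
  rw [map_sum]
  refine Finset.sum_congr rfl fun ν _ => ?_
  have : (Pi.single ν (v ν) : Fin 3 → ℂ) = v ν • Pi.single ν 1 := by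
    ext μ; by_cases hμ : μ = ν
    · subst hμ; simp
    · simp [hμ]
  rw [this, map_smul, smul_eq_mul]

theorem SingleParticle.hasDerivAt_line (v : Fin 3 → ℂ) (t : ℂ) :
    HasDerivAt (fun t : ℂ => h.symbol (t • v))
      (∑ ν, v ν * fderiv ℂ h.symbol (t • v) (Pi.single ν 1)) t := by
  rw [← fderiv_apply_eq_sum]
  have h1 : HasDerivAt (fun t : ℂ => t • v) v t := by
    simpa using (hasDerivAt_id t).smul_const v
  exact (h.entire (t • v)).hasFDerivAt.comp_hasDerivAt t h1

theorem SingleParticle.deriv_line (v : Fin 3 → ℂ) :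
    deriv (fun t : ℂ => h.symbol (t • v)) 0 = 0 := by
  rw [(h.hasDerivAt_line v 0).deriv]
  simp [h.deriv_zero]

theorem SingleParticle.deriv_deriv_line (v : Fin 3 → ℝ) :
    (deriv (deriv (fun t : ℂ => h.symbol (t • fun ν => (v ν : ℂ)))) 0).re = h.hess v := by
  have h1 : deriv (fun t : ℂ => h.symbol (t • fun ν => (v ν : ℂ))) =
      fun t => ∑ ν, (v ν : ℂ) * fderiv ℂ h.symbol (t • fun ν => (v ν : ℂ)) (Pi.single ν 1) := by
    funext t; exact (h.hasDerivAt_line _ t).deriv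
  have hdf : ∀ ν : Fin 3, DifferentiableAt ℂ
      (fun p => fderiv ℂ h.symbol p (Pi.single ν 1)) 0 := by
    intro ν
    by_contra hcon
    have h2 := h.hessian_pos.diag_pos (i := ν)
    simp [fderiv_zero_of_not_differentiableAt hcon] at h2
  have h3 : ∀ ν : Fin 3, HasDerivAt
      (fun t : ℂ => fderiv ℂ h.symbol (t • fun ν => (v ν : ℂ)) (Pi.single ν 1))
      (fderiv ℂ (fun p => fderiv ℂ h.symbol p (Pi.single ν 1)) 0 (fun ν => (v ν : ℂ))) 0 := by
    intro ν
    have h4 : HasDerivAt (fun t : ℂ => t • fun ν => (v ν : ℂ)) (fun ν => (v ν : ℂ)) 0 := by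
      simpa using (hasDerivAt_id (0 : ℂ)).smul_const (fun ν => (v ν : ℂ))
    have h5 := hdf ν
    rw [← zero_smul ℂ (fun ν => (v ν : ℂ))] at h5
    have h6 := h5.hasFDerivAt.comp_hasDerivAt (0 : ℂ) h4
    rw [zero_smul] at h6
    exact h6
  rw [h1]
  have h6 := HasDerivAt.fun_sum (u := Finset.univ) (fun ν _ => (h3 ν).const_mul ((v ν : ℝ) : ℂ))
  rw [h6.deriv, Complex.re_sum]
  unfold SingleParticle.hess
  rw [Finset.sum_comm]
  refine Finset.sum_congr rfl fun ν _ => ?_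
  rw [fderiv_apply_eq_sum (fderiv ℂ (fun p => fderiv ℂ h.symbol p (Pi.single ν 1)) 0),
    Finset.mul_sum, Complex.re_sum]
  refine Finset.sum_congr rfl fun μ _ => ?_
  rw [← mul_assoc, ← Complex.ofReal_mul, Complex.re_ofReal_mul]
  ring

theorem SingleParticle.exists_quadratic_le_hat :
    ∃ c : ℝ, 0 < c ∧ ∀ p : Fin 3 → ℝ, (∀ ν, |p ν| ≤ Real.pi) → c * ∑ ν, p ν ^ 2 ≤ h.hat p := by
  -- lower bound of the Hessian on the unit sphere
  obtain ⟨v₀, hv₀, hmin⟩ := (isCompact_sphere (0 : Fin 3 → ℝ) 1).exists_isMinOn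
    (NormedSpace.sphere_nonempty.2 zero_le_one) h.continuous_hess.continuousOn
  have hv₀0 : v₀ ≠ 0 := by
    rintro rfl; simp at hv₀
  set l := h.hess v₀ with hl
  have hlpos : 0 < l := h.hess_pos v₀ hv₀0
  obtain ⟨M, hM⟩ := h.exists_norm_symbol_le 4
  have hM0 : 0 ≤ M := (norm_nonneg _).trans (hM 0 (by simp))
  set δ : ℝ := min 1 (l / (4 * (M + 1))) with hδ
  have hδpos : 0 < δ := by positivity
  -- near the origin
  have hnear : ∀ p : Fin 3 → ℝ, ‖p‖ ≤ δ → l / 4 * ‖p‖ ^ 2 ≤ h.hat p := by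
    intro p hp
    by_cases hp0 : p = 0
    · subst hp0; simpa using h.hat_nonneg 0
    have hpn : 0 < ‖p‖ := norm_pos_iff.2 hp0
    set v : Fin 3 → ℝ := ‖p‖⁻¹ • p with hv
    have hvn : ‖v‖ = 1 := by
      rw [hv, norm_smul, norm_inv, norm_norm, inv_mul_cancel₀ hpn.ne']
    have hvcn : ‖(fun ν => (v ν : ℂ))‖ ≤ 1 := by
      rw [pi_norm_le_iff_of_nonneg zero_le_one]
      intro ν
      rw [Complex.norm_real, ← hvn]
      exact norm_le_pi_norm v ν
    have hq : l ≤ h.hess v := hmin (by simpa using hvn)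
    set g : ℂ → ℂ := fun t => h.symbol (t • fun ν => (v ν : ℂ)) with hg
    have hgd : Differentiable ℂ g := fun t => (h.hasDerivAt_line _ t).differentiableAt
    have h1 := norm_taylor_two_le hgd (M := M) (r := 1) (fun s hs => hM _ (by
      rw [norm_smul]
      calc ‖s‖ * ‖(fun ν => (v ν : ℂ))‖ ≤ 4 * 1 := by
            gcongr; linarith
        _ = 4 := by norm_num)) (‖p‖ : ℂ) (by
          simpa using hp.trans (min_le_left _ _))
    have hg0 : g 0 = 0 := by simp [hg, h.zero]
    have hg1 : deriv g 0 = 0 := h.deriv_line _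
    have hgp : g (‖p‖ : ℂ) = (h.hat p : ℂ) := by
      rw [← h.symbol_ofReal]
      change h.symbol _ = _
      congr 1
      funext ν
      simp only [hv, Pi.smul_apply, smul_eq_mul]
      push_cast
      rw [← mul_assoc, mul_inv_cancel₀, one_mul]
      exact_mod_cast hpn.ne'
    rw [hgp, hg0, hg1] at h1
    have h2 := (Complex.abs_re_le_norm _).trans h1
    have h3 : (((h.hat p : ℂ) - 0 - (‖p‖ : ℂ) * 0 - (‖p‖ : ℂ) ^ 2 / 2 * deriv (deriv g) 0)).re =
        h.hat p - ‖p‖ ^ 2 / 2 * h.hess v := by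
      have : (deriv (deriv g) 0).re = h.hess v := h.deriv_deriv_line v
      have h4 : (‖p‖ : ℂ) ^ 2 / 2 = ((‖p‖ ^ 2 / 2 : ℝ) : ℂ) := by push_cast; ring
      rw [h4, Complex.sub_re, Complex.re_ofReal_mul, this]
      simp
    rw [h3] at h2
    have h5 := (abs_le.1 h2).1
    have h6 : ‖(‖p‖ : ℂ)‖ = ‖p‖ := by simp
    rw [h6] at h5
    have h7 : M * ‖p‖ ≤ l / 4 := by
      have : ‖p‖ ≤ l / (4 * (M + 1)) := hp.trans (min_le_right _ _)
      calc M * ‖p‖ ≤ (M + 1) * (l / (4 * (M + 1))) := by gcongr; linarith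
        _ = l / 4 := by field_simp
    have h8 : M * ‖p‖ ^ 3 ≤ l / 4 * ‖p‖ ^ 2 := by
      calc M * ‖p‖ ^ 3 = (M * ‖p‖) * ‖p‖ ^ 2 := by ring
        _ ≤ _ := by gcongr
    have h9 : ‖p‖ ^ 2 / 2 * l ≤ ‖p‖ ^ 2 / 2 * h.hess v := by gcongr
    linarith
  -- away from the origin
  have hK : IsCompact {p : Fin 3 → ℝ | ‖p‖ ≤ Real.pi ∧ δ ≤ ‖p‖} := by
    have : {p : Fin 3 → ℝ | ‖p‖ ≤ Real.pi ∧ δ ≤ ‖p‖} =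
        closedBall 0 Real.pi ∩ {p | δ ≤ ‖p‖} := by ext; simp
    rw [this]
    exact (isCompact_closedBall _ _).inter_right (isClosed_le continuous_const continuous_norm)
  have hfar : ∃ c : ℝ, 0 < c ∧ ∀ p : Fin 3 → ℝ, ‖p‖ ≤ Real.pi → δ ≤ ‖p‖ → c ≤ h.hat p := by
    rcases Set.eq_empty_or_nonempty {p : Fin 3 → ℝ | ‖p‖ ≤ Real.pi ∧ δ ≤ ‖p‖} with he | hne
    · refine ⟨1, one_pos, fun p h1 h2 => ?_⟩
      have : p ∈ {p : Fin 3 → ℝ | ‖p‖ ≤ Real.pi ∧ δ ≤ ‖p‖} := ⟨h1, h2⟩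
      simp [he] at this
    · obtain ⟨p₁, hp₁, hm⟩ := hK.exists_isMinOn hne h.continuous_hat.continuousOn
      refine ⟨h.hat p₁, h.pos p₁ ?_, fun p h1 h2 => hm ⟨h1, h2⟩⟩
      rintro ⟨z, hz⟩
      have hz0 : ∀ ν, z ν = 0 := by
        intro ν
        have h1 : |p₁ ν| ≤ Real.pi := (norm_le_pi_norm p₁ ν).trans hp₁.1
        rw [hz ν, abs_mul, abs_of_pos Real.two_pi_pos] at h1
        have h2 : |((z ν : ℤ) : ℝ)| < 1 := by
          by_contra hcon
          push Not at hcon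
          nlinarith [Real.pi_pos]
        rw [← Int.cast_abs] at h2
        have h3 : |z ν| < 1 := by exact_mod_cast h2
        simpa using h3
      have hp0 : p₁ = 0 := by funext ν; rw [hz ν, hz0 ν]; simp
      have := hp₁.2
      rw [hp0, norm_zero] at this
      linarith
  obtain ⟨c, hc, hcf⟩ := hfar
  refine ⟨min (l / 4) (c / Real.pi ^ 2) / 3, by positivity, fun p hp => ?_⟩
  have hpn : ‖p‖ ≤ Real.pi := (pi_norm_le_iff_of_nonneg Real.pi_pos.le).2 hp
  have hsum : ∑ ν, p ν ^ 2 ≤ 3 * ‖p‖ ^ 2 := by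
    calc ∑ ν, p ν ^ 2 ≤ ∑ _ν : Fin 3, ‖p‖ ^ 2 := by
          refine Finset.sum_le_sum fun ν _ => ?_
          rw [← sq_abs]
          exact pow_le_pow_left₀ (abs_nonneg _) (norm_le_pi_norm p ν) 2
      _ = _ := by simp
  have hle : min (l / 4) (c / Real.pi ^ 2) * ‖p‖ ^ 2 ≤ h.hat p := by
    by_cases hpd : ‖p‖ ≤ δ
    · exact le_trans (by gcongr; exact min_le_left _ _) (hnear p hpd)
    · refine le_trans ?_ (hcf p hpn (le_of_not_ge hpd))
      calc min (l / 4) (c / Real.pi ^ 2) * ‖p‖ ^ 2 ≤ c / Real.pi ^ 2 * Real.pi ^ 2 := by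
            gcongr; exact min_le_right _ _
        _ = c := by field_simp
  calc min (l / 4) (c / Real.pi ^ 2) / 3 * ∑ ν, p ν ^ 2
      ≤ min (l / 4) (c / Real.pi ^ 2) / 3 * (3 * ‖p‖ ^ 2) := by gcongr
    _ = min (l / 4) (c / Real.pi ^ 2) * ‖p‖ ^ 2 := by ring
    _ ≤ _ := hle

/-- The symbol along a complex line in a coordinate direction. -/
def SingleParticle.slice (p : Fin 3 → ℝ) (ν : Fin 3) (s : ℂ) : ℂ :=
  h.symbol (Function.update (fun μ => (p μ : ℂ)) ν s)

theorem SingleParticle.differentiable_slice (p : Fin 3 → ℝ) (ν : Fin 3) :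
    Differentiable ℂ (h.slice p ν) := by
  intro s
  have hu : DifferentiableAt ℂ (Function.update (fun μ => (p μ : ℂ)) ν) s := by
    rw [differentiableAt_pi]
    intro μ
    by_cases hμ : μ = ν
    · subst hμ; simp
    · simp [Function.update_of_ne hμ]
  exact (h.entire _).comp s hu

theorem SingleParticle.slice_ofReal (p : Fin 3 → ℝ) (ν : Fin 3) (s : ℝ) :
    h.slice p ν s = (h.hat (Function.update p ν s) : ℂ) := by
  rw [← h.symbol_ofReal, SingleParticle.slice]
  congr 1
  funext μ
  by_cases hμ : μ = ν
  · subst hμ; simp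
  · simp [hμ]

theorem SingleParticle.exists_re_slice_ge (r : ℝ) :
    ∃ C : ℝ, 0 ≤ C ∧ ∀ (p : Fin 3 → ℝ) (ν : Fin 3) (η : ℝ), (∀ μ, |p μ| ≤ Real.pi) → |η| ≤ r →
      h.hat p - C * η ^ 2 ≤ (h.slice p ν (p ν + η * Complex.I)).re := by
  obtain ⟨M, hM⟩ := h.exists_norm_symbol_le (Real.pi + r + 2)
  refine ⟨max M 0, le_max_right _ _, fun p ν η hp hη => ?_⟩
  have hr : 0 ≤ r := (abs_nonneg η).trans hη
  set f : ℂ → ℂ := fun s => h.slice p ν (p ν + s) with hf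
  have hfd : Differentiable ℂ f :=
    (h.differentiable_slice p ν).comp ((differentiable_const _).add differentiable_id)
  have h1 := norm_taylor_one_le hfd (M := M) (r := r) (fun s hs => hM _ (by
    rw [pi_norm_le_iff_of_nonneg (by positivity)]
    intro μ
    by_cases hμ : μ = ν
    · subst hμ
      simp only [Function.update_self]
      calc ‖(p μ : ℂ) + s‖ ≤ ‖(p μ : ℂ)‖ + ‖s‖ := norm_add_le _ _
        _ ≤ Real.pi + (r + 2) := by
            gcongr
            simpa using hp μ
        _ = _ := by ring
    · simp only [Function.update_of_ne hμ, Complex.norm_real, Real.norm_eq_abs]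
      linarith [hp μ])) (η * Complex.I) (by simpa using hη)
  have him : (deriv f 0).im = 0 := im_deriv_zero_of_real hfd (fun x => by
    simp only [hf]
    rw [← Complex.ofReal_add, h.slice_ofReal, Complex.ofReal_im])
  have hf0 : f 0 = (h.hat p : ℂ) := by
    simp only [hf, add_zero]
    rw [h.slice_ofReal, Function.update_eq_self]
  have h2 := (Complex.abs_re_le_norm _).trans h1
  have h3 : (f (η * Complex.I) - f 0 - η * Complex.I * deriv f 0).re =
      (f (η * Complex.I)).re - h.hat p := by
    rw [hf0]; simp [him]
  rw [h3] at h2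
  have h4 := (abs_le.1 h2).1
  have h5 : ‖(η : ℂ) * Complex.I‖ ^ 2 = η ^ 2 := by simp
  rw [h5] at h4
  have h6 : M * η ^ 2 ≤ max M 0 * η ^ 2 := by gcongr; exact le_max_left _ _
  linarith

theorem SingleParticle.slice_periodic (p : Fin 3 → ℝ) (ν : Fin 3) (s : ℂ) :
    h.slice p ν (s + 2 * Real.pi) = h.slice p ν s := by
  have hreal : ∀ x : ℝ, h.slice p ν ((x : ℂ) + 2 * Real.pi) = h.slice p ν x := by
    intro x
    have e1 : ((x : ℂ) + 2 * Real.pi) = ((x + 2 * Real.pi : ℝ) : ℂ) := by push_cast; ring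
    rw [e1, h.slice_ofReal, h.slice_ofReal, ← h.symbol_ofReal, ← h.symbol_ofReal, h.fourier,
      h.fourier]
    refine tsum_congr fun z => ?_
    congr 1
    have : (∑ μ, ((Function.update p ν (x + 2 * Real.pi) μ : ℝ) : ℂ) * (z μ : ℂ)) =
        (∑ μ, ((Function.update p ν x μ : ℝ) : ℂ) * (z μ : ℂ)) + 2 * Real.pi * z ν := by
      rw [← Finset.add_sum_erase _ _ (Finset.mem_univ ν),
        ← Finset.add_sum_erase _ (fun μ => ((Function.update p ν x μ : ℝ) : ℂ) * (z μ : ℂ))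
          (Finset.mem_univ ν)]
      have : ∑ μ ∈ Finset.univ.erase ν, ((Function.update p ν (x + 2 * Real.pi) μ : ℝ) : ℂ) *
          (z μ : ℂ) = ∑ μ ∈ Finset.univ.erase ν, ((Function.update p ν x μ : ℝ) : ℂ) *
          (z μ : ℂ) := by
        refine Finset.sum_congr rfl fun μ hμ => ?_
        rw [Function.update_of_ne (Finset.ne_of_mem_erase hμ),
          Function.update_of_ne (Finset.ne_of_mem_erase hμ)]
      rw [this]
      simp only [Function.update_self]
      push_cast
      ring
    rw [this, mul_add, Complex.exp_add]
    have e2 : Complex.exp (-Complex.I * (2 * Real.pi * z ν)) = 1 := by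
      rw [Complex.exp_eq_one_iff]
      exact ⟨-z ν, by push_cast; ring⟩
    rw [e2, mul_one]
  have hd := h.differentiable_slice p ν
  have ha1 : AnalyticOnNhd ℂ (fun s => h.slice p ν (s + 2 * Real.pi)) Set.univ :=
    DifferentiableOn.analyticOnNhd
      (hd.comp (differentiable_id.add (differentiable_const _))).differentiableOn isOpen_univ
  have ha2 : AnalyticOnNhd ℂ (h.slice p ν) Set.univ :=
    hd.differentiableOn.analyticOnNhd isOpen_univ
  have hfreq : ∃ᶠ z in nhdsWithin (0 : ℂ) {0}ᶜ,
      h.slice p ν (z + 2 * Real.pi) = h.slice p ν z := by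
    have ht : Filter.Tendsto (fun x : ℝ => (x : ℂ)) (nhdsWithin 0 {0}ᶜ)
        (nhdsWithin (0 : ℂ) {0}ᶜ) := by
      refine tendsto_nhdsWithin_of_tendsto_nhds_of_eventually_within _ ?_ ?_
      · have : Filter.Tendsto (fun x : ℝ => (x : ℂ)) (nhds 0) (nhds ((0 : ℝ) : ℂ)) :=
          Complex.continuous_ofReal.tendsto 0
        simpa using this.mono_left nhdsWithin_le_nhds
      · filter_upwards [self_mem_nhdsWithin] with x hx
        simpa using hx
    exact ht.frequently (Filter.Frequently.of_forall hreal)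
  have := ha1.eq_of_frequently_eq ha2 hfreq
  exact congrFun this s

end Symbol

end ParabolicBlockSpin

namespace ParabolicBlockSpin

open MeasureTheory UnitAddTorus

section Shift

theorem integral_eq_integral_add_mul_I {G : ℂ → ℂ} (hG : Differentiable ℂ G)
    (hper : ∀ s, G (s + 1) = G s) (σ : ℝ) :
    ∫ x in (-(1 / 2) : ℝ)..(1 / 2), G x = ∫ x in (-(1 / 2) : ℝ)..(1 / 2), G (x + σ * Complex.I) := by
  have h := Complex.integral_boundary_rect_eq_zero_of_differentiableOn G
    (((-(1 / 2) : ℝ) : ℂ)) ((((1 / 2 : ℝ)) : ℂ) + σ * Complex.I) hG.differentiableOn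
  simp only [Complex.add_re, Complex.add_im, Complex.ofReal_re, Complex.ofReal_im, Complex.mul_re,
    Complex.mul_im, Complex.I_re, Complex.I_im, mul_zero, mul_one, sub_zero, zero_add, add_zero]
    at h
  have h2 : ∀ y : ℝ, G (((1 / 2 : ℝ) : ℂ) + y * Complex.I) =
      G (((-(1 / 2) : ℝ) : ℂ) + y * Complex.I) := by
    intro y
    rw [← hper (((-(1 / 2) : ℝ) : ℂ) + y * Complex.I)]
    congr 1
    push_cast
    ring
  simp only [h2] at h
  have h3 : ∀ x : ℝ, (x : ℂ) + ((0 : ℝ) : ℂ) * Complex.I = x := by intro x; simp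
  simp only [h3] at h
  linear_combination h

/-- The uniform measure on the centred unit interval. -/
abbrev unitMeasure : Measure ℝ := volume.restrict (Set.Ioc (-(1 / 2)) (1 / 2))

theorem integral_unitMeasure {E : Type*} [NormedAddCommGroup E] [NormedSpace ℝ E] (f : ℝ → E) :
    ∫ x, f x ∂unitMeasure = ∫ x in (-(1 / 2) : ℝ)..(1 / 2), f x := by
  rw [intervalIntegral.integral_of_le (by norm_num)]

theorem ae_unitMeasure : ∀ᵐ x ∂unitMeasure, |x| ≤ 1 / 2 := by
  filter_upwards [ae_restrict_mem measurableSet_Ioc] with x hx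
  exact abs_le.2 ⟨hx.1.le, hx.2⟩

theorem ae_pi_unitMeasure {d : ℕ} :
    ∀ᵐ x ∂(Measure.pi fun _ : Fin d => unitMeasure), ∀ i, |x i| ≤ 1 / 2 := by
  rw [ae_all_iff]
  intro i
  exact (Measure.quasiMeasurePreserving_eval (fun _ : Fin d => unitMeasure) i).ae ae_unitMeasure

theorem norm_integral_pi_le_of_forall_slice {g : (Fin 3 → ℝ) → ℂ} (hg : Continuous g) (ν : Fin 3)
    {b : ℝ → ℝ} (hb : Continuous b) {C : ℝ}
    (H : ∀ q : Fin 2 → ℝ, (∀ j, |q j| ≤ 1 / 2) →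
      ‖∫ s in (-(1 / 2) : ℝ)..(1 / 2), g (ν.insertNth s q)‖ ≤ C * ∏ j, b (q j)) :
    ‖∫ x, g x ∂(Measure.pi fun _ : Fin 3 => unitMeasure)‖ ≤
      C * (∫ s in (-(1 / 2) : ℝ)..(1 / 2), b s) ^ 2 := by
  have hmp := measurePreserving_piFinSuccAbove (fun _ : Fin 3 => unitMeasure) ν
  have h1 := (hmp.symm).integral_comp' g
  rw [← h1]
  simp only [MeasurableEquiv.piFinSuccAbove_symm_apply, Fin.insertNthEquiv, Equiv.coe_fn_mk]
  have hcont : Continuous fun z : ℝ × (Fin 2 → ℝ) => g (ν.insertNth z.1 z.2) := by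
    refine hg.comp ?_
    exact Continuous.finInsertNth ν continuous_fst continuous_snd
  obtain ⟨M, hM⟩ := (isCompact_closedBall (0 : Fin 3 → ℝ) (1 / 2)).exists_bound_of_continuousOn
    hg.continuousOn
  have hint : Integrable (fun z : ℝ × (Fin 2 → ℝ) => g (ν.insertNth z.1 z.2))
      (unitMeasure.prod (Measure.pi fun _ : Fin 2 => unitMeasure)) := by
    refine Integrable.of_bound hcont.aestronglyMeasurable M ?_
    have hae : ∀ᵐ x ∂(Measure.pi fun _ : Fin 3 => unitMeasure), ‖g x‖ ≤ M := by
      filter_upwards [ae_pi_unitMeasure] with x hx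
      refine hM x ?_
      rw [mem_closedBall_zero_iff, pi_norm_le_iff_of_nonneg (by norm_num)]
      exact hx
    exact hmp.symm.quasiMeasurePreserving.ae hae
  rw [integral_prod_symm _ hint]
  have hbint : Integrable (fun q : Fin 2 → ℝ => C * ∏ j, b (q j))
      (Measure.pi fun _ : Fin 2 => unitMeasure) := by
    refine Integrable.const_mul ?_ C
    refine Integrable.fintype_prod (f := fun _ : Fin 2 => b) fun _ => ?_
    exact (hb.integrableOn_Icc (a := -(1 / 2)) (b := 1 / 2)).mono_set Set.Ioc_subset_Icc_self
  refine (norm_integral_le_of_norm_le hbint ?_).trans ?_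
  · filter_upwards [ae_pi_unitMeasure] with q hq
    rw [integral_unitMeasure]
    exact H q hq
  · rw [integral_const_mul, integral_fintype_prod_eq_prod (fun _ : Fin 2 => b)]
    simp only [Finset.prod_const, Finset.card_univ, Fintype.card_fin]
    rw [integral_unitMeasure]

theorem integral_exp_neg_mul_sq_le {b : ℝ} (hb : 0 < b) :
    ∫ s in (-(1 / 2) : ℝ)..(1 / 2), Real.exp (-b * s ^ 2) ≤ √(Real.pi / b) := by
  rw [← integral_gaussian b, intervalIntegral.integral_of_le (by norm_num)]
  exact setIntegral_le_integral (integrable_exp_neg_mul_sq hb)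
    (Filter.Eventually.of_forall fun x => (Real.exp_pos _).le)

end Shift

section HeatKernel

variable (h : SingleParticle)

/-- The symbol as a continuous function on the torus of real momenta, in units of `2 π`. -/
def SingleParticle.torusSymbol : C(UnitAddTorus (Fin 3), ℂ) :=
  ∑' z : Fin 3 → ℤ, h.kernel z • mFourier (-z)

theorem mFourier_coe (n : Fin 3 → ℤ) (q : Fin 3 → ℝ) :
    mFourier n (fun ν => (q ν : UnitAddCircle)) =
      Complex.exp (2 * Real.pi * Complex.I * ∑ ν, (n ν : ℂ) * (q ν : ℂ)) := by
  have : mFourier n (fun ν => (q ν : UnitAddCircle)) =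
      ∏ ν, fourier (n ν) (q ν : UnitAddCircle) := rfl
  rw [this, Finset.mul_sum, Complex.exp_sum]
  refine Finset.prod_congr rfl fun ν _ => ?_
  rw [fourier_coe_apply]
  congr 1
  push_cast
  ring

theorem SingleParticle.torusSymbol_coe (q : Fin 3 → ℝ) :
    h.torusSymbol (fun ν => (q ν : UnitAddCircle)) =
      h.symbol (fun ν => ((2 * Real.pi * q ν : ℝ) : ℂ)) := by
  have hs : Summable fun z : Fin 3 → ℤ => h.kernel z • (mFourier (-z) : C(_, ℂ)) := by
    refine Summable.of_norm ?_
    simpa only [norm_smul, mFourier_norm, mul_one] using h.summable_kernel.norm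
  have h1 := (ContinuousMap.evalCLM ℂ (fun ν => (q ν : UnitAddCircle))).hasSum hs.hasSum
  have h2 : h.torusSymbol (fun ν => (q ν : UnitAddCircle)) = _ := h1.tsum_eq.symm
  rw [h2, h.fourier]
  refine tsum_congr fun z => ?_
  simp only [ContinuousMap.evalCLM_apply, ContinuousMap.smul_apply, smul_eq_mul, mFourier_coe]
  congr 2
  rw [Finset.mul_sum, Finset.mul_sum]
  refine Finset.sum_congr rfl fun ν _ => ?_
  simp only [Pi.neg_apply]
  push_cast
  ring

/-- The symbol of the semigroup `exp (-k h₀)` on the torus of momenta. -/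
def SingleParticle.heatSymbol (k : ℕ) : C(UnitAddTorus (Fin 3), ℂ) where
  toFun t := Complex.exp (-(k : ℂ) * h.torusSymbol t)
  continuous_toFun := by fun_prop

/-- The kernel of the semigroup `exp (-k h₀)` on `ℤ³`. -/
def SingleParticle.heatKernel (k : ℕ) (z : Fin 3 → ℤ) : ℂ := mFourierCoeff (h.heatSymbol k) (-z)

/-- The integrand of the Fourier integral for the heat kernel. -/
def SingleParticle.heatIntegrand (k : ℕ) (z : Fin 3 → ℤ) (x : Fin 3 → ℂ) : ℂ :=
  Complex.exp (-(k : ℂ) * h.symbol (fun ν => 2 * Real.pi * x ν)) *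
    Complex.exp (2 * Real.pi * Complex.I * ∑ ν, (z ν : ℂ) * x ν)

theorem SingleParticle.heatKernel_eq (k : ℕ) (z : Fin 3 → ℤ) :
    h.heatKernel k z =
      ∫ x, h.heatIntegrand k z (fun ν => (x ν : ℂ)) ∂(Measure.pi fun _ : Fin 3 => unitMeasure) := by
  have hset : {x : Fin 3 → ℝ | ∀ i, x i ∈ Set.Ioc (-(1 / 2) : ℝ) (-(1 / 2) + 1)} =
      Set.univ.pi fun _ => Set.Ioc (-(1 / 2)) (1 / 2) := by
    ext x; simp only [Set.mem_ofPred_eq, Set.mem_univ_pi]; norm_num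
  rw [SingleParticle.heatKernel, mFourierCoeff_eq_integral _ _ (fun _ => -(1 / 2)), hset,
    volume_pi, Measure.restrict_pi_pi]
  refine integral_congr_ae (Filter.Eventually.of_forall fun x => ?_)
  simp only [smul_eq_mul, neg_neg, mFourier_coe, SingleParticle.heatIntegrand]
  rw [mul_comm]
  congr 1
  change Complex.exp (-(k : ℂ) * h.torusSymbol (fun ν => (x ν : UnitAddCircle))) = _
  rw [h.torusSymbol_coe]
  push_cast
  rfl

theorem SingleParticle.heatIntegrand_update (k : ℕ) (z : Fin 3 → ℤ) (x : Fin 3 → ℝ) (ν : Fin 3)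
    (s : ℂ) : h.heatIntegrand k z (Function.update (fun μ => (x μ : ℂ)) ν s) =
      Complex.exp (-(k : ℂ) * h.slice (fun μ => 2 * Real.pi * x μ) ν (2 * Real.pi * s)) *
      (Complex.exp (2 * Real.pi * Complex.I * ∑ μ ∈ Finset.univ.erase ν, (z μ : ℂ) * x μ) *
      Complex.exp (2 * Real.pi * Complex.I * (z ν * s))) := by
  unfold SingleParticle.heatIntegrand SingleParticle.slice
  congr 1
  · congr 3
    funext μ
    by_cases hμ : μ = ν
    · subst hμ; simp
    · simp [Function.update_of_ne hμ]
  · rw [← Complex.exp_add, ← Finset.add_sum_erase _ _ (Finset.mem_univ ν), Function.update_self]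
    congr 1
    rw [mul_add, add_comm]
    congr 2
    refine Finset.sum_congr rfl fun μ hμ => ?_
    rw [Function.update_of_ne (Finset.ne_of_mem_erase hμ)]

theorem SingleParticle.exists_norm_heatKernel_le_coord (r : ℝ) :
    ∃ C₁ C₂ : ℝ, 0 ≤ C₁ ∧ 0 ≤ C₂ ∧ ∀ (k : ℕ) (z : Fin 3 → ℤ) (ν : Fin 3) (η : ℝ), 1 ≤ k → 0 ≤ η →
      η ≤ r → ‖h.heatKernel k z‖ ≤
        C₁ * (√(k : ℝ))⁻¹ ^ 3 * Real.exp (C₂ * k * η ^ 2) * Real.exp (-(η * |(z ν : ℝ)|)) := by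
  obtain ⟨c, hc, hcq⟩ := h.exists_quadratic_le_hat
  obtain ⟨C₂, hC₂, hC⟩ := h.exists_re_slice_ge r
  set κ : ℝ := c * (2 * Real.pi) ^ 2 with hκ
  have hκpos : 0 < κ := by positivity
  refine ⟨√(Real.pi / κ) ^ 3, C₂, by positivity, hC₂, fun k z ν η hk hη hηr => ?_⟩
  have hk0 : (0 : ℝ) < k := by exact_mod_cast hk
  obtain ⟨σ, hση, hσz⟩ : ∃ τ : ℝ, |τ| = η ∧ -((z ν : ℝ) * τ) = -(η * |(z ν : ℝ)|) := by
    rcases le_total 0 (z ν : ℝ) with hz | hz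
    · exact ⟨η, abs_of_nonneg hη, by rw [abs_of_nonneg hz]; ring⟩
    · exact ⟨-η, by rw [abs_neg, abs_of_nonneg hη], by rw [abs_of_nonpos hz]; ring⟩
  have hση2 : σ ^ 2 = η ^ 2 := by rw [← hση, sq_abs]
  set σ' : ℝ := σ / (2 * Real.pi) with hσ'
  have hσ'2 : 2 * Real.pi * σ' = σ := by rw [hσ']; field_simp
  set b : ℝ → ℝ := fun s => Real.exp (-(k * κ) * s ^ 2) with hb
  have hbint := integral_exp_neg_mul_sq_le (b := k * κ) (by positivity)
  have hbint0 : 0 ≤ ∫ s in (-(1 / 2) : ℝ)..(1 / 2), b s :=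
    intervalIntegral.integral_nonneg (by norm_num) fun s _ => (Real.exp_pos _).le
  have hgc : Continuous fun x : Fin 3 → ℝ => h.heatIntegrand k z (fun ν => (x ν : ℂ)) := by
    unfold SingleParticle.heatIntegrand
    have := h.entire.continuous
    fun_prop
  set E := Real.exp (C₂ * k * η ^ 2) * Real.exp (-(η * |(z ν : ℝ)|)) with hE
  rw [h.heatKernel_eq]
  have hmain := norm_integral_pi_le_of_forall_slice hgc ν (b := b) (by fun_prop)
    (C := E * ∫ s in (-(1 / 2) : ℝ)..(1 / 2), b s) (by
    intro q hq
    set G : ℂ → ℂ := fun s => h.heatIntegrand k z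
      (Function.update (fun μ => ((ν.insertNth (0 : ℝ) q : Fin 3 → ℝ) μ : ℂ)) ν s) with hG
    set x₀ : Fin 3 → ℝ := ν.insertNth (0 : ℝ) q with hx₀
    have hGd : Differentiable ℂ G := by
      have h1 := h.differentiable_slice (fun μ => 2 * Real.pi * x₀ μ) ν
      have h2 : G = fun s => _ := funext fun s => h.heatIntegrand_update k z x₀ ν s
      rw [h2]
      fun_prop
    have hGper : ∀ s, G (s + 1) = G s := by
      intro s
      simp only [hG, h.heatIntegrand_update]
      rw [mul_add (2 * (Real.pi : ℂ)) s 1, mul_one, h.slice_periodic]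
      congr 2
      rw [mul_add (z ν : ℂ), mul_add, Complex.exp_add, mul_one]
      have : Complex.exp (2 * Real.pi * Complex.I * (z ν : ℂ)) = 1 := by
        rw [Complex.exp_eq_one_iff]; exact ⟨z ν, by ring⟩
      rw [this, mul_one]
    have hins : ∀ s : ℝ, h.heatIntegrand k z
        (fun μ => ((ν.insertNth s q : Fin 3 → ℝ) μ : ℂ)) = G s := by
      intro s
      simp only [hG]
      congr 1
      funext μ
      by_cases hμ : μ = ν
      · subst hμ; simp
      · obtain ⟨j, rfl⟩ := Fin.exists_succAbove_eq hμ
        rw [Function.update_of_ne hμ]; simp [hx₀]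
    simp only [hins]
    rw [integral_eq_integral_add_mul_I hGd hGper σ']
    have hbd : ∀ s : ℝ, s ∈ Set.Ioc (-(1 / 2) : ℝ) (1 / 2) →
        ‖G (s + σ' * Complex.I)‖ ≤ E * (∏ j, b (q j)) * b s := by
      intro s hs
      set p : Fin 3 → ℝ := fun μ => 2 * Real.pi * (ν.insertNth s q : Fin 3 → ℝ) μ with hp
      have hpb : ∀ μ, |p μ| ≤ Real.pi := by
        intro μ
        have : |(ν.insertNth s q : Fin 3 → ℝ) μ| ≤ 1 / 2 := by
          by_cases hμ : μ = ν
          · subst hμ; simp only [Fin.insertNth_apply_same]; exact abs_le.2 ⟨hs.1.le, hs.2⟩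
          · obtain ⟨j, rfl⟩ := Fin.exists_succAbove_eq hμ
            simpa using hq j
        rw [hp, abs_mul, abs_of_pos Real.two_pi_pos]
        nlinarith [Real.pi_pos]
      have h1 := hC p ν σ hpb (hση.le.trans hηr)
      have h2 := hcq p hpb
      have hslice : h.slice (fun μ => 2 * Real.pi * x₀ μ) ν (2 * Real.pi * (s + σ' * Complex.I)) =
          h.slice p ν (p ν + σ * Complex.I) := by
        unfold SingleParticle.slice
        congr 1
        funext μ
        by_cases hμ : μ = ν
        · subst hμ
          simp only [Function.update_self, hp, Fin.insertNth_apply_same, ← hσ'2]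
          push_cast
          ring
        · obtain ⟨j, rfl⟩ := Fin.exists_succAbove_eq hμ
          rw [Function.update_of_ne hμ, Function.update_of_ne hμ]
          simp [hx₀, hp]
      have hsum : ∑ μ, p μ ^ 2 = (2 * Real.pi) ^ 2 * (s ^ 2 + ∑ j, q j ^ 2) := by
        rw [Fin.sum_univ_succAbove _ ν]
        simp only [hp, Fin.insertNth_apply_same, Fin.insertNth_apply_succAbove, mul_pow]
        rw [← Finset.mul_sum]; ring
      rw [hG]
      simp only
      rw [h.heatIntegrand_update, norm_mul, norm_mul, Complex.norm_exp, Complex.norm_exp,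
        Complex.norm_exp, hslice]
      have e1 : (2 * Real.pi * Complex.I * ∑ μ ∈ Finset.univ.erase ν, (z μ : ℂ) * (x₀ μ : ℂ)).re
          = 0 := by
        have : (2 * Real.pi * Complex.I * ∑ μ ∈ Finset.univ.erase ν, (z μ : ℂ) * (x₀ μ : ℂ)) =
            ((2 * Real.pi * ∑ μ ∈ Finset.univ.erase ν, (z μ : ℝ) * x₀ μ : ℝ) : ℂ) * Complex.I := by
          push_cast; ring
        rw [this]; simp
      have e2 : (2 * Real.pi * Complex.I * ((z ν : ℂ) * (s + σ' * Complex.I))).re =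
          -(η * |(z ν : ℝ)|) := by
        rw [← hσz, ← hσ'2]
        have : (2 * Real.pi * Complex.I * ((z ν : ℂ) * (s + σ' * Complex.I))) =
            ((2 * Real.pi * z ν * s : ℝ) : ℂ) * Complex.I + ((-(2 * Real.pi * z ν * σ') : ℝ) : ℂ) := by
          push_cast
          linear_combination (2 * Real.pi * z ν * σ' : ℂ) * Complex.I_mul_I
        rw [this, Complex.add_re, Complex.re_ofReal_mul]
        simp only [Complex.I_re, mul_zero, zero_add, Complex.ofReal_re]
        ring
      have e3 : (-(k : ℂ) * h.slice p ν (p ν + σ * Complex.I)).re =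
          -(k * (h.slice p ν (p ν + σ * Complex.I)).re) := by
        rw [← Complex.ofReal_natCast, ← Complex.ofReal_neg, Complex.re_ofReal_mul]; ring
      rw [e1, e2, e3, Real.exp_zero, one_mul, hE, hb]
      simp only
      rw [← Real.exp_sum, ← Real.exp_add, ← Real.exp_add, ← Real.exp_add, ← Real.exp_add]
      refine Real.exp_le_exp.2 ?_
      have h3 : c * ((2 * Real.pi) ^ 2 * (s ^ 2 + ∑ j, q j ^ 2)) - C₂ * η ^ 2 ≤
          (h.slice p ν (p ν + σ * Complex.I)).re := by
        rw [← hsum, ← hση2]; linarith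
      have h4 := mul_le_mul_of_nonneg_left h3 hk0.le
      rw [← Finset.mul_sum]
      have h5 : (k : ℝ) * (c * ((2 * Real.pi) ^ 2 * (s ^ 2 + ∑ j, q j ^ 2)) - C₂ * η ^ 2) =
        k * κ * s ^ 2 + k * κ * ∑ j, q j ^ 2 - C₂ * k * η ^ 2 := by rw [hκ]; ring
      rw [h5] at h4
      linarith
    refine (intervalIntegral.norm_integral_le_of_norm_le (by norm_num)
      (Filter.Eventually.of_forall hbd) ?_).trans ?_
    · exact Continuous.intervalIntegrable (by fun_prop) _ _
    · rw [intervalIntegral.integral_const_mul]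
      exact le_of_eq (by ring))
  refine hmain.trans ?_
  have hroot : √(Real.pi / (k * κ)) = √(Real.pi / κ) * (√(k : ℝ))⁻¹ := by
    rw [← Real.sqrt_inv, ← Real.sqrt_mul (by positivity)]
    congr 1
    field_simp
  calc (E * ∫ s in (-(1 / 2) : ℝ)..(1 / 2), b s) * (∫ s in (-(1 / 2) : ℝ)..(1 / 2), b s) ^ 2
      = E * (∫ s in (-(1 / 2) : ℝ)..(1 / 2), b s) ^ 3 := by ring
    _ ≤ E * (√(Real.pi / (k * κ))) ^ 3 := by gcongr
    _ = _ := by rw [hroot, hE]; ring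

theorem SingleParticle.exists_norm_heatKernel_le (r : ℝ) :
    ∃ C₁ C₂ : ℝ, 0 ≤ C₁ ∧ 0 ≤ C₂ ∧ ∀ (k : ℕ) (z : Fin 3 → ℤ) (η : ℝ), 1 ≤ k → 0 ≤ η → η ≤ r →
      ‖h.heatKernel k z‖ ≤ C₁ * (√(k : ℝ))⁻¹ ^ 3 * Real.exp (C₂ * k * η ^ 2) *
        ∏ ν, Real.exp (-(η / 3 * |(z ν : ℝ)|)) := by
  obtain ⟨C₁, C₂, h1, h2, H⟩ := h.exists_norm_heatKernel_le_coord r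
  refine ⟨C₁, C₂, h1, h2, fun k z η hk hη hηr => ?_⟩
  obtain ⟨ν, -, hν⟩ := Finset.exists_max_image Finset.univ (fun ν => |(z ν : ℝ)|)
    ⟨0, Finset.mem_univ _⟩
  refine (H k z ν η hk hη hηr).trans ?_
  gcongr
  rw [← Real.exp_sum]
  refine Real.exp_le_exp.2 ?_
  have h3 : ∑ μ, -(η / 3 * |(z μ : ℝ)|) ≥ ∑ _μ : Fin 3, -(η / 3 * |(z ν : ℝ)|) := by
    refine Finset.sum_le_sum fun μ _ => ?_
    have := hν μ (Finset.mem_univ _)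
    have : η / 3 * |(z μ : ℝ)| ≤ η / 3 * |(z ν : ℝ)| := by gcongr
    linarith
  refine le_trans (le_of_eq ?_) h3
  simp
  ring

end HeatKernel

section ExpSums

theorem summable_exp_neg_mul_abs_int {α : ℝ} (hα : 0 < α) :
    Summable fun z : ℤ => Real.exp (-(α * |(z : ℝ)|)) := by
  have h0 : Summable fun n : ℕ => Real.exp (-(α * n)) := by
    have := Real.summable_exp_nat_mul_iff (a := -α) |>.2 (by linarith)
    refine this.congr fun n => ?_
    congr 1; ring
  refine Summable.of_nat_of_neg ?_ ?_
  · simpa using h0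
  · simpa using h0

theorem one_sub_exp_neg_inv_le {α : ℝ} (hα : 0 < α) : (1 - Real.exp (-α))⁻¹ ≤ 1 + 1 / α := by
  have h1 : Real.exp (-α) ≤ 1 / (1 + α) := by
    rw [Real.exp_neg, ← one_div]
    exact one_div_le_one_div_of_le (by linarith) (by linarith [Real.add_one_le_exp α])
  have h2 : α / (1 + α) ≤ 1 - Real.exp (-α) := by
    have : α / (1 + α) = 1 - 1 / (1 + α) := by field_simp; ring_nf
    linarith
  calc (1 - Real.exp (-α))⁻¹ ≤ (α / (1 + α))⁻¹ := inv_anti₀ (by positivity) h2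
    _ = 1 + 1 / α := by field_simp; ring

theorem tsum_exp_neg_mul_abs_int_le {α : ℝ} (hα : 0 < α) :
    ∑' z : ℤ, Real.exp (-(α * |(z : ℝ)|)) ≤ 2 + 2 / α := by
  have h0 : Summable fun n : ℕ => Real.exp (-(α * n)) := by
    have := Real.summable_exp_nat_mul_iff (a := -α) |>.2 (by linarith)
    refine this.congr fun n => ?_
    congr 1; ring
  have h1 : ∑' n : ℕ, Real.exp (-(α * n)) = (1 - Real.exp (-α))⁻¹ := by
    rw [← tsum_geometric_of_lt_one (Real.exp_pos _).le (Real.exp_lt_one_iff.2 (neg_neg_of_pos hα))]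
    refine tsum_congr fun n => ?_
    rw [← Real.exp_nat_mul]; congr 1; ring
  have h2 := one_sub_exp_neg_inv_le hα
  have hs := (Summable.of_nat_of_neg (f := fun z : ℤ => Real.exp (-(α * |(z : ℝ)|)))
    (by simpa using h0) (by simpa using h0))
  rw [tsum_of_nat_of_neg_add_one (by simpa using h0)]
  · have h3 : ∑' n : ℕ, Real.exp (-(α * |((-((n : ℤ) + 1) : ℤ) : ℝ)|)) ≤
        ∑' n : ℕ, Real.exp (-(α * n)) := by
      refine Summable.tsum_le_tsum (fun n => ?_) ?_ h0
      · refine Real.exp_le_exp.2 ?_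
        push_cast
        rw [abs_neg, abs_of_nonneg (by positivity : (0 : ℝ) ≤ (n : ℝ) + 1)]
        nlinarith
      · have := (summable_nat_add_iff 1).2 h0
        refine this.congr fun n => ?_
        push_cast
        rw [abs_neg, abs_of_nonneg (by positivity : (0 : ℝ) ≤ (n : ℝ) + 1)]
    have h4 : ∑' n : ℕ, Real.exp (-(α * |(((n : ℕ) : ℤ) : ℝ)|)) =
        ∑' n : ℕ, Real.exp (-(α * n)) := by simp
    rw [h4]
    have h5 : 2 / α = 1 / α + 1 / α := by ring
    linarith
  · have := (summable_nat_add_iff 1).2 h0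
    refine this.congr fun n => ?_
    push_cast
    rw [abs_neg, abs_of_nonneg (by positivity : (0 : ℝ) ≤ (n : ℝ) + 1)]

theorem hasSum_prod_of_nonneg {n : ℕ} {g : Fin n → ℤ → ℝ} {S : Fin n → ℝ} (h0 : ∀ i z, 0 ≤ g i z)
    (hg : ∀ i, HasSum (g i) (S i)) : HasSum (fun z : Fin n → ℤ => ∏ i, g i (z i)) (∏ i, S i) := by
  induction n with
  | zero => simp
  | succ n ih =>
    have h1 := ih (g := fun i => g i.succ) (S := fun i => S i.succ) (fun i z => h0 _ z)
      (fun i => hg _)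
    have hn1 : 0 ≤ g 0 := fun z => h0 0 z
    have hn2 : 0 ≤ fun z : Fin n → ℤ => ∏ i : Fin n, g i.succ (z i) :=
      fun z => Finset.prod_nonneg fun i _ => h0 _ _
    have hsm := Summable.mul_of_nonneg (hg 0).summable h1.summable hn1 hn2
    have h2 : HasSum (fun x : ℤ × (Fin n → ℤ) => g 0 x.1 * ∏ i, g i.succ (x.2 i))
        (S 0 * ∏ i : Fin n, S i.succ) :=
      HasSum.mul (f := g 0) (g := fun z : Fin n → ℤ => ∏ i : Fin n, g i.succ (z i)) (hg 0) h1 hsm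
    rw [Fin.prod_univ_succ, ← (Fin.consEquiv (fun _ : Fin (n + 1) => ℤ)).hasSum_iff]
    have h3 : ((fun z : Fin (n + 1) → ℤ => ∏ i, g i (z i)) ∘
        (Fin.consEquiv (fun _ : Fin (n + 1) => ℤ))) =
        fun x : ℤ × (Fin n → ℤ) => g 0 x.1 * ∏ i, g i.succ (x.2 i) := by
      funext x
      simp [Fin.consEquiv, Fin.prod_univ_succ]
    rw [h3]
    exact h2

theorem summable_prod_exp_neg_mul_abs {α : ℝ} (hα : 0 < α) :
    Summable fun z : Fin 3 → ℤ => ∏ ν, Real.exp (-(α * |(z ν : ℝ)|)) :=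
  (hasSum_prod_of_nonneg (g := fun _ z => Real.exp (-(α * |(z : ℝ)|)))
    (fun _ _ => (Real.exp_pos _).le)
    (fun _ => (summable_exp_neg_mul_abs_int hα).hasSum)).summable

theorem tsum_prod_exp_neg_mul_abs_le {α : ℝ} (hα : 0 < α) :
    ∑' z : Fin 3 → ℤ, ∏ ν, Real.exp (-(α * |(z ν : ℝ)|)) ≤ (2 + 2 / α) ^ 3 := by
  rw [(hasSum_prod_of_nonneg (g := fun _ z => Real.exp (-(α * |(z : ℝ)|)))
    (fun _ _ => (Real.exp_pos _).le)
    (fun _ => (summable_exp_neg_mul_abs_int hα).hasSum)).tsum_eq]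
  simp only [Finset.prod_const, Finset.card_univ, Fintype.card_fin]
  have := tsum_exp_neg_mul_abs_int_le hα
  have h0 : 0 ≤ ∑' z : ℤ, Real.exp (-(α * |(z : ℝ)|)) := tsum_nonneg fun _ => (Real.exp_pos _).le
  gcongr

end ExpSums

section HeatSeries

variable (h : SingleParticle)

theorem SingleParticle.summable_heatKernel {k : ℕ} (hk : 1 ≤ k) : Summable (h.heatKernel k) := by
  obtain ⟨C₁, C₂, h1, h2, H⟩ := h.exists_norm_heatKernel_le 3
  refine Summable.of_norm_bounded
    ((summable_prod_exp_neg_mul_abs one_pos).mul_left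
      (C₁ * (√(k : ℝ))⁻¹ ^ 3 * Real.exp (C₂ * k * 3 ^ 2))) fun z => ?_
  have := H k z 3 hk (by norm_num) le_rfl
  simpa using this

theorem SingleParticle.hasSum_heatKernel {k : ℕ} (hk : 1 ≤ k) (p : Fin 3 → ℝ) :
    HasSum (fun z : Fin 3 → ℤ => h.heatKernel k z *
      Complex.exp (-Complex.I * ∑ ν, (p ν : ℂ) * (z ν : ℂ))) (Complex.exp (-(k : ℂ) * h.hat p)) := by
  have hs : Summable (mFourierCoeff (h.heatSymbol k)) := by
    have := h.summable_heatKernel hk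
    rw [← (Equiv.neg (Fin 3 → ℤ)).summable_iff] at this
    refine this.congr fun z => ?_
    simp [SingleParticle.heatKernel]
  have h1 := hasSum_mFourier_series_apply_of_summable hs
    (fun ν => ((p ν / (2 * Real.pi) : ℝ) : UnitAddCircle))
  rw [← (Equiv.neg (Fin 3 → ℤ)).hasSum_iff] at h1
  have h2 : h.heatSymbol k (fun ν => ((p ν / (2 * Real.pi) : ℝ) : UnitAddCircle)) =
      Complex.exp (-(k : ℂ) * h.hat p) := by
    change Complex.exp (-(k : ℂ) * h.torusSymbol _) = _
    rw [h.torusSymbol_coe, ← h.symbol_ofReal]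
    congr 3
    funext ν
    congr 1
    field_simp
  rw [h2] at h1
  have h3 : (fun z : Fin 3 → ℤ => h.heatKernel k z *
      Complex.exp (-Complex.I * ∑ ν, (p ν : ℂ) * (z ν : ℂ))) =
      (fun i => mFourierCoeff (h.heatSymbol k) i •
        mFourier i fun ν => ((p ν / (2 * Real.pi) : ℝ) : UnitAddCircle)) ∘
        (Equiv.neg (Fin 3 → ℤ)) := by
    funext z
    simp only [Function.comp_apply, Equiv.neg_apply, smul_eq_mul, mFourier_coe,
      SingleParticle.heatKernel]
    congr 2
    rw [Finset.mul_sum, Finset.mul_sum]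
    refine Finset.sum_congr rfl fun ν _ => ?_
    simp only [Pi.neg_apply]
    push_cast
    have : (Real.pi : ℂ) ≠ 0 := by exact_mod_cast Real.pi_ne_zero
    field_simp
  rw [h3]
  exact h1

end HeatSeries

end ParabolicBlockSpin

namespace ParabolicBlockSpin

open Matrix

section L2Norm

variable {ι κ : Type*} [Fintype ι] [Fintype κ]

/-- The `ℓ²` norm of a complex function on a finite set. -/
def l2 (φ : ι → ℂ) : ℝ := ‖(WithLp.toLp 2 φ : EuclideanSpace ℂ ι)‖

theorem l2_sq (φ : ι → ℂ) : l2 φ ^ 2 = ∑ x, ‖φ x‖ ^ 2 := EuclideanSpace.norm_sq_eq _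

theorem l2_nonneg (φ : ι → ℂ) : 0 ≤ l2 φ := norm_nonneg _

theorem l2_add_le (φ ψ : ι → ℂ) : l2 (φ + ψ) ≤ l2 φ + l2 ψ := by
  unfold l2; rw [WithLp.toLp_add]; exact norm_add_le _ _

theorem l2_sub_le (φ ψ : ι → ℂ) : l2 (φ - ψ) ≤ l2 φ + l2 ψ := by
  unfold l2; rw [WithLp.toLp_sub]; exact norm_sub_le _ _

theorem l2_smul (c : ℂ) (φ : ι → ℂ) : l2 (c • φ) = ‖c‖ * l2 φ := by
  unfold l2; rw [WithLp.toLp_smul, norm_smul]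

theorem l2_le_of_sq_le {φ : ι → ℂ} {c : ℝ} (hc : 0 ≤ c) (h : ∑ x, ‖φ x‖ ^ 2 ≤ c ^ 2) :
    l2 φ ≤ c := by
  rw [← l2_sq] at h; exact (pow_le_pow_iff_left₀ (l2_nonneg _) hc two_ne_zero).1 h

theorem sum_mul_le_l2_mul_l2 (φ ψ : ι → ℂ) : ∑ x, ‖φ x‖ * ‖ψ x‖ ≤ l2 φ * l2 ψ := by
  have h := Finset.sum_mul_sq_le_sq_mul_sq Finset.univ (fun x => ‖φ x‖) (fun x => ‖ψ x‖)
  rw [← l2_sq, ← l2_sq, ← mul_pow] at h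
  exact (pow_le_pow_iff_left₀ (Finset.sum_nonneg fun x _ => by positivity)
    (mul_nonneg (l2_nonneg _) (l2_nonneg _)) two_ne_zero).1 h

theorem norm_dotProduct_le (φ ψ : ι → ℂ) : ‖star φ ⬝ᵥ ψ‖ ≤ l2 φ * l2 ψ := by
  refine (norm_sum_le _ _).trans ?_
  simpa using sum_mul_le_l2_mul_l2 φ ψ

theorem star_dotProduct_self (φ : ι → ℂ) : star φ ⬝ᵥ φ = ((l2 φ ^ 2 : ℝ) : ℂ) := by
  rw [l2_sq]
  push_cast
  refine Finset.sum_congr rfl fun x _ => ?_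
  rw [Pi.star_apply, RCLike.star_def, mul_comm, Complex.mul_conj, Complex.normSq_eq_norm_sq]
  push_cast; rfl

end L2Norm

section Fourier

variable (M₀ M₁ : ℕ) [NeZero M₀] [NeZero M₁]

/-- The finite group `ℤ/M₀ × (ℤ/M₁)³`. -/
abbrev Tor : Type := ZMod M₀ × (Fin 3 → ZMod M₁)

/-- The matrix of the discrete Fourier transform. -/
def dftM : Matrix (Tor M₀ M₁) (Tor M₀ M₁) ℂ := Matrix.of fun p x =>
  ZMod.stdAddChar (-(p.1 * x.1)) * ∏ ν, ZMod.stdAddChar (-(p.2 ν * x.2 ν))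

variable {M₀ M₁}

theorem dftM_add (p x y : Tor M₀ M₁) : dftM M₀ M₁ p (x + y) = dftM M₀ M₁ p x * dftM M₀ M₁ p y := by
  simp only [dftM, Matrix.of_apply, Prod.fst_add, Prod.snd_add, Pi.add_apply, mul_add, neg_add,
    AddChar.map_add_eq_mul, Finset.prod_mul_distrib]
  ring

theorem dftM_zero (p : Tor M₀ M₁) : dftM M₀ M₁ p 0 = 1 := by
  simp [dftM]

theorem star_dftM (p x : Tor M₀ M₁) : star (dftM M₀ M₁ p x) = dftM M₀ M₁ p (-x) := by
  simp only [dftM, Matrix.of_apply, star_mul', star_prod, Prod.fst_neg, Prod.snd_neg, Pi.neg_apply,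
    RCLike.star_def, ← AddChar.map_neg_eq_conj, mul_neg]

theorem norm_dftM (p x : Tor M₀ M₁) : ‖dftM M₀ M₁ p x‖ = 1 := by
  simp [dftM, AddChar.norm_apply]

theorem sum_dftM (x : Tor M₀ M₁) :
    ∑ p, dftM M₀ M₁ p x = if x = 0 then (Fintype.card (Tor M₀ M₁) : ℂ) else 0 := by
  simp only [dftM, Matrix.of_apply]
  rw [Fintype.sum_prod_type]
  simp only [← Finset.mul_sum]
  rw [← Finset.sum_mul]
  have h1 : ∑ a : ZMod M₀, ZMod.stdAddChar (-(a * x.1)) = if x.1 = 0 then (M₀ : ℂ) else 0 := by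
    have := AddChar.sum_mulShift (-x.1) (ZMod.isPrimitive_stdAddChar M₀)
    simpa [ZMod.card] using this
  have h2 : ∑ q : Fin 3 → ZMod M₁, ∏ ν, ZMod.stdAddChar (-(q ν * x.2 ν)) =
      ∏ ν, if x.2 ν = 0 then (M₁ : ℂ) else 0 := by
    rw [← Fintype.prod_sum (f := fun ν b => ZMod.stdAddChar (-(b * x.2 ν)))]
    refine Finset.prod_congr rfl fun ν _ => ?_
    have := AddChar.sum_mulShift (-x.2 ν) (ZMod.isPrimitive_stdAddChar M₁)
    simpa [ZMod.card] using this
  rw [h1, h2]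
  by_cases hx : x = 0
  · subst hx
    simp [ZMod.card]
  · rw [if_neg hx]
    by_cases h0 : x.1 = 0
    · have : ∃ ν, x.2 ν ≠ 0 := by
        by_contra hcon
        push Not at hcon
        exact hx (Prod.ext h0 (funext hcon))
      obtain ⟨ν, hν⟩ := this
      rw [Finset.prod_eq_zero (Finset.mem_univ ν) (by simp [hν]), mul_zero]
    · simp [h0]

theorem conjTranspose_dftM_mul :
    (dftM M₀ M₁)ᴴ * dftM M₀ M₁ = (Fintype.card (Tor M₀ M₁) : ℂ) • 1 := by
  ext x y
  rw [Matrix.mul_apply]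
  simp only [Matrix.conjTranspose_apply, star_dftM, ← dftM_add, sum_dftM]
  by_cases hxy : x = y
  · subst hxy; simp
  · have : -x + y ≠ 0 := by
      intro h; exact hxy (by rw [neg_add_eq_zero] at h; exact h)
    rw [if_neg this]; simp [hxy]

theorem card_tor_pos : 0 < (Fintype.card (Tor M₀ M₁) : ℝ) := by
  exact_mod_cast Fintype.card_pos

theorem isUnit_dftM : IsUnit (dftM M₀ M₁) := by
  have hc : (Fintype.card (Tor M₀ M₁) : ℂ) ≠ 0 := by exact_mod_cast card_tor_pos.ne'
  refine (Matrix.isUnit_iff_isUnit_det _).2 (Matrix.isUnit_det_of_left_inverse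
    (B := (Fintype.card (Tor M₀ M₁) : ℂ)⁻¹ • (dftM M₀ M₁)ᴴ) ?_)
  rw [Matrix.smul_mul, conjTranspose_dftM_mul, smul_smul, inv_mul_cancel₀ hc, one_smul]

theorem l2_dftM_mulVec (φ : Tor M₀ M₁ → ℂ) :
    l2 (dftM M₀ M₁ *ᵥ φ) ^ 2 = Fintype.card (Tor M₀ M₁) * l2 φ ^ 2 := by
  have h := star_dotProduct_self (dftM M₀ M₁ *ᵥ φ)
  rw [Matrix.star_mulVec, ← Matrix.dotProduct_mulVec, Matrix.mulVec_mulVec, conjTranspose_dftM_mul,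
    Matrix.smul_mulVec, Matrix.one_mulVec, dotProduct_smul, star_dotProduct_self] at h
  have h2 : ((Fintype.card (Tor M₀ M₁) * l2 φ ^ 2 : ℝ) : ℂ) =
      ((l2 (dftM M₀ M₁ *ᵥ φ) ^ 2 : ℝ) : ℂ) := by
    rw [← h]; push_cast; rw [smul_eq_mul]
  exact_mod_cast h2.symm

/-- The discrete Fourier transform diagonalizes `A`, with the eigenvalues `t`. -/
def HasSymbol (A : Matrix (Tor M₀ M₁) (Tor M₀ M₁) ℂ) (t : Tor M₀ M₁ → ℂ) : Prop :=
  dftM M₀ M₁ * A = Matrix.diagonal t * dftM M₀ M₁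

namespace HasSymbol

variable {A B : Matrix (Tor M₀ M₁) (Tor M₀ M₁) ℂ} {s t : Tor M₀ M₁ → ℂ}

theorem one : HasSymbol (1 : Matrix (Tor M₀ M₁) (Tor M₀ M₁) ℂ) 1 := by
  unfold HasSymbol
  rw [show Matrix.diagonal (1 : Tor M₀ M₁ → ℂ) = 1 from Matrix.diagonal_one, one_mul, mul_one]

theorem neg (hA : HasSymbol A s) : HasSymbol (-A) (-s) := by
  unfold HasSymbol at *
  rw [mul_neg, hA, ← neg_mul]
  congr 1
  ext i j
  by_cases hij : i = j
  · subst hij; simp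
  · simp [hij]

theorem sub (hA : HasSymbol A s) (hB : HasSymbol B t) : HasSymbol (A - B) (s - t) := by
  unfold HasSymbol at *
  rw [mul_sub, hA, hB, ← sub_mul]
  congr 1
  ext i j
  by_cases hij : i = j
  · subst hij; simp
  · simp [hij]

theorem mul (hA : HasSymbol A s) (hB : HasSymbol B t) : HasSymbol (A * B) (s * t) := by
  unfold HasSymbol at *
  rw [← mul_assoc, hA, mul_assoc, hB, ← mul_assoc, Matrix.diagonal_mul_diagonal]
  rfl

theorem pow (hA : HasSymbol A s) (k : ℕ) : HasSymbol (A ^ k) (s ^ k) := by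
  induction k with
  | zero => simpa using one
  | succ k ih => rw [pow_succ, pow_succ]; exact ih.mul hA

theorem exp (hA : HasSymbol A s) :
    HasSymbol (NormedSpace.exp A) (fun p => Complex.exp (s p)) := by
  unfold HasSymbol at *
  have hU := isUnit_dftM (M₀ := M₀) (M₁ := M₁)
  have hUd := (Matrix.isUnit_iff_isUnit_det _).1 hU
  have h1 := Matrix.exp_conj (dftM M₀ M₁) A hU
  rw [hA, Matrix.mul_nonsing_inv_cancel_right _ _ hUd, Matrix.exp_diagonal] at h1
  have h2 : NormedSpace.exp s = fun p => Complex.exp (s p) := by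
    rw [Complex.exp_eq_exp_ℂ]
    funext p
    exact Pi.coe_exp s p
  rw [← h2, h1, Matrix.nonsing_inv_mul_cancel_right _ _ hUd]

theorem unique (hA : HasSymbol A s) (hB : HasSymbol B s) : A = B := by
  unfold HasSymbol at *
  exact isUnit_dftM.mul_left_cancel (hA.trans hB.symm)

theorem dftM_mulVec (hA : HasSymbol A s) (φ : Tor M₀ M₁ → ℂ) (p : Tor M₀ M₁) :
    (dftM M₀ M₁ *ᵥ (A *ᵥ φ)) p = s p * (dftM M₀ M₁ *ᵥ φ) p := by
  rw [Matrix.mulVec_mulVec, hA, ← Matrix.mulVec_mulVec, Matrix.mulVec_diagonal]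

theorem l2_mulVec_le (hA : HasSymbol A s) (hB : HasSymbol B t) {C : ℝ} (hC : 0 ≤ C)
    (hst : ∀ p, ‖s p‖ ≤ C * ‖t p‖) (φ : Tor M₀ M₁ → ℂ) : l2 (A *ᵥ φ) ≤ C * l2 (B *ᵥ φ) := by
  have h1 : l2 (dftM M₀ M₁ *ᵥ (A *ᵥ φ)) ^ 2 ≤ C ^ 2 * l2 (dftM M₀ M₁ *ᵥ (B *ᵥ φ)) ^ 2 := by
    rw [l2_sq, l2_sq, Finset.mul_sum]
    refine Finset.sum_le_sum fun p _ => ?_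
    rw [hA.dftM_mulVec, hB.dftM_mulVec, norm_mul, norm_mul, mul_pow, mul_pow, ← mul_assoc,
      ← mul_pow C]
    gcongr
    exact hst p
  rw [l2_dftM_mulVec, l2_dftM_mulVec] at h1
  have h2 : l2 (A *ᵥ φ) ^ 2 ≤ (C * l2 (B *ᵥ φ)) ^ 2 := by
    have := card_tor_pos (M₀ := M₀) (M₁ := M₁)
    rw [mul_pow]
    by_contra hcon
    push Not at hcon
    have := mul_lt_mul_of_pos_left hcon this
    linarith
  exact (pow_le_pow_iff_left₀ (l2_nonneg _) (mul_nonneg hC (l2_nonneg _)) two_ne_zero).1 h2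

theorem l2_mulVec_sq_le (hA : HasSymbol A s) (hB : HasSymbol B t) {C : ℝ} (hC : 0 ≤ C)
    (hst : ∀ p, ‖s p‖ ^ 2 ≤ C * ‖t p‖) (φ : Tor M₀ M₁ → ℂ) :
    l2 (A *ᵥ φ) ^ 2 ≤ C * (l2 φ * l2 (B *ᵥ φ)) := by
  set F := dftM M₀ M₁
  set N : ℝ := ((Fintype.card (Tor M₀ M₁) : ℕ) : ℝ)
  have hN : 0 < N := card_tor_pos
  have h1 : l2 (F *ᵥ (A *ᵥ φ)) ^ 2 ≤ C * (l2 (F *ᵥ φ) * l2 (F *ᵥ (B *ᵥ φ))) := by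
    refine le_trans ?_ (mul_le_mul_of_nonneg_left (sum_mul_le_l2_mul_l2 _ _) hC)
    rw [l2_sq, Finset.mul_sum]
    refine Finset.sum_le_sum fun p _ => ?_
    rw [hA.dftM_mulVec, hB.dftM_mulVec, norm_mul, norm_mul, mul_pow]
    calc ‖s p‖ ^ 2 * ‖(F *ᵥ φ) p‖ ^ 2 ≤ C * ‖t p‖ * ‖(F *ᵥ φ) p‖ ^ 2 := by gcongr; exact hst p
      _ = _ := by ring
  have hF : ∀ ψ : Tor M₀ M₁ → ℂ, l2 (F *ᵥ ψ) = √N * l2 ψ := by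
    intro ψ
    have := l2_dftM_mulVec ψ
    rw [← Real.sqrt_sq (l2_nonneg (F *ᵥ ψ)), this, Real.sqrt_mul hN.le,
      Real.sqrt_sq (l2_nonneg _)]
  rw [hF, hF, hF, mul_pow, Real.sq_sqrt hN.le] at h1
  have h2 : C * (√N * l2 φ * (√N * l2 (B *ᵥ φ))) = N * (C * (l2 φ * l2 (B *ᵥ φ))) := by
    linear_combination (C * l2 φ * l2 (B *ᵥ φ)) * Real.mul_self_sqrt hN.le
  rw [h2] at h1
  exact le_of_mul_le_mul_left h1 hN

end HasSymbol

/-- The translation `(τ_v φ)(x) = φ (x + v)`. -/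
def shiftM (v : Tor M₀ M₁) : Matrix (Tor M₀ M₁) (Tor M₀ M₁) ℂ :=
  Matrix.of fun x y => if y = x + v then 1 else 0

theorem mul_shiftM_apply {κ : Type*} (A : Matrix κ (Tor M₀ M₁) ℂ) (v : Tor M₀ M₁) (i : κ)
    (y : Tor M₀ M₁) : (A * shiftM v) i y = A i (y - v) := by
  rw [Matrix.mul_apply, Finset.sum_eq_single (y - v)]
  · simp [shiftM]
  · intro x _ hx
    have : y ≠ x + v := fun h => hx (by rw [h]; abel)
    simp [shiftM, this]
  · simp

theorem shiftM_mulVec (v : Tor M₀ M₁) (φ : Tor M₀ M₁ → ℂ) (x : Tor M₀ M₁) :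
    (shiftM v *ᵥ φ) x = φ (x + v) := by
  simp [Matrix.mulVec, dotProduct, shiftM]

theorem hasSymbol_shiftM (v : Tor M₀ M₁) : HasSymbol (shiftM v) (fun p => dftM M₀ M₁ p (-v)) := by
  unfold HasSymbol
  ext p y
  rw [mul_shiftM_apply, Matrix.diagonal_mul, sub_eq_add_neg, dftM_add, mul_comm]

/-- The periodization of a translation invariant kernel on `ℤ³`, acting on the last three
coordinates. -/
def periodM (f : (Fin 3 → ℤ) → ℂ) : Matrix (Tor M₀ M₁) (Tor M₀ M₁) ℂ :=
  Matrix.of fun x y => if x.1 = y.1 then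
    ∑' z : Fin 3 → ℤ, if (fun ν => ((z ν : ℤ) : ZMod M₁)) = x.2 - y.2 then f z else 0 else 0

theorem stdAddChar_intCast_mul (p : ZMod M₁) (z : ℤ) :
    ZMod.stdAddChar (-(p * (z : ZMod M₁))) =
      Complex.exp (-Complex.I * ((2 * Real.pi * p.valMinAbs / M₁ : ℝ) * (z : ℂ))) := by
  have h1 : -(p * (z : ZMod M₁)) = ((-(p.valMinAbs * z) : ℤ) : ZMod M₁) := by
    simp [ZMod.coe_valMinAbs]
  rw [h1, ZMod.stdAddChar_coe]
  congr 1
  push_cast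
  ring

/-- The spatial momentum of a character, with components in `[-π, π]`. -/
def momentum (p : Tor M₀ M₁) (ν : Fin 3) : ℝ := 2 * Real.pi * (p.2 ν).valMinAbs / M₁

theorem abs_momentum_le (p : Tor M₀ M₁) (ν : Fin 3) : |momentum p ν| ≤ Real.pi := by
  have h1 := (p.2 ν).natAbs_valMinAbs_le
  have h2 : |((p.2 ν).valMinAbs : ℝ)| ≤ (M₁ : ℝ) / 2 := by
    have h3 : 2 * (p.2 ν).valMinAbs.natAbs ≤ M₁ := by omega
    have h4 : (2 : ℝ) * ((p.2 ν).valMinAbs.natAbs : ℝ) ≤ M₁ := by exact_mod_cast h3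
    rw [Nat.cast_natAbs, Int.cast_abs] at h4
    linarith
  have hM : (0 : ℝ) < M₁ := by exact_mod_cast Nat.pos_of_ne_zero (NeZero.ne M₁)
  rw [momentum, abs_div, abs_mul, abs_of_pos Real.two_pi_pos, abs_of_pos hM, div_le_iff₀ hM]
  nlinarith [Real.pi_pos]

theorem dftM_intCast (p : Tor M₀ M₁) (z : Fin 3 → ℤ) :
    dftM M₀ M₁ p (0, fun ν => ((z ν : ℤ) : ZMod M₁)) =
      Complex.exp (-Complex.I * ∑ ν, (momentum p ν : ℂ) * (z ν : ℂ)) := by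
  simp only [dftM, Matrix.of_apply, mul_zero, neg_zero, AddChar.map_zero_eq_one, one_mul,
    stdAddChar_intCast_mul]
  rw [← Complex.exp_sum, Finset.mul_sum]
  rfl

theorem hasSymbol_periodM {f : (Fin 3 → ℤ) → ℂ} (hf : Summable f) :
    HasSymbol (periodM f : Matrix (Tor M₀ M₁) (Tor M₀ M₁) ℂ)
      (fun p => ∑' z, f z * Complex.exp (-Complex.I * ∑ ν, (momentum p ν : ℂ) * (z ν : ℂ))) := by
  unfold HasSymbol
  ext p y
  rw [Matrix.diagonal_mul, Matrix.mul_apply, ← tsum_mul_right]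
  have h1 : ∀ x : Tor M₀ M₁, dftM M₀ M₁ p x * periodM f x y =
      ∑' z : Fin 3 → ℤ, if x = y + (0, fun ν => ((z ν : ℤ) : ZMod M₁)) then
        dftM M₀ M₁ p x * f z else 0 := by
    intro x
    simp only [periodM, Matrix.of_apply]
    by_cases hx : x.1 = y.1
    · rw [if_pos hx, ← tsum_mul_left]
      refine tsum_congr fun z => ?_
      have : (fun ν => ((z ν : ℤ) : ZMod M₁)) = x.2 - y.2 ↔
          x = y + (0, fun ν => ((z ν : ℤ) : ZMod M₁)) := by
        rw [Prod.ext_iff, eq_sub_iff_add_eq, add_comm]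
        simp [hx, eq_comm]
      simp only [this, mul_ite, mul_zero]
    · rw [if_neg hx, mul_zero]
      symm
      convert tsum_zero with z
      rw [if_neg]
      intro h; apply hx; rw [h]; simp
  simp only [h1]
  rw [← Summable.tsum_finsetSum]
  · refine tsum_congr fun z => ?_
    simp only [Finset.sum_ite_eq', Finset.mem_univ, if_true]
    rw [dftM_add, dftM_intCast]
    ring
  · intro x _
    refine Summable.of_norm_bounded hf.norm fun z => ?_
    split_ifs
    · rw [norm_mul, norm_dftM, one_mul]
    · simp

end Fourier

section Transfer

variable (h : SingleParticle) (M₀ M₁ : ℕ) [NeZero M₀] [NeZero M₁]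

/-- The one step transfer operator `exp (-h₀) τ` with the time shift `τ = 1 + ∂₀`. -/
def transfer : Matrix (Tor M₀ M₁) (Tor M₀ M₁) ℂ :=
  NormedSpace.exp (-(periodM h.kernel)) * shiftM (1, 0)

variable {M₀ M₁}

theorem hasSymbol_transfer :
    HasSymbol (transfer h M₀ M₁)
      (fun p => (Real.exp (-h.hat (momentum p)) : ℂ) * dftM M₀ M₁ p (-(1, 0))) := by
  have h1 := (hasSymbol_periodM (M₀ := M₀) (M₁ := M₁) h.summable_kernel).neg.exp.mul
    (hasSymbol_shiftM (1, 0))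
  unfold transfer
  convert h1 using 1
  funext p
  simp only [Pi.mul_apply, Pi.neg_apply]
  rw [← h.fourier, h.symbol_ofReal]
  push_cast
  rfl

theorem transfer_pow {k : ℕ} (hk : 1 ≤ k) :
    transfer h M₀ M₁ ^ k = periodM (h.heatKernel k) * shiftM (k, 0) := by
  have h1 := (hasSymbol_periodM (M₀ := M₀) (M₁ := M₁) (h.summable_heatKernel hk)).mul
    (hasSymbol_shiftM ((k : ZMod M₀), 0))
  refine ((hasSymbol_transfer h).pow k).unique ?_
  convert h1 using 1
  funext p
  simp only [Pi.mul_apply, Pi.pow_apply]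
  rw [(h.hasSum_heatKernel hk (momentum p)).tsum_eq, mul_pow]
  congr 1
  · rw [← Complex.ofReal_pow, ← Real.exp_nat_mul, Complex.ofReal_exp]
    congr 1
    push_cast; ring
  · have : ∀ n : ℕ, dftM M₀ M₁ p (-(1, 0)) ^ n = dftM M₀ M₁ p (-((n : ZMod M₀), 0)) := by
      intro n
      induction n with
      | zero =>
        have : (((0 : ℕ) : ZMod M₀), (0 : Fin 3 → ZMod M₁)) = 0 := by simp
        rw [pow_zero, this, neg_zero, dftM_zero]
      | succ n ih =>
        rw [pow_succ, ih, ← dftM_add]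
        congr 1
        ext <;> simp
        ring
    exact this k

theorem l2_transfer_le (φ : Tor M₀ M₁ → ℂ) : l2 (transfer h M₀ M₁ *ᵥ φ) ≤ l2 φ := by
  have := (hasSymbol_transfer h).l2_mulVec_le (HasSymbol.one (M₀ := M₀) (M₁ := M₁)) zero_le_one
    (fun p => by
      simp only [norm_mul, norm_dftM, Complex.norm_real, Real.norm_eq_abs, Real.abs_exp,
        Pi.one_apply, norm_one, mul_one]
      exact Real.exp_le_one_iff.2 (by linarith [h.hat_nonneg (momentum p)])) φ
  simpa using this

theorem norm_sq_one_sub_mul {r : ℝ} {w : ℂ} (hw : ‖w‖ = 1) :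
    ‖1 - (r : ℂ) * w‖ ^ 2 = (1 - r) ^ 2 + r * ‖1 - w‖ ^ 2 := by
  have h1 : w.re ^ 2 + w.im ^ 2 = 1 := by
    have := Complex.normSq_eq_norm_sq w
    rw [hw, Complex.normSq_apply] at this
    linarith
  rw [← Complex.normSq_eq_norm_sq, ← Complex.normSq_eq_norm_sq, Complex.normSq_apply,
    Complex.normSq_apply]
  simp only [Complex.sub_re, Complex.sub_im, Complex.one_re, Complex.one_im, Complex.re_ofReal_mul,
    Complex.im_ofReal_mul]
  linear_combination (r ^ 2 - r) * h1

theorem exists_transfer_gradient_bounds :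
    ∃ C : ℝ, 0 < C ∧ ∀ (M₀ M₁ : ℕ) [NeZero M₀] [NeZero M₁] (φ : Tor M₀ M₁ → ℂ),
      l2 ((1 - shiftM (1, 0)) *ᵥ φ) ≤ C * l2 ((1 - transfer h M₀ M₁) *ᵥ φ) ∧
      ∀ ν : Fin 3, l2 ((1 - shiftM (0, Pi.single ν 1)) *ᵥ φ) ^ 2 ≤
        C * (l2 φ * l2 ((1 - transfer h M₀ M₁) *ᵥ φ)) := by
  obtain ⟨H, hH⟩ := h.exists_hat_le
  obtain ⟨c, hc, hcq⟩ := h.exists_quadratic_le_hat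
  refine ⟨max (Real.exp H) (Real.exp H / c), by positivity, ?_⟩
  intro M₀ M₁ _ _ φ
  have hH0 : 0 ≤ H := (h.hat_nonneg 0).trans (hH 0)
  have hD := (HasSymbol.one (M₀ := M₀) (M₁ := M₁)).sub (hasSymbol_transfer h)
  have hlow : ∀ p : Tor M₀ M₁, Real.exp (-H) ≤ Real.exp (-h.hat (momentum p)) := fun p =>
    Real.exp_le_exp.2 (by linarith [hH (momentum p)])
  have hle1 : ∀ p : Tor M₀ M₁, Real.exp (-h.hat (momentum p)) ≤ 1 := fun p =>
    Real.exp_le_one_iff.2 (by linarith [h.hat_nonneg (momentum p)])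
  refine ⟨?_, fun ν => ?_⟩
  · have h1 := ((HasSymbol.one (M₀ := M₀) (M₁ := M₁)).sub (hasSymbol_shiftM (1, 0))).l2_mulVec_le
      hD (C := Real.exp H) (Real.exp_pos H).le (fun p => ?_) φ
    · refine h1.trans ?_
      gcongr
      · exact l2_nonneg _
      · exact le_max_left _ _
    · simp only [Pi.sub_apply, Pi.one_apply]
      have h2 := norm_sq_one_sub_mul (r := Real.exp (-h.hat (momentum p)))
        (norm_dftM p (-(1, 0)))
      rw [← pow_le_pow_iff_left₀ (norm_nonneg _) (by positivity) two_ne_zero, mul_pow]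
      rw [h2]
      have h3 : 1 ≤ Real.exp H ^ 2 * Real.exp (-h.hat (momentum p)) := by
        calc (1 : ℝ) ≤ Real.exp H := Real.one_le_exp hH0
          _ = Real.exp H ^ 2 * Real.exp (-H) := by
            rw [pow_two, mul_assoc, ← Real.exp_add]; simp
          _ ≤ _ := by gcongr; exact hH _
      have h4 : 0 ≤ Real.exp H ^ 2 * (1 - Real.exp (-h.hat (momentum p))) ^ 2 := by positivity
      nlinarith [sq_nonneg ‖1 - dftM M₀ M₁ p (-(1, 0))‖]
  · have h1 := ((HasSymbol.one (M₀ := M₀) (M₁ := M₁)).sub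
      (hasSymbol_shiftM (0, Pi.single ν 1))).l2_mulVec_sq_le
      hD (C := Real.exp H / c) (by positivity) (fun p => ?_) φ
    · refine h1.trans ?_
      gcongr
      · exact mul_nonneg (l2_nonneg _) (l2_nonneg _)
      · exact le_max_right _ _
    · simp only [Pi.sub_apply, Pi.one_apply]
      have e1 : dftM M₀ M₁ p (-(0, Pi.single ν 1)) =
          Complex.exp (Complex.I * (momentum p ν : ℝ)) := by
        have : (-(0, Pi.single ν 1) : Tor M₀ M₁) =
            (0, fun μ => (((-Pi.single ν 1 : Fin 3 → ℤ) μ : ℤ) : ZMod M₁)) := by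
          ext μ
          · simp
          · by_cases hμ : μ = ν
            · subst hμ; simp
            · simp [hμ]
        rw [this, dftM_intCast]
        congr 1
        rw [Finset.sum_eq_single ν]
        · simp
        · intro μ _ hμ; simp [hμ]
        · simp
      have e2 : ‖1 - Complex.exp (Complex.I * (momentum p ν : ℝ))‖ ≤ |momentum p ν| := by
        rw [norm_sub_rev]
        exact Real.norm_exp_I_mul_ofReal_sub_one_le
      have h2 := norm_sq_one_sub_mul (r := Real.exp (-h.hat (momentum p)))
        (norm_dftM p (-(1, 0)))
      have h3 : 1 - Real.exp (-h.hat (momentum p)) ≤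
          ‖1 - (Real.exp (-h.hat (momentum p)) : ℂ) * dftM M₀ M₁ p (-(1, 0))‖ := by
        rw [← pow_le_pow_iff_left₀ (by linarith [hle1 p]) (norm_nonneg _) two_ne_zero, h2]
        have : 0 ≤ Real.exp (-h.hat (momentum p)) * ‖1 - dftM M₀ M₁ p (-(1, 0))‖ ^ 2 := by
          positivity
        linarith
      have h4 : h.hat (momentum p) * Real.exp (-H) ≤ 1 - Real.exp (-h.hat (momentum p)) := by
        have h5 := Real.add_one_le_exp (h.hat (momentum p))
        have h6 : h.hat (momentum p) * Real.exp (-H) ≤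
            h.hat (momentum p) * Real.exp (-h.hat (momentum p)) :=
          mul_le_mul_of_nonneg_left (hlow p) (h.hat_nonneg _)
        have h7 : Real.exp (h.hat (momentum p)) * Real.exp (-h.hat (momentum p)) = 1 := by
          rw [← Real.exp_add]; simp
        nlinarith [Real.exp_pos (-h.hat (momentum p))]
      have h5 : c * momentum p ν ^ 2 ≤ h.hat (momentum p) := by
        refine le_trans ?_ (hcq (momentum p) (abs_momentum_le p))
        gcongr
        exact Finset.single_le_sum (f := fun ν => momentum p ν ^ 2) (fun _ _ => sq_nonneg _)
          (Finset.mem_univ ν)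
      rw [e1]
      have h6 : ‖1 - Complex.exp (Complex.I * (momentum p ν : ℝ))‖ ^ 2 ≤ momentum p ν ^ 2 := by
        rw [← sq_abs (momentum p ν)]; gcongr
      refine h6.trans ?_
      have h7 : Real.exp H * Real.exp (-H) = 1 := by rw [← Real.exp_add]; simp
      calc momentum p ν ^ 2 = Real.exp H / c * (c * momentum p ν ^ 2 * Real.exp (-H)) := by
            field_simp; linear_combination (-(momentum p ν ^ 2)) * h7
        _ ≤ Real.exp H / c * (h.hat (momentum p) * Real.exp (-H)) := by gcongr
        _ ≤ _ := by gcongr; exact h4.trans h3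

end Transfer

end ParabolicBlockSpin

namespace ParabolicBlockSpin

open Matrix

section WeightedNorms

variable {P : Type*} [PseudoMetricSpace P] {ι κ l : Type*} [Fintype ι] [Fintype κ] [Fintype l]

/-- The weighted row sums of a matrix are bounded. -/
def RowBd (m : ℝ) (f : ι → P) (g : κ → P) (A : Matrix ι κ ℂ) (C : ℝ) : Prop :=
  ∀ i, ∑ j, Real.exp (m * dist (f i) (g j)) * ‖A i j‖ ≤ C

/-- The weighted column sums of a matrix are bounded. -/
def ColBd (m : ℝ) (f : ι → P) (g : κ → P) (A : Matrix ι κ ℂ) (C : ℝ) : Prop :=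
  ∀ j, ∑ i, Real.exp (m * dist (f i) (g j)) * ‖A i j‖ ≤ C

/-- The weighted entries of a matrix are bounded. -/
def PtBd (m : ℝ) (f : ι → P) (g : κ → P) (A : Matrix ι κ ℂ) (C : ℝ) : Prop :=
  ∀ i j, Real.exp (m * dist (f i) (g j)) * ‖A i j‖ ≤ C

variable {m : ℝ} {f : ι → P} {g : κ → P} {k : l → P} {A A' : Matrix ι κ ℂ} {B : Matrix κ l ℂ}
  {C C' D : ℝ}

theorem rowBd_transpose : RowBd m g f Aᵀ C ↔ ColBd m f g A C := by
  simp only [RowBd, ColBd, Matrix.transpose_apply, dist_comm]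

theorem colBd_transpose : ColBd m g f Aᵀ C ↔ RowBd m f g A C := by
  simp only [RowBd, ColBd, Matrix.transpose_apply, dist_comm]

theorem ptBd_transpose : PtBd m g f Aᵀ C ↔ PtBd m f g A C := by
  simp only [PtBd, Matrix.transpose_apply, dist_comm]
  exact forall_comm

theorem exp_dist_le_mul (hm : 0 ≤ m) (x y z : P) :
    Real.exp (m * dist x z) ≤ Real.exp (m * dist x y) * Real.exp (m * dist y z) := by
  rw [← Real.exp_add, ← mul_add]
  exact Real.exp_le_exp.2 (mul_le_mul_of_nonneg_left (dist_triangle x y z) hm)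

theorem exp_dist_mul_norm_mul_le (hm : 0 ≤ m) (A : Matrix ι κ ℂ) (B : Matrix κ l ℂ) (i : ι)
    (j : l) : Real.exp (m * dist (f i) (k j)) * ‖(A * B) i j‖ ≤
      ∑ x, (Real.exp (m * dist (f i) (g x)) * ‖A i x‖) *
        (Real.exp (m * dist (g x) (k j)) * ‖B x j‖) := by
  rw [Matrix.mul_apply]
  calc _ ≤ Real.exp (m * dist (f i) (k j)) * ∑ x, ‖A i x * B x j‖ := by
        gcongr; exact norm_sum_le _ _
    _ = ∑ x, Real.exp (m * dist (f i) (k j)) * (‖A i x‖ * ‖B x j‖) := by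
        rw [Finset.mul_sum]; simp only [norm_mul]
    _ ≤ _ := by
        refine Finset.sum_le_sum fun x _ => ?_
        calc _ ≤ (Real.exp (m * dist (f i) (g x)) * Real.exp (m * dist (g x) (k j))) *
              (‖A i x‖ * ‖B x j‖) := by gcongr; exact exp_dist_le_mul hm _ _ _
          _ = _ := by ring

theorem RowBd.mul (hm : 0 ≤ m) (hD : 0 ≤ D) (hA : RowBd m f g A C) (hB : RowBd m g k B D) :
    RowBd m f k (A * B) (C * D) := by
  intro i
  calc _ ≤ ∑ j, ∑ x, (Real.exp (m * dist (f i) (g x)) * ‖A i x‖) *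
        (Real.exp (m * dist (g x) (k j)) * ‖B x j‖) :=
        Finset.sum_le_sum fun j _ => exp_dist_mul_norm_mul_le hm A B i j
    _ = ∑ x, (Real.exp (m * dist (f i) (g x)) * ‖A i x‖) *
        ∑ j, (Real.exp (m * dist (g x) (k j)) * ‖B x j‖) := by
        rw [Finset.sum_comm]; simp only [Finset.mul_sum]
    _ ≤ ∑ x, (Real.exp (m * dist (f i) (g x)) * ‖A i x‖) * D := by
        gcongr with x; exact hB x
    _ = (∑ x, Real.exp (m * dist (f i) (g x)) * ‖A i x‖) * D := by rw [Finset.sum_mul]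
    _ ≤ C * D := by gcongr; exact hA i

theorem ColBd.mul (hm : 0 ≤ m) (hC : 0 ≤ C) (hA : ColBd m f g A C) (hB : ColBd m g k B D) :
    ColBd m f k (A * B) (C * D) := by
  rw [← rowBd_transpose] at *
  rw [Matrix.transpose_mul, mul_comm C D]
  exact RowBd.mul hm hC hB hA

theorem RowBd.mul_ptBd (hm : 0 ≤ m) (hD : 0 ≤ D) (hA : RowBd m f g A C) (hB : PtBd m g k B D) :
    PtBd m f k (A * B) (C * D) := by
  intro i j
  calc _ ≤ ∑ x, (Real.exp (m * dist (f i) (g x)) * ‖A i x‖) *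
        (Real.exp (m * dist (g x) (k j)) * ‖B x j‖) := exp_dist_mul_norm_mul_le hm A B i j
    _ ≤ ∑ x, (Real.exp (m * dist (f i) (g x)) * ‖A i x‖) * D := by
        gcongr with x; exact hB x j
    _ = (∑ x, Real.exp (m * dist (f i) (g x)) * ‖A i x‖) * D := by rw [Finset.sum_mul]
    _ ≤ C * D := by gcongr; exact hA i

theorem PtBd.mul_colBd (hm : 0 ≤ m) (hC : 0 ≤ C) (hA : PtBd m f g A C) (hB : ColBd m g k B D) :
    PtBd m f k (A * B) (C * D) := by
  rw [← ptBd_transpose] at hA ⊢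
  rw [← rowBd_transpose] at hB
  rw [Matrix.transpose_mul, mul_comm C D]
  exact RowBd.mul_ptBd hm hC hB hA

theorem RowBd.sub (hA : RowBd m f g A C) (hA' : RowBd m f g A' C') :
    RowBd m f g (A - A') (C + C') := by
  intro i
  refine le_trans ?_ (add_le_add (hA i) (hA' i))
  rw [← Finset.sum_add_distrib]
  refine Finset.sum_le_sum fun j _ => ?_
  rw [← mul_add, Matrix.sub_apply]
  gcongr
  exact norm_sub_le _ _

theorem RowBd.add (hA : RowBd m f g A C) (hA' : RowBd m f g A' C') :
    RowBd m f g (A + A') (C + C') := by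
  intro i
  refine le_trans ?_ (add_le_add (hA i) (hA' i))
  rw [← Finset.sum_add_distrib]
  refine Finset.sum_le_sum fun j _ => ?_
  rw [← mul_add, Matrix.add_apply]
  gcongr
  exact norm_add_le _ _

theorem ColBd.sub (hA : ColBd m f g A C) (hA' : ColBd m f g A' C') :
    ColBd m f g (A - A') (C + C') := by
  rw [← rowBd_transpose] at *; rw [Matrix.transpose_sub]; exact hA.sub hA'

theorem ColBd.add (hA : ColBd m f g A C) (hA' : ColBd m f g A' C') :
    ColBd m f g (A + A') (C + C') := by
  rw [← rowBd_transpose] at *; rw [Matrix.transpose_add]; exact hA.add hA'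

theorem PtBd.sub (hA : PtBd m f g A C) (hA' : PtBd m f g A' C') :
    PtBd m f g (A - A') (C + C') := by
  intro i j
  refine le_trans ?_ (add_le_add (hA i j) (hA' i j))
  rw [← mul_add, Matrix.sub_apply]
  gcongr
  exact norm_sub_le _ _

theorem RowBd.smul (c : ℂ) (hA : RowBd m f g A C) : RowBd m f g (c • A) (‖c‖ * C) := by
  intro i
  refine le_trans (le_of_eq ?_) (mul_le_mul_of_nonneg_left (hA i) (norm_nonneg c))
  rw [Finset.mul_sum]
  refine Finset.sum_congr rfl fun j _ => ?_
  rw [Matrix.smul_apply, smul_eq_mul, norm_mul]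
  ring

theorem ColBd.smul (c : ℂ) (hA : ColBd m f g A C) : ColBd m f g (c • A) (‖c‖ * C) := by
  rw [← rowBd_transpose] at *; rw [Matrix.transpose_smul]; exact hA.smul c

theorem PtBd.smul (c : ℂ) (hA : PtBd m f g A C) : PtBd m f g (c • A) (‖c‖ * C) := by
  intro i j
  refine le_trans (le_of_eq ?_) (mul_le_mul_of_nonneg_left (hA i j) (norm_nonneg c))
  rw [Matrix.smul_apply, smul_eq_mul, norm_mul]
  ring

theorem RowBd.mono (hA : RowBd m f g A C) {m' : ℝ} (hm : m' ≤ m) (hC : C ≤ C') :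
    RowBd m' f g A C' := by
  intro i
  refine (Finset.sum_le_sum fun j _ => ?_).trans ((hA i).trans hC)
  have := dist_nonneg (x := f i) (y := g j)
  gcongr

theorem ColBd.mono (hA : ColBd m f g A C) {m' : ℝ} (hm : m' ≤ m) (hC : C ≤ C') :
    ColBd m' f g A C' := by
  rw [← rowBd_transpose] at *; exact hA.mono hm hC

theorem PtBd.mono (hA : PtBd m f g A C) {m' : ℝ} (hm : m' ≤ m) (hC : C ≤ C') :
    PtBd m' f g A C' := by
  intro i j
  refine le_trans ?_ ((hA i j).trans hC)
  have := dist_nonneg (x := f i) (y := g j)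
  gcongr

theorem RowBd.one [DecidableEq ι] : RowBd m f f (1 : Matrix ι ι ℂ) 1 := by
  intro i
  rw [Finset.sum_eq_single i]
  · simp
  · intro j _ hj; simp [Matrix.one_apply_ne hj.symm]
  · simp

theorem ColBd.one [DecidableEq ι] : ColBd m f f (1 : Matrix ι ι ℂ) 1 := by
  rw [← rowBd_transpose, Matrix.transpose_one]; exact RowBd.one

/-- The Schur test. -/
theorem l2_mulVec_sq_le_of_rowBd_colBd (hm : 0 ≤ m) (hC : 0 ≤ C) (hA : RowBd m f g A C)
    (hA' : ColBd m f g A D) (φ : κ → ℂ) : l2 (A *ᵥ φ) ^ 2 ≤ C * D * l2 φ ^ 2 := by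
  have hr : ∀ i, ∑ j, ‖A i j‖ ≤ C := fun i => by simpa using (hA.mono hm le_rfl) i
  have hc : ∀ j, ∑ i, ‖A i j‖ ≤ D := fun i => by simpa using (hA'.mono hm le_rfl) i
  rw [l2_sq, l2_sq]
  calc ∑ i, ‖(A *ᵥ φ) i‖ ^ 2 ≤ ∑ i, C * ∑ j, ‖A i j‖ * ‖φ j‖ ^ 2 := by
        refine Finset.sum_le_sum fun i _ => ?_
        have h1 : ‖(A *ᵥ φ) i‖ ≤ ∑ j, ‖A i j‖ * ‖φ j‖ := by
          refine (norm_sum_le _ _).trans (le_of_eq ?_)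
          simp only [norm_mul]
        have h2 : (∑ j, ‖A i j‖ * ‖φ j‖) ^ 2 ≤ (∑ j, ‖A i j‖) * ∑ j, ‖A i j‖ * ‖φ j‖ ^ 2 :=
          Finset.sum_sq_le_sum_mul_sum_of_sq_le_mul _ (fun j _ => norm_nonneg _)
            (fun j _ => by positivity) (fun j _ => le_of_eq (by ring))
        calc _ ≤ (∑ j, ‖A i j‖ * ‖φ j‖) ^ 2 := by gcongr
          _ ≤ _ := h2
          _ ≤ _ := by
            gcongr
            exact hr i
    _ = C * ∑ j, (∑ i, ‖A i j‖) * ‖φ j‖ ^ 2 := by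
        rw [← Finset.mul_sum, Finset.sum_comm]; simp only [Finset.sum_mul]
    _ ≤ C * ∑ j, D * ‖φ j‖ ^ 2 := by
        gcongr with j; exact hc j
    _ = _ := by rw [← Finset.mul_sum, mul_assoc]

theorem l2_mulVec_le_of_rowBd_colBd (hm : 0 ≤ m) (hC : 0 ≤ C) (hA : RowBd m f g A C)
    (hA' : ColBd m f g A C) (φ : κ → ℂ) : l2 (A *ᵥ φ) ≤ C * l2 φ := by
  have := l2_mulVec_sq_le_of_rowBd_colBd hm hC hA hA' φ
  refine (pow_le_pow_iff_left₀ (l2_nonneg _) (mul_nonneg hC (l2_nonneg _)) two_ne_zero).1 ?_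
  rw [mul_pow, pow_two C]
  exact this

end WeightedNorms

section SchurNorm

variable {P : Type*} [PseudoMetricSpace P] {ι : Type*} [Fintype ι]

/-- The weighted row and column sums of a square matrix are bounded. -/
def SchurBd (m : ℝ) (f : ι → P) (A : Matrix ι ι ℂ) (C : ℝ) : Prop :=
  RowBd m f f A C ∧ ColBd m f f A C

variable {m : ℝ} {f : ι → P} {A B : Matrix ι ι ℂ} {C D : ℝ}

namespace SchurBd

theorem mul (hm : 0 ≤ m) (hC : 0 ≤ C) (hD : 0 ≤ D) (hA : SchurBd m f A C) (hB : SchurBd m f B D) :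
    SchurBd m f (A * B) (C * D) := ⟨hA.1.mul hm hD hB.1, hA.2.mul hm hC hB.2⟩

theorem add (hA : SchurBd m f A C) (hB : SchurBd m f B D) : SchurBd m f (A + B) (C + D) :=
  ⟨hA.1.add hB.1, hA.2.add hB.2⟩

theorem sub (hA : SchurBd m f A C) (hB : SchurBd m f B D) : SchurBd m f (A - B) (C + D) :=
  ⟨hA.1.sub hB.1, hA.2.sub hB.2⟩

theorem smul (c : ℂ) (hA : SchurBd m f A C) : SchurBd m f (c • A) (‖c‖ * C) :=
  ⟨hA.1.smul c, hA.2.smul c⟩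

theorem mono (hA : SchurBd m f A C) {m' C' : ℝ} (hm : m' ≤ m) (hC : C ≤ C') :
    SchurBd m' f A C' := ⟨hA.1.mono hm hC, hA.2.mono hm hC⟩

theorem one [DecidableEq ι] : SchurBd m f (1 : Matrix ι ι ℂ) 1 := ⟨RowBd.one, ColBd.one⟩

theorem pow [DecidableEq ι] (hm : 0 ≤ m) (hC : 0 ≤ C) (hA : SchurBd m f A C) (n : ℕ) :
    SchurBd m f (A ^ n) (C ^ n) := by
  induction n with
  | zero => simpa using one
  | succ n ih => rw [pow_succ, pow_succ]; exact ih.mul hm (by positivity) hC hA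

theorem l2_mulVec_le (hm : 0 ≤ m) (hC : 0 ≤ C) (hA : SchurBd m f A C) (φ : ι → ℂ) :
    l2 (A *ᵥ φ) ≤ C * l2 φ := l2_mulVec_le_of_rowBd_colBd hm hC hA.1 hA.2 φ

theorem of_ptBd {v V : ℝ} (hC : 0 ≤ C) (hA : PtBd (2 * m) f f A (C * v))
    (hV : ∀ j, ∑ i, v * Real.exp (-(m * dist (f i) (f j))) ≤ V) : SchurBd m f A (C * V) := by
  have key : ∀ i j, Real.exp (m * dist (f i) (f j)) * ‖A i j‖ ≤
      C * (v * Real.exp (-(m * dist (f i) (f j)))) := by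
    intro i j
    have h1 := hA i j
    have h2 : Real.exp (m * dist (f i) (f j)) =
        Real.exp (-(m * dist (f i) (f j))) * Real.exp (2 * m * dist (f i) (f j)) := by
      rw [← Real.exp_add]; congr 1; ring
    rw [h2]
    calc _ = Real.exp (-(m * dist (f i) (f j))) *
          (Real.exp (2 * m * dist (f i) (f j)) * ‖A i j‖) := by ring
      _ ≤ Real.exp (-(m * dist (f i) (f j))) * (C * v) := by gcongr
      _ = _ := by ring
  constructor
  · intro i
    calc _ ≤ ∑ j, C * (v * Real.exp (-(m * dist (f j) (f i)))) := by
          refine Finset.sum_le_sum fun j _ => ?_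
          rw [dist_comm (f j)]; exact key i j
      _ = C * ∑ j, v * Real.exp (-(m * dist (f j) (f i))) := by rw [Finset.mul_sum]
      _ ≤ _ := by gcongr; exact hV i
  · intro j
    calc _ ≤ ∑ i, C * (v * Real.exp (-(m * dist (f i) (f j)))) :=
          Finset.sum_le_sum fun i _ => key i j
      _ = C * ∑ i, v * Real.exp (-(m * dist (f i) (f j))) := by rw [Finset.mul_sum]
      _ ≤ _ := by gcongr; exact hV j

end SchurBd

theorem abs_exp_sub_one_le {m m₀ s d : ℝ} (hm : 0 ≤ m) (hm₀ : 0 < m₀) (hmm : m ≤ m₀)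
    (hs : |s| ≤ m * d) : |Real.exp s - 1| ≤ m / m₀ * Real.exp (m₀ * d) := by
  have h1 : |Real.exp s - 1| ≤ Real.exp |s| - 1 := by
    rcases le_total 0 s with h0 | h0
    · rw [abs_of_nonneg h0, abs_of_nonneg (by linarith [Real.one_le_exp h0])]
    · rw [abs_of_nonpos h0, abs_of_nonpos (by linarith [Real.exp_le_one_iff.2 h0])]
      have h2 := Real.add_one_le_exp s
      have h3 := Real.add_one_le_exp (-s)
      linarith
  have h2 : Real.exp (m * d) ≤ 1 - m / m₀ + m / m₀ * Real.exp (m₀ * d) := by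
    have ha : 0 ≤ 1 - m / m₀ := by rw [sub_nonneg, div_le_one hm₀]; exact hmm
    have hb : 0 ≤ m / m₀ := by positivity
    have h3 := convexOn_exp.2 (Set.mem_univ 0) (Set.mem_univ (m₀ * d)) ha hb (by ring)
    simp only [smul_eq_mul, mul_zero, zero_add, Real.exp_zero, mul_one] at h3
    have h4 : m / m₀ * (m₀ * d) = m * d := by field_simp
    rwa [h4] at h3
  have h3 : Real.exp |s| ≤ Real.exp (m * d) := Real.exp_le_exp.2 hs
  have h4 : 0 ≤ m / m₀ := by positivity
  linarith

theorem l2_exp_mul_inverse_mulVec_le [DecidableEq ι] {m₀ : ℝ} {R Z : Matrix ι ι ℂ} {CR CZ : ℝ}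
    (hm : 0 ≤ m) (hm₀ : 0 < m₀) (hmm : m ≤ m₀) (hCR : 0 ≤ CR) (hCZ : 0 ≤ CZ)
    (hR : SchurBd m₀ f R CR) (hZ : Z * (1 - R) = 1) (hZ' : (1 - R) * Z = 1)
    (hZ2 : ∀ φ, l2 (Z *ᵥ φ) ≤ CZ * l2 φ) (hsmall : m / m₀ * CR * CZ ≤ 1 / 2) (ρ : ι → ℝ)
    (hρ : ∀ i j, |ρ i - ρ j| ≤ dist (f i) (f j)) (c : ι → ℂ) :
    l2 (fun i => (Real.exp (m * ρ i) : ℂ) * (Z *ᵥ c) i) ≤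
      2 * CZ * l2 (fun i => (Real.exp (m * ρ i) : ℂ) * c i) := by
  set ψ : ι → ℂ := fun i => (Real.exp (m * ρ i) : ℂ) * (Z *ᵥ c) i with hψ
  set c' : ι → ℂ := fun i => (Real.exp (m * ρ i) : ℂ) * c i with hc'
  set F : Matrix ι ι ℂ := Matrix.of fun i j =>
    ((Real.exp (m * (ρ i - ρ j)) - 1 : ℝ) : ℂ) * R i j with hF
  have hFe : ∀ i j, ‖F i j‖ ≤ m / m₀ * (Real.exp (m₀ * dist (f i) (f j)) * ‖R i j‖) := by
    intro i j
    simp only [hF, Matrix.of_apply, norm_mul, Complex.norm_real, Real.norm_eq_abs]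
    rw [← mul_assoc]
    gcongr
    refine abs_exp_sub_one_le hm hm₀ hmm ?_
    rw [abs_mul, abs_of_nonneg hm]
    exact mul_le_mul_of_nonneg_left (hρ i j) hm
  have hFb : SchurBd 0 f F (m / m₀ * CR) := by
    constructor
    · intro i
      simp only [zero_mul, Real.exp_zero, one_mul]
      refine (Finset.sum_le_sum fun j _ => hFe i j).trans ?_
      rw [← Finset.mul_sum]
      gcongr
      exact hR.1 i
    · intro j
      simp only [zero_mul, Real.exp_zero, one_mul]
      refine (Finset.sum_le_sum fun i _ => hFe i j).trans ?_
      rw [← Finset.mul_sum]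
      gcongr
      exact hR.2 j
  have hF2 := hFb.l2_mulVec_le le_rfl (by positivity) ψ
  have heq : (1 - R) *ᵥ ψ = c' + F *ᵥ ψ := by
    have h1 : Z *ᵥ c = c + R *ᵥ (Z *ᵥ c) := by
      have h2 : (1 - R) *ᵥ (Z *ᵥ c) = c := by
        rw [Matrix.mulVec_mulVec, hZ', Matrix.one_mulVec]
      rw [Matrix.sub_mulVec, Matrix.one_mulVec] at h2
      exact sub_eq_iff_eq_add.1 h2
    funext i
    have h3 := congrFun h1 i
    rw [Matrix.sub_mulVec, Matrix.one_mulVec]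
    simp only [Pi.sub_apply, Pi.add_apply]
    have h4 : (R *ᵥ ψ) i + (F *ᵥ ψ) i =
        (Real.exp (m * ρ i) : ℂ) * (R *ᵥ (Z *ᵥ c)) i := by
      change ∑ j, R i j * ψ j + ∑ j, F i j * ψ j =
        (Real.exp (m * ρ i) : ℂ) * ∑ j, R i j * (Z *ᵥ c) j
      rw [Finset.mul_sum, ← Finset.sum_add_distrib]
      refine Finset.sum_congr rfl fun j _ => ?_
      simp only [hF, Matrix.of_apply, hψ]
      have h5 : Real.exp (m * (ρ i - ρ j)) * Real.exp (m * ρ j) = Real.exp (m * ρ i) := by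
        rw [← Real.exp_add]; congr 1; ring
      rw [← h5]
      push_cast
      ring
    have h6 : ψ i = c' i + (Real.exp (m * ρ i) : ℂ) * (R *ᵥ (Z *ᵥ c)) i := by
      simp only [hψ, hc']
      rw [← mul_add, ← Pi.add_apply c, ← h1]
    rw [h6, ← h4]
    ring
  have hψ2 : ψ = Z *ᵥ (c' + F *ᵥ ψ) := by
    rw [← heq, Matrix.mulVec_mulVec, hZ, Matrix.one_mulVec]
  have h7 : l2 ψ ≤ CZ * (l2 c' + m / m₀ * CR * l2 ψ) := by
    calc l2 ψ = l2 (Z *ᵥ (c' + F *ᵥ ψ)) := by rw [← hψ2]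
      _ ≤ CZ * l2 (c' + F *ᵥ ψ) := hZ2 _
      _ ≤ CZ * (l2 c' + m / m₀ * CR * l2 ψ) := by
        gcongr
        exact (l2_add_le _ _).trans (by gcongr)
  have h8 : m / m₀ * CR * CZ * l2 ψ ≤ 1 / 2 * l2 ψ :=
    mul_le_mul_of_nonneg_right hsmall (l2_nonneg _)
  nlinarith

theorem l2_exp_mul_le_of_ptBd_of_sum {a b : ℝ} {c : ι → ℂ} {w : ι → ℝ} (ha : 0 ≤ a)
    (h1 : ∀ i, Real.exp (w i) * ‖c i‖ ≤ a)
    (h2 : ∑ i, Real.exp (w i) * ‖c i‖ ≤ b) :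
    l2 (fun i => (Real.exp (w i) : ℂ) * c i) ≤ √(a * b) := by
  refine l2_le_of_sq_le (Real.sqrt_nonneg _) ?_
  have hb : 0 ≤ b := (Finset.sum_nonneg fun i _ => by positivity).trans h2
  rw [Real.sq_sqrt (by positivity)]
  calc _ = ∑ i, (Real.exp (w i) * ‖c i‖) * (Real.exp (w i) * ‖c i‖) := by
        refine Finset.sum_congr rfl fun i _ => ?_
        rw [norm_mul, Complex.norm_real, Real.norm_eq_abs, Real.abs_exp]; ring
    _ ≤ ∑ i, a * (Real.exp (w i) * ‖c i‖) := by
        gcongr with i; exact h1 i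
    _ ≤ _ := by rw [← Finset.mul_sum]; gcongr

/-- A Combes–Thomas estimate: if `R` has exponential decay and `Z = (1 - R)⁻¹` is bounded on `ℓ²`,
then `A Z B` decays exponentially for bounded kernels `A` and `B`. -/
theorem ptBd_mul_inverse_mul [DecidableEq ι] {m₀ : ℝ} {R Z A B : Matrix ι ι ℂ} {CR CZ a ca : ℝ}
    (hm : 0 ≤ m) (hm₀ : 0 < m₀) (hmm : m ≤ m₀) (hCR : 0 ≤ CR) (hCZ : 0 ≤ CZ)
    (hR : SchurBd m₀ f R CR) (hZ : Z * (1 - R) = 1) (hZ' : (1 - R) * Z = 1)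
    (hZ2 : ∀ φ, l2 (Z *ᵥ φ) ≤ CZ * l2 φ) (hsmall : m / m₀ * CR * CZ ≤ 1 / 2) (ha : 0 ≤ a)
    (hca : 0 ≤ ca)
    (hA : PtBd m₀ f f A a) (hA' : RowBd m₀ f f A ca) (hB : PtBd m₀ f f B a)
    (hB' : ColBd m₀ f f B ca) : PtBd m f f (A * Z * B) (2 * CZ * ca * a) := by
  intro i j
  have hA := hA.mono hmm le_rfl
  have hA' := hA'.mono hmm le_rfl
  have hB := hB.mono hmm le_rfl
  have hB' := hB'.mono hmm le_rfl
  set ρ : ι → ℝ := fun k => dist (f k) (f j) with hρ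
  have hct := l2_exp_mul_inverse_mulVec_le hm hm₀ hmm hCR hCZ hR hZ hZ' hZ2 hsmall ρ
    (fun i k => abs_dist_sub_le (f i) (f k) (f j)) (fun k => B k j)
  have hb := l2_exp_mul_le_of_ptBd_of_sum (c := fun k => B k j) (w := fun k => m * ρ k) ha
    (fun k => hB k j) (hB' j)
  have hrow := l2_exp_mul_le_of_ptBd_of_sum (c := fun k => A i k)
    (w := fun k => m * dist (f i) (f k)) ha (fun k => hA i k) (hA' i)
  set ψ : ι → ℂ := fun i => (Real.exp (m * ρ i) : ℂ) * (Z *ᵥ fun k => B k j) i with hψ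
  have hsq : √(a * ca) * √(a * ca) = a * ca := Real.mul_self_sqrt (by positivity)
  calc Real.exp (m * dist (f i) (f j)) * ‖(A * Z * B) i j‖
      = Real.exp (m * dist (f i) (f j)) * ‖∑ k, A i k * (Z *ᵥ fun k => B k j) k‖ := by
        rw [Matrix.mul_assoc, Matrix.mul_apply]; rfl
    _ ≤ Real.exp (m * dist (f i) (f j)) * ∑ k, ‖A i k‖ * ‖(Z *ᵥ fun k => B k j) k‖ := by
        gcongr
        refine (norm_sum_le _ _).trans (le_of_eq ?_)
        simp only [norm_mul]
    _ ≤ ∑ k, ‖(Real.exp (m * dist (f i) (f k)) : ℂ) * A i k‖ * ‖ψ k‖ := by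
        rw [Finset.mul_sum]
        refine Finset.sum_le_sum fun k _ => ?_
        simp only [hψ, norm_mul, Complex.norm_real, Real.norm_eq_abs, Real.abs_exp]
        calc _ ≤ (Real.exp (m * dist (f i) (f k)) * Real.exp (m * dist (f k) (f j))) *
              (‖A i k‖ * ‖(Z *ᵥ fun k => B k j) k‖) := by
              gcongr; exact exp_dist_le_mul hm _ _ _
          _ = _ := by simp only [hρ]; ring
    _ ≤ l2 (fun k => (Real.exp (m * dist (f i) (f k)) : ℂ) * A i k) * l2 ψ :=
        sum_mul_le_l2_mul_l2 _ _
    _ ≤ √(a * ca) * (2 * CZ * √(a * ca)) := by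
        gcongr
        · exact l2_nonneg _
        · exact hct.trans (by gcongr)
    _ = 2 * CZ * (√(a * ca) * √(a * ca)) := by ring
    _ = _ := by rw [hsq]; ring

theorem schurBd_inverse [DecidableEq ι] {m₀ : ℝ} {R Z : Matrix ι ι ℂ} {CR CZ CP v V : ℝ}
    (hm : 0 ≤ m) (hm₀ : 0 < m₀) (hmm : 2 * m ≤ m₀) (hCR : 0 ≤ CR) (hCZ : 0 ≤ CZ) (hCP : 0 ≤ CP)
    (hv : 0 ≤ v)
    (hR : SchurBd m₀ f R CR) (hZ : Z * (1 - R) = 1) (hZ' : (1 - R) * Z = 1)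
    (hZ2 : ∀ φ, l2 (Z *ᵥ φ) ≤ CZ * l2 φ) (hsmall : 2 * m / m₀ * CR * CZ ≤ 1 / 2)
    (hP : PtBd m₀ f f (R ^ 3) (CP * v))
    (hV : ∀ j, ∑ i, v * Real.exp (-(m * dist (f i) (f j))) ≤ V) :
    SchurBd m f Z (1 + CR + CR ^ 2 + CR ^ 3 + CR ^ 4 + CR ^ 5 + 2 * CZ * CR ^ 3 * CP * V) := by
  have hmm' : m ≤ m₀ := by linarith
  have hR3 := hR.pow hm₀.le hCR 3
  have h1 := ptBd_mul_inverse_mul (m := 2 * m) (by positivity) hm₀ hmm hCR hCZ hR hZ hZ' hZ2 hsmall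
    (a := CP * v) (ca := CR ^ 3) (by positivity) (by positivity) hP hR3.1 hP hR3.2
  have h2 : SchurBd m f (R ^ 3 * Z * R ^ 3) (2 * CZ * CR ^ 3 * CP * V) := by
    refine SchurBd.of_ptBd (C := 2 * CZ * CR ^ 3 * CP) (v := v) (by positivity) ?_ hV
    refine h1.mono le_rfl (le_of_eq (by ring))
  have hZR : Z * R = R * Z := by
    have e1 : Z - Z * R = 1 := by rw [← hZ]; noncomm_ring
    have e2 : Z - R * Z = 1 := by rw [← hZ']; noncomm_ring
    have : Z - Z * R = Z - R * Z := e1.trans e2.symm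
    simpa using this
  have hexp : Z = 1 + R + R ^ 2 + R ^ 3 + R ^ 4 + R ^ 5 + R ^ 3 * Z * R ^ 3 := by
    have e1 : Z * (1 - R) * (1 + R + R ^ 2 + R ^ 3 + R ^ 4 + R ^ 5) = Z - Z * R ^ 6 := by
      noncomm_ring
    have e2 : R ^ 3 * Z = Z * R ^ 3 := ((Commute.pow_right (show Commute Z R from hZR) 3).eq).symm
    rw [hZ, one_mul] at e1
    rw [e2, e1]
    noncomm_ring
  have hRm := hR.mono hmm' le_rfl
  rw [hexp]
  have h5 := ((((SchurBd.one (m := m) (f := f)).add hRm).add (hRm.pow hm hCR 2)).add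
    (hRm.pow hm hCR 3)).add (hRm.pow hm hCR 4) |>.add (hRm.pow hm hCR 5) |>.add h2
  exact h5

end SchurNorm

section Green

variable {P : Type*} [PseudoMetricSpace P] {ι : Type*} [Fintype ι] [DecidableEq ι]

/-- The constant in `schurBd_green`. -/
def greenConst (μ CG CK CS CP CQ V : ℝ) : ℝ :=
  let CR := CG * (μ + CK)
  let CZ := 1 + CS * (μ + CK)
  let CPR := μ * (μ * (μ * CP + CG ^ 3 * CQ) + CG ^ 2 * CQ * CR) + CG * CQ * CR ^ 2
  (1 + CR + CR ^ 2 + CR ^ 3 + CR ^ 4 + CR ^ 5 + 2 * CZ * CR ^ 3 * CPR * V) * CG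

/-- The rate of exponential decay in `schurBd_green`. -/
def greenRate (μ CG CK CS m₀ : ℝ) : ℝ :=
  m₀ / (4 * (CG * (μ + CK) * (1 + CS * (μ + CK)) + 1))

/-- Exponential decay of `(D + K)⁻¹`, given an `ℓ²` bound on this inverse, the decay of the massive
inverse `G = (D + μ)⁻¹`, and pointwise bounds for the kernels of `G³` and `K`. -/
theorem schurBd_green {f : ι → P} {m₀ μ CG CK CS CP CQ v V : ℝ} {D K G S : Matrix ι ι ℂ}
    (hm₀ : 0 < m₀) (hμ : 0 ≤ μ) (hCG : 0 ≤ CG) (hCK : 0 ≤ CK) (hCS : 0 ≤ CS) (hCP : 0 ≤ CP)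
    (hCQ : 0 ≤ CQ) (hv : 0 ≤ v)
    (hG1 : G * (D + (μ : ℂ) • 1) = 1) (hG2 : (D + (μ : ℂ) • 1) * G = 1)
    (hS1 : S * (D + K) = 1) (hS2 : (D + K) * S = 1) (hG : SchurBd m₀ f G CG)
    (hK : SchurBd m₀ f K CK) (hG3 : PtBd m₀ f f (G ^ 3) (CP * v)) (hKp : PtBd m₀ f f K (CQ * v))
    (hS : ∀ φ, l2 (S *ᵥ φ) ≤ CS * l2 φ)
    (hV : ∀ j, ∑ i, v * Real.exp (-(greenRate μ CG CK CS m₀ * dist (f i) (f j))) ≤ V) :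
    SchurBd (greenRate μ CG CK CS m₀) f S (greenConst μ CG CK CS CP CQ V) := by
  set R : Matrix ι ι ℂ := G * ((μ : ℂ) • 1 - K) with hRdef
  set Z : Matrix ι ι ℂ := S * (D + (μ : ℂ) • 1) with hZdef
  have hμn : ‖(μ : ℂ)‖ = μ := by rw [Complex.norm_real, Real.norm_eq_abs, abs_of_nonneg hμ]
  have hVb : SchurBd m₀ f ((μ : ℂ) • 1 - K) (μ + CK) := by
    have := (SchurBd.one (m := m₀) (f := f)).smul (μ : ℂ)
    rw [hμn, mul_one] at this
    exact this.sub hK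
  set CR := CG * (μ + CK) with hCRdef
  have hCR : 0 ≤ CR := by positivity
  have hR : SchurBd m₀ f R CR := hG.mul hm₀.le hCG (by positivity) hVb
  have h1R : 1 - R = G * (D + K) := by
    calc 1 - R = G * (D + (μ : ℂ) • 1) - G * ((μ : ℂ) • 1 - K) := by rw [hG1]
      _ = G * (D + K) := by rw [← mul_sub]; congr 1; abel
  have hZ : Z * (1 - R) = 1 := by
    rw [h1R, hZdef, ← mul_assoc, mul_assoc S, hG2, mul_one, hS1]
  have hZ' : (1 - R) * Z = 1 := by
    rw [h1R, hZdef, ← mul_assoc, mul_assoc G, hS2, mul_one, hG1]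
  have hZ1 : Z = 1 + S * ((μ : ℂ) • 1 - K) := by
    calc Z = S * (D + K) + S * ((μ : ℂ) • 1 - K) := by
          rw [hZdef, ← mul_add]; congr 1; abel
      _ = _ := by rw [hS1]
  set CZ := 1 + CS * (μ + CK) with hCZdef
  have hCZ : 0 ≤ CZ := by positivity
  have hZ2 : ∀ φ, l2 (Z *ᵥ φ) ≤ CZ * l2 φ := by
    intro φ
    rw [hZ1, Matrix.add_mulVec, Matrix.one_mulVec, ← Matrix.mulVec_mulVec]
    calc _ ≤ l2 φ + CS * ((μ + CK) * l2 φ) := by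
          refine (l2_add_le _ _).trans ?_
          gcongr
          refine (hS _).trans ?_
          gcongr
          exact hVb.l2_mulVec_le hm₀.le (by positivity) φ
      _ = _ := by rw [hCZdef]; ring
  have hRsub : R = (μ : ℂ) • G - G * K := by rw [hRdef, mul_sub, mul_smul_comm, mul_one]
  have hG2b := hG.pow hm₀.le hCG 2
  have hG3b := hG.pow hm₀.le hCG 3
  -- pointwise bounds for `G² R`, `G R²` and `R³`
  have hp1 : PtBd m₀ f f (G ^ 2 * R) ((μ * CP + CG ^ 3 * CQ) * v) := by
    have e : G ^ 2 * R = (μ : ℂ) • G ^ 3 - G ^ 3 * K := by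
      rw [hRsub, mul_sub, mul_smul_comm, ← mul_assoc, ← pow_succ]
    rw [e]
    have := (hG3.smul (μ : ℂ)).sub (hG3b.1.mul_ptBd hm₀.le (by positivity) hKp)
    rw [hμn] at this
    exact this.mono le_rfl (le_of_eq (by ring))
  have hp2 : PtBd m₀ f f (G * R ^ 2)
      ((μ * (μ * CP + CG ^ 3 * CQ) + CG ^ 2 * CQ * CR) * v) := by
    have e : G * R ^ 2 = (μ : ℂ) • (G ^ 2 * R) - G ^ 2 * K * R := by
      have : G * R = (μ : ℂ) • G ^ 2 - G ^ 2 * K := by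
        rw [hRsub, mul_sub, mul_smul_comm, ← mul_assoc, ← pow_two]
      rw [pow_two R, ← mul_assoc, this, sub_mul, smul_mul_assoc]
    rw [e]
    have := (hp1.smul (μ : ℂ)).sub
      ((hG2b.1.mul_ptBd hm₀.le (by positivity) hKp).mul_colBd hm₀.le (by positivity) hR.2)
    rw [hμn] at this
    exact this.mono le_rfl (le_of_eq (by ring))
  have hp3 : PtBd m₀ f f (R ^ 3) ((μ * (μ * (μ * CP + CG ^ 3 * CQ) + CG ^ 2 * CQ * CR) +
      CG * CQ * CR ^ 2) * v) := by
    have e : R ^ 3 = (μ : ℂ) • (G * R ^ 2) - G * K * R ^ 2 := by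
      conv_lhs => rw [pow_succ' R 2]
      nth_rewrite 1 [hRsub]
      rw [sub_mul, smul_mul_assoc]
    rw [e]
    have := (hp2.smul (μ : ℂ)).sub
      ((hG.1.mul_ptBd hm₀.le (by positivity) hKp).mul_colBd hm₀.le (by positivity)
        (hR.pow hm₀.le hCR 2).2)
    rw [hμn] at this
    exact this.mono le_rfl (le_of_eq (by ring))
  set m := greenRate μ CG CK CS m₀ with hmdef
  have hmeq : m = m₀ / (4 * (CR * CZ + 1)) := rfl
  have hmpos : 0 < m := by rw [hmeq]; positivity
  have hprod : 0 ≤ CR * CZ := by positivity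
  have hmm : 2 * m ≤ m₀ := by
    rw [hmeq, ← mul_div_assoc, div_le_iff₀ (by positivity)]
    nlinarith
  have hsmall : 2 * m / m₀ * CR * CZ ≤ 1 / 2 := by
    have : 2 * m / m₀ * CR * CZ = CR * CZ / (2 * (CR * CZ + 1)) := by
      rw [hmeq]; field_simp; ring
    rw [this, div_le_div_iff₀ (by positivity) (by positivity)]
    linarith
  have hfin := schurBd_inverse hmpos.le hm₀ hmm hCR hCZ (by positivity) hv hR hZ hZ' hZ2 hsmall
    hp3 hV
  have hZG : S = Z * G := by rw [hZdef, mul_assoc, hG2, mul_one]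
  rw [hZG]
  rcases isEmpty_or_nonempty ι with hι | ⟨⟨i₀⟩⟩
  · exact ⟨fun i => hι.elim i, fun i => hι.elim i⟩
  have hV0 : 0 ≤ V := (Finset.sum_nonneg fun i _ => by positivity).trans (hV i₀)
  exact hfin.mul hmpos.le (by positivity) hCG (hG.mono (by linarith) le_rfl)

end Green

end ParabolicBlockSpin

namespace ParabolicBlockSpin

open Matrix

section Geometric

variable {ι : Type*} [Fintype ι] [DecidableEq ι] {A : Matrix ι ι ℂ} {c : ℝ}

open scoped Matrix.Norms.L2Operator in
theorem l2_opNorm_le_of_forall {C : ℝ} (hC : 0 ≤ C) (h : ∀ φ, l2 (A *ᵥ φ) ≤ C * l2 φ) :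
    ‖A‖ ≤ C := by
  rw [Matrix.l2_opNorm_def]
  refine ContinuousLinearMap.opNorm_le_bound _ hC fun x => ?_
  exact h (WithLp.ofLp x)

open scoped Matrix.Norms.L2Operator in
theorem isUnit_one_sub_of_l2 (hc : 0 ≤ c) (hc1 : c < 1) (h : ∀ φ, l2 (A *ᵥ φ) ≤ c * l2 φ) :
    IsUnit (1 - A) := by
  have : CompleteSpace (Matrix ι ι ℂ) := FiniteDimensional.complete ℂ _
  exact isUnit_one_sub_of_norm_lt_one ((l2_opNorm_le_of_forall hc h).trans_lt hc1)

open scoped Matrix.Norms.L2Operator in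
theorem hasSum_choose_mul_pow_apply (hc : 0 ≤ c) (hc1 : c < 1)
    (h : ∀ φ, l2 (A *ᵥ φ) ≤ c * l2 φ) (n : ℕ) (i j : ι) :
    HasSum (fun k : ℕ => ((k + n).choose n : ℂ) * (A ^ k) i j) (((1 - A)⁻¹ ^ (n + 1)) i j) := by
  have : CompleteSpace (Matrix ι ι ℂ) := FiniteDimensional.complete ℂ _
  have h1 := hasSum_choose_mul_geometric_of_norm_lt_one' n
    ((l2_opNorm_le_of_forall hc h).trans_lt hc1)
  rw [Matrix.nonsing_inv_eq_ringInverse]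
  have h2 := h1.map (Matrix.entryLinearMap ℂ ℂ i j) (LinearMap.continuous_of_finiteDimensional _)
  have h3 : (fun k : ℕ => ((k + n).choose n : ℂ) * (A ^ k) i j) =
      (Matrix.entryLinearMap ℂ ℂ i j) ∘ fun k : ℕ => (((k + n).choose n : ℕ) : Matrix ι ι ℂ) * A ^ k := by
    funext k
    simp only [Function.comp_apply, Matrix.entryLinearMap_apply]
    rw [← nsmul_eq_mul]
    conv_rhs => rw [← nsmul_eq_mul]
    rfl
  rw [h3]
  exact h2

theorem RowBd.of_hasSum {P : Type*} [PseudoMetricSpace P] {κ l : Type*} [Fintype κ] {m : ℝ}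
    {f : l → P} {g : κ → P} {a : ℕ → Matrix l κ ℂ} {H : Matrix l κ ℂ} {b : ℕ → ℝ} {C : ℝ}
    (ha : ∀ i j, HasSum (fun k => a k i j) (H i j)) (hb : ∀ k, RowBd m f g (a k) (b k))
    (hC : HasSum b C) : RowBd m f g H C := by
  intro i
  have h1 : Filter.Tendsto (fun s : Finset ℕ => ∑ j, Real.exp (m * dist (f i) (g j)) *
      ‖∑ k ∈ s, a k i j‖) Filter.atTop
      (nhds (∑ j, Real.exp (m * dist (f i) (g j)) * ‖H i j‖)) := by
    refine tendsto_finsetSum _ fun j _ => ?_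
    exact ((ha i j).norm).const_mul _
  refine le_of_tendsto_of_tendsto' h1 hC fun s => ?_
  calc _ ≤ ∑ j, Real.exp (m * dist (f i) (g j)) * ∑ k ∈ s, ‖a k i j‖ := by
        gcongr; exact norm_sum_le _ _
    _ = ∑ k ∈ s, ∑ j, Real.exp (m * dist (f i) (g j)) * ‖a k i j‖ := by
        rw [Finset.sum_comm]; simp only [Finset.mul_sum]
    _ ≤ _ := Finset.sum_le_sum fun k _ => hb k i

theorem ColBd.of_hasSum {P : Type*} [PseudoMetricSpace P] {κ l : Type*} [Fintype l] {m : ℝ}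
    {f : l → P} {g : κ → P} {a : ℕ → Matrix l κ ℂ} {H : Matrix l κ ℂ} {b : ℕ → ℝ} {C : ℝ}
    (ha : ∀ i j, HasSum (fun k => a k i j) (H i j)) (hb : ∀ k, ColBd m f g (a k) (b k))
    (hC : HasSum b C) : ColBd m f g H C := by
  intro j
  have := RowBd.of_hasSum (m := m) (f := g) (g := f) (a := fun k => (a k)ᵀ) (H := Hᵀ)
    (fun i j => ha j i) (fun k i => by simpa [dist_comm] using hb k i) hC j
  simpa [dist_comm] using this

end Geometric

section Cosets

variable {M : ℕ} [NeZero M]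

/-- The exponential weight on a residue class. -/
def cosetExp (M : ℕ) (α : ℝ) (c : ZMod M) (z : ℤ) : ℝ :=
  if (z : ZMod M) = c then Real.exp (-(α * |(z : ℝ)|)) else 0

theorem cosetExp_nonneg (α : ℝ) (c : ZMod M) (z : ℤ) : 0 ≤ cosetExp M α c z := by
  unfold cosetExp; split_ifs <;> positivity

theorem summable_cosetExp {α : ℝ} (hα : 0 < α) (c : ZMod M) : Summable (cosetExp M α c) := by
  refine Summable.of_nonneg_of_le (cosetExp_nonneg α c) (fun z => ?_)
    (summable_exp_neg_mul_abs_int hα)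
  unfold cosetExp; split_ifs
  · exact le_rfl
  · positivity

theorem tsum_cosetExp_le {α : ℝ} (hα : 1 ≤ α * M) (c : ZMod M) :
    ∑' z, cosetExp M α c z ≤ 6 := by
  have hM : (0 : ℝ) < M := by exact_mod_cast Nat.pos_of_ne_zero (NeZero.ne M)
  have hα0 : 0 < α := by
    by_contra hcon
    push Not at hcon
    have := mul_nonpos_of_nonpos_of_nonneg hcon hM.le
    linarith
  set c₀ : ℤ := c.valMinAbs with hc₀
  have hc₀c : ((c₀ : ℤ) : ZMod M) = c := ZMod.coe_valMinAbs c
  have hc₀le : |(c₀ : ℝ)| ≤ (M : ℝ) / 2 := by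
    have h1 := c.natAbs_valMinAbs_le
    have h3 : 2 * c.valMinAbs.natAbs ≤ M := by omega
    have h4 : (2 : ℝ) * (c.valMinAbs.natAbs : ℝ) ≤ M := by exact_mod_cast h3
    rw [Nat.cast_natAbs, Int.cast_abs] at h4
    linarith
  have hinj : Function.Injective fun j : ℤ => c₀ + j * (M : ℤ) := by
    intro i j hij
    simp only [add_right_inj] at hij
    exact mul_right_cancel₀ (by exact_mod_cast NeZero.ne M) hij
  have hsupp : Function.support (cosetExp M α c) ⊆ Set.range fun j : ℤ => c₀ + j * (M : ℤ) := by
    intro z hz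
    have hzc : (z : ZMod M) = c := by
      by_contra hcon
      simp [cosetExp, hcon] at hz
    rw [← hc₀c, ZMod.intCast_eq_intCast_iff_dvd_sub] at hzc
    obtain ⟨j, hj⟩ := hzc
    refine ⟨-j, ?_⟩
    simp only
    linarith
  rw [← hinj.tsum_eq hsupp]
  have hle : ∀ j : ℤ, cosetExp M α c (c₀ + j * (M : ℤ)) ≤ Real.exp (-(1 / 2 * |(j : ℝ)|)) := by
    intro j
    unfold cosetExp
    split_ifs
    · refine Real.exp_le_exp.2 (neg_le_neg ?_)
      by_cases hj : j = 0
      · subst hj; simp; positivity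
      · have hj1 : (1 : ℝ) ≤ |(j : ℝ)| := by
          rw [← Int.cast_abs]; exact_mod_cast Int.one_le_abs hj
        have h1 : |(j : ℝ)| * M / 2 ≤ |((c₀ + j * (M : ℤ) : ℤ) : ℝ)| := by
          push_cast
          have h2 : |(j : ℝ) * M| ≤ |(c₀ : ℝ) + j * M| + |(c₀ : ℝ)| := by
            have : (j : ℝ) * M = ((c₀ : ℝ) + j * M) - c₀ := by ring
            calc |(j : ℝ) * M| = |((c₀ : ℝ) + j * M) - c₀| := by rw [← this]
              _ ≤ _ := abs_sub _ _
          rw [abs_mul, abs_of_pos hM] at h2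
          nlinarith
        calc 1 / 2 * |(j : ℝ)| ≤ (α * M) * (|(j : ℝ)| / 2) := by nlinarith
          _ = α * (|(j : ℝ)| * M / 2) := by ring
          _ ≤ _ := by gcongr
    · positivity
  calc _ ≤ ∑' j : ℤ, Real.exp (-(1 / 2 * |(j : ℝ)|)) :=
        Summable.tsum_le_tsum hle ((summable_cosetExp hα0 c).comp_injective hinj)
          (summable_exp_neg_mul_abs_int (by norm_num))
    _ ≤ 2 + 2 / (1 / 2) := tsum_exp_neg_mul_abs_int_le (by norm_num)
    _ = 6 := by norm_num

theorem hasSum_prod_cosetExp {α : ℝ} (hα : 0 < α) (c : Fin 3 → ZMod M) :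
    HasSum (fun z : Fin 3 → ℤ => ∏ ν, cosetExp M α (c ν) (z ν))
      (∏ ν, ∑' z, cosetExp M α (c ν) z) :=
  hasSum_prod_of_nonneg (g := fun ν => cosetExp M α (c ν)) (fun _ _ => cosetExp_nonneg _ _ _)
    (fun ν => (summable_cosetExp hα (c ν)).hasSum)

theorem tsum_prod_cosetExp_le {α : ℝ} (hα0 : 0 < α) (hα : 1 ≤ α * M) (c : Fin 3 → ZMod M) :
    ∑' z : Fin 3 → ℤ, ∏ ν, cosetExp M α (c ν) (z ν) ≤ 216 := by
  rw [(hasSum_prod_cosetExp hα0 c).tsum_eq]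
  calc _ ≤ ∏ _ν : Fin 3, (6 : ℝ) := Finset.prod_le_prod
        (fun ν _ => tsum_nonneg fun z => cosetExp_nonneg _ _ _)
        (fun ν _ => tsum_cosetExp_le hα _)
    _ = 216 := by norm_num

theorem tsum_nat_cosetExp_le {α : ℝ} (hα0 : 0 < α) (hα : 1 ≤ α * M) (c : ZMod M) :
    Summable (fun k : ℕ => cosetExp M α c k) ∧ ∑' k : ℕ, cosetExp M α c k ≤ 6 := by
  have hs := summable_cosetExp hα0 c
  refine ⟨hs.comp_injective Nat.cast_injective, ?_⟩
  refine le_trans ?_ (tsum_cosetExp_le hα c)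
  exact tsum_comp_le_tsum_of_inj hs (cosetExp_nonneg α c) Nat.cast_injective

end Cosets

section HeatBounds

variable (h : SingleParticle)

theorem SingleParticle.exists_norm_heatKernel_le_scaled :
    ∃ C γ : ℝ, 0 ≤ C ∧ 0 ≤ γ ∧ ∀ (k : ℕ) (z : Fin 3 → ℤ) (e : ℝ), 1 ≤ k → 0 ≤ e → e ≤ 1 →
      ‖h.heatKernel k z‖ ≤ C * (√(k : ℝ))⁻¹ ^ 3 * Real.exp (γ * (e ^ 2 * k)) *
        ∏ ν, Real.exp (-((2 * e + (√(k : ℝ))⁻¹) * |(z ν : ℝ)|)) := by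
  obtain ⟨C₁, C₂, h1, h2, H⟩ := h.exists_norm_heatKernel_le 9
  refine ⟨C₁ * Real.exp (18 * C₂), 72 * C₂, by positivity, by positivity,
    fun k z e hk he he1 => ?_⟩
  have hk1 : (1 : ℝ) ≤ k := by exact_mod_cast hk
  have hsk : 1 ≤ √(k : ℝ) := Real.one_le_sqrt.2 hk1
  have hski : (√(k : ℝ))⁻¹ ≤ 1 := inv_le_one_of_one_le₀ hsk
  have hski0 : 0 ≤ (√(k : ℝ))⁻¹ := by positivity
  have hH := H k z (3 * (2 * e + (√(k : ℝ))⁻¹)) hk (by positivity) (by linarith)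
  have e1 : 3 * (2 * e + (√(k : ℝ))⁻¹) / 3 = 2 * e + (√(k : ℝ))⁻¹ := by ring
  rw [e1] at hH
  refine hH.trans ?_
  have e2 : C₂ * k * (3 * (2 * e + (√(k : ℝ))⁻¹)) ^ 2 ≤ 18 * C₂ + 72 * C₂ * (e ^ 2 * k) := by
    have e3 : (k : ℝ) * (√(k : ℝ))⁻¹ ^ 2 = 1 := by
      rw [inv_pow, Real.sq_sqrt (by positivity)]; field_simp
    have e4 : (2 * e + (√(k : ℝ))⁻¹) ^ 2 ≤ 2 * (4 * e ^ 2) + 2 * (√(k : ℝ))⁻¹ ^ 2 := by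
      nlinarith [sq_nonneg (2 * e - (√(k : ℝ))⁻¹)]
    calc C₂ * k * (3 * (2 * e + (√(k : ℝ))⁻¹)) ^ 2
        = 9 * (C₂ * k) * (2 * e + (√(k : ℝ))⁻¹) ^ 2 := by ring
      _ ≤ 9 * (C₂ * k) * (2 * (4 * e ^ 2) + 2 * (√(k : ℝ))⁻¹ ^ 2) := by gcongr
      _ = 18 * C₂ * (k * (√(k : ℝ))⁻¹ ^ 2) + 72 * C₂ * (e ^ 2 * k) := by ring
      _ = _ := by rw [e3]; ring
  have e5 : Real.exp (C₂ * k * (3 * (2 * e + (√(k : ℝ))⁻¹)) ^ 2) ≤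
      Real.exp (18 * C₂) * Real.exp (72 * C₂ * (e ^ 2 * k)) := by
    rw [← Real.exp_add]; exact Real.exp_le_exp.2 e2
  calc _ ≤ C₁ * (√(k : ℝ))⁻¹ ^ 3 * (Real.exp (18 * C₂) * Real.exp (72 * C₂ * (e ^ 2 * k))) *
        ∏ ν, Real.exp (-((2 * e + (√(k : ℝ))⁻¹) * |(z ν : ℝ)|)) := by
        gcongr
    _ = _ := by ring

/-- `L¹` bound for the heat kernel with an exponential weight. -/
theorem SingleParticle.exists_tsum_heatKernel_le :
    ∃ C γ : ℝ, 0 ≤ C ∧ 0 ≤ γ ∧ ∀ (k : ℕ) (e : ℝ), 1 ≤ k → 0 ≤ e → e ≤ 1 →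
      Summable (fun z : Fin 3 → ℤ => Real.exp (e * ∑ ν, |(z ν : ℝ)|) * ‖h.heatKernel k z‖) ∧
      ∑' z : Fin 3 → ℤ, Real.exp (e * ∑ ν, |(z ν : ℝ)|) * ‖h.heatKernel k z‖ ≤
        C * Real.exp (γ * (e ^ 2 * k)) ∧
      ∀ (M : ℕ) [NeZero M], 1 ≤ e * M → ∀ c : Fin 3 → ZMod M,
        ∑' z : Fin 3 → ℤ, (if (fun ν => ((z ν : ℤ) : ZMod M)) = c then
          Real.exp (e * ∑ ν, |(z ν : ℝ)|) * ‖h.heatKernel k z‖ else 0) ≤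
        C * (√(k : ℝ))⁻¹ ^ 3 * Real.exp (γ * (e ^ 2 * k)) := by
  obtain ⟨C, γ, hC, hγ, H⟩ := h.exists_norm_heatKernel_le_scaled
  refine ⟨216 * C, γ, by positivity, hγ, fun k e hk he he1 => ?_⟩
  have hk1 : (1 : ℝ) ≤ k := by exact_mod_cast hk
  have hsk : 1 ≤ √(k : ℝ) := Real.one_le_sqrt.2 hk1
  have hsk0 : 0 < (√(k : ℝ))⁻¹ := by positivity
  set E : ℝ := C * (√(k : ℝ))⁻¹ ^ 3 * Real.exp (γ * (e ^ 2 * k)) with hE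
  have hE0 : 0 ≤ E := by positivity
  have key : ∀ z : Fin 3 → ℤ, Real.exp (e * ∑ ν, |(z ν : ℝ)|) * ‖h.heatKernel k z‖ ≤
      E * ∏ ν, Real.exp (-((e + (√(k : ℝ))⁻¹) * |(z ν : ℝ)|)) := by
    intro z
    calc _ ≤ Real.exp (e * ∑ ν, |(z ν : ℝ)|) *
          (E * ∏ ν, Real.exp (-((2 * e + (√(k : ℝ))⁻¹) * |(z ν : ℝ)|))) := by
          gcongr; exact H k z e hk he he1
      _ = E * ∏ ν, Real.exp (-((e + (√(k : ℝ))⁻¹) * |(z ν : ℝ)|)) := by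
          rw [← Real.exp_sum, ← Real.exp_sum, mul_left_comm, ← Real.exp_add]
          congr 2
          rw [Finset.mul_sum, ← Finset.sum_add_distrib]
          refine Finset.sum_congr rfl fun ν _ => ?_
          ring
  have key1 : ∀ z : Fin 3 → ℤ, Real.exp (e * ∑ ν, |(z ν : ℝ)|) * ‖h.heatKernel k z‖ ≤
      E * ∏ ν, Real.exp (-((√(k : ℝ))⁻¹ * |(z ν : ℝ)|)) := by
    intro z
    refine (key z).trans ?_
    gcongr
    linarith
  have hs1 := (summable_prod_exp_neg_mul_abs hsk0).mul_left E
  have hs : Summable (fun z : Fin 3 → ℤ =>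
      Real.exp (e * ∑ ν, |(z ν : ℝ)|) * ‖h.heatKernel k z‖) :=
    Summable.of_nonneg_of_le (fun z => by positivity) key1 hs1
  refine ⟨hs, ?_, ?_⟩
  · calc _ ≤ ∑' z : Fin 3 → ℤ, E * ∏ ν, Real.exp (-((√(k : ℝ))⁻¹ * |(z ν : ℝ)|)) :=
          Summable.tsum_le_tsum key1 hs hs1
      _ = E * ∑' z : Fin 3 → ℤ, ∏ ν, Real.exp (-((√(k : ℝ))⁻¹ * |(z ν : ℝ)|)) := tsum_mul_left
      _ ≤ E * (2 + 2 / (√(k : ℝ))⁻¹) ^ 3 := by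
          gcongr; exact tsum_prod_exp_neg_mul_abs_le hsk0
      _ ≤ E * (4 * √(k : ℝ)) ^ 3 := by
          gcongr
          rw [div_inv_eq_mul]; linarith
      _ = 64 * C * Real.exp (γ * (e ^ 2 * k)) * ((√(k : ℝ))⁻¹ * √(k : ℝ)) ^ 3 := by
          rw [hE]; ring
      _ ≤ 216 * C * Real.exp (γ * (e ^ 2 * k)) := by
          rw [inv_mul_cancel₀ (by positivity), one_pow, mul_one]
          gcongr; norm_num
  · intro M _ heM c
    have he0 : 0 < e := by
      rcases he.lt_or_eq with h0 | h0
      · exact h0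
      · rw [← h0] at heM; norm_num at heM
    have hsM := ((hasSum_prod_cosetExp (M := M) he0 c).summable).mul_left E
    have key2 : ∀ z : Fin 3 → ℤ, (if (fun ν => ((z ν : ℤ) : ZMod M)) = c then
        Real.exp (e * ∑ ν, |(z ν : ℝ)|) * ‖h.heatKernel k z‖ else 0) ≤
        E * ∏ ν, cosetExp M e (c ν) (z ν) := by
      intro z
      split_ifs with hz
      · have h3 : ∀ ν, cosetExp M e (c ν) (z ν) = Real.exp (-(e * |(z ν : ℝ)|)) := by
          intro ν; rw [cosetExp, if_pos (congrFun hz ν)]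
        simp only [h3]
        refine (key z).trans ?_
        gcongr
        linarith
      · exact mul_nonneg hE0 (Finset.prod_nonneg fun ν _ => cosetExp_nonneg _ _ _)
    calc _ ≤ ∑' z : Fin 3 → ℤ, E * ∏ ν, cosetExp M e (c ν) (z ν) := by
          refine Summable.tsum_le_tsum key2 ?_ hsM
          refine Summable.of_nonneg_of_le (fun z => ?_) key2 hsM
          split_ifs <;> positivity
      _ = E * ∑' z : Fin 3 → ℤ, ∏ ν, cosetExp M e (c ν) (z ν) := tsum_mul_left
      _ ≤ E * 216 := by gcongr; exact tsum_prod_cosetExp_le he0 heM c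
      _ = _ := by rw [hE]; ring

end HeatBounds

end ParabolicBlockSpin

namespace ParabolicBlockSpin

open Matrix

/-- A placement of the finite torus `ℤ/M₀ × (ℤ/M₁)³` in a metric space such that the time and space
coordinates have lattice spacings at most `e²` and `e`. -/
structure TorusGeom {M₀ M₁ : ℕ} [NeZero M₀] [NeZero M₁] {P : Type*} [PseudoMetricSpace P]
    (f : Tor M₀ M₁ → P) (e : ℝ) : Prop where
  pos : 0 < e
  le_one : e ≤ 1
  time : 1 ≤ e ^ 2 * M₀
  space : 1 ≤ e * M₁
  dist_le : ∀ (x : Tor M₀ M₁) (t : ℤ) (z : Fin 3 → ℤ),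
    dist (f x) (f (x + ((t : ZMod M₀), fun ν => ((z ν : ℤ) : ZMod M₁)))) ≤
      e ^ 2 * |(t : ℝ)| + e * ∑ ν, |(z ν : ℝ)|

section Transfer

variable {M₀ M₁ : ℕ} [NeZero M₀] [NeZero M₁] {P : Type*} [PseudoMetricSpace P]
  {f : Tor M₀ M₁ → P} {e : ℝ} (h : SingleParticle)

/-- The exponentially weighted `ℓ¹` norm of the heat kernel on a residue class. -/
def heatClass (M₁ : ℕ) (e : ℝ) (k : ℕ) (c : Fin 3 → ZMod M₁) : ℝ :=
  ∑' z : Fin 3 → ℤ, if (fun ν => ((z ν : ℤ) : ZMod M₁)) = c then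
    Real.exp (e * ∑ ν, |(z ν : ℝ)|) * ‖h.heatKernel k z‖ else 0

theorem sum_heatClass {k : ℕ}
    (hs : Summable (fun z : Fin 3 → ℤ => Real.exp (e * ∑ ν, |(z ν : ℝ)|) * ‖h.heatKernel k z‖)) :
    ∑ c, heatClass h M₁ e k c =
      ∑' z : Fin 3 → ℤ, Real.exp (e * ∑ ν, |(z ν : ℝ)|) * ‖h.heatKernel k z‖ := by
  unfold heatClass
  rw [← Summable.tsum_finsetSum]
  · simp
  · intro c _
    refine Summable.of_nonneg_of_le (fun z => by split_ifs <;> positivity) (fun z => ?_) hs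
    split_ifs
    · exact le_rfl
    · positivity

theorem exp_dist_mul_norm_transfer_pow_le (hf : TorusGeom f e) {k : ℕ} (hk : 1 ≤ k)
    (hs : Summable (fun z : Fin 3 → ℤ => Real.exp (e * ∑ ν, |(z ν : ℝ)|) * ‖h.heatKernel k z‖))
    (x y : Tor M₀ M₁) :
    Real.exp (1 * dist (f x) (f y)) * ‖(transfer h M₀ M₁ ^ k) x y‖ ≤
      if y.1 = x.1 + k then Real.exp (e ^ 2 * k) * heatClass h M₁ e k (x.2 - y.2) else 0 := by
  rw [transfer_pow h hk, mul_shiftM_apply, periodM, Matrix.of_apply]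
  simp only [Prod.fst_sub, Prod.snd_sub, sub_zero]
  by_cases hxy : y.1 = x.1 + k
  · rw [if_pos hxy, if_pos (by rw [hxy]; ring), heatClass]
    have hsc : Summable fun z : Fin 3 → ℤ => if (fun ν => ((z ν : ℤ) : ZMod M₁)) = x.2 - y.2 then
        Real.exp (e * ∑ ν, |(z ν : ℝ)|) * ‖h.heatKernel k z‖ else 0 := by
      refine Summable.of_nonneg_of_le (fun z => by split_ifs <;> positivity) (fun z => ?_) hs
      split_ifs
      · exact le_rfl
      · positivity
    have hnorm : Summable fun z : Fin 3 → ℤ =>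
        ‖if (fun ν => ((z ν : ℤ) : ZMod M₁)) = x.2 - y.2 then h.heatKernel k z else 0‖ := by
      refine Summable.of_nonneg_of_le (fun z => norm_nonneg _) (fun z => ?_)
        (h.summable_heatKernel hk).norm
      split_ifs
      · exact le_rfl
      · simp
    calc _ ≤ Real.exp (1 * dist (f x) (f y)) * ∑' z : Fin 3 → ℤ,
          ‖if (fun ν => ((z ν : ℤ) : ZMod M₁)) = x.2 - y.2 then h.heatKernel k z else 0‖ := by
          gcongr; exact norm_tsum_le_tsum_norm hnorm
      _ = ∑' z : Fin 3 → ℤ, Real.exp (1 * dist (f x) (f y)) *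
          ‖if (fun ν => ((z ν : ℤ) : ZMod M₁)) = x.2 - y.2 then h.heatKernel k z else 0‖ :=
          tsum_mul_left.symm
      _ ≤ ∑' z : Fin 3 → ℤ, Real.exp (e ^ 2 * k) *
          (if (fun ν => ((z ν : ℤ) : ZMod M₁)) = x.2 - y.2 then
            Real.exp (e * ∑ ν, |(z ν : ℝ)|) * ‖h.heatKernel k z‖ else 0) := by
          refine Summable.tsum_le_tsum (fun z => ?_) (hnorm.mul_left _) (hsc.mul_left _)
          split_ifs with hz
          · rw [← mul_assoc, ← Real.exp_add]
            gcongr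
            have hd := hf.dist_le x k (-z)
            have hy : x + (((k : ℤ) : ZMod M₀), fun ν => (((-z) ν : ℤ) : ZMod M₁)) = y := by
              ext ν
              · simp [hxy]
              · have := congrFun hz ν
                simp only [Pi.sub_apply] at this
                simp [this]
            rw [hy] at hd
            simpa using hd
          · simp
      _ = _ := tsum_mul_left
  · rw [if_neg hxy, if_neg]
    · simp
    · intro h1; apply hxy; rw [h1]; ring

theorem exists_transfer_pow_bounds : ∃ C γ : ℝ, 1 ≤ C ∧ 0 ≤ γ ∧
    ∀ (M₀ M₁ : ℕ) [NeZero M₀] [NeZero M₁] (P : Type) [PseudoMetricSpace P] (f : Tor M₀ M₁ → P)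
      (e : ℝ), TorusGeom f e → ∀ k : ℕ,
      SchurBd 1 f (transfer h M₀ M₁ ^ k) (C * Real.exp (γ * (e ^ 2 * k))) ∧
      (1 ≤ k → ∀ x y, Real.exp (1 * dist (f x) (f y)) * ‖(transfer h M₀ M₁ ^ k) x y‖ ≤
        if y.1 = x.1 + k then C * (√(k : ℝ))⁻¹ ^ 3 * Real.exp (γ * (e ^ 2 * k)) else 0) := by
  obtain ⟨C, γ, hC, hγ, H⟩ := h.exists_tsum_heatKernel_le
  refine ⟨max C 1, γ + 1, le_max_right _ _, by positivity, ?_⟩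
  intro M₀ M₁ _ _ P _ f e hf k
  have hCm : C ≤ max C 1 := le_max_left _ _
  have hexp : ∀ k : ℕ, Real.exp (e ^ 2 * k) * Real.exp (γ * (e ^ 2 * k)) =
      Real.exp ((γ + 1) * (e ^ 2 * k)) := by
    intro k; rw [← Real.exp_add]; congr 1; ring
  constructor
  · rcases Nat.eq_zero_or_pos k with rfl | hk
    · simpa using SchurBd.one.mono le_rfl (le_max_right C 1)
    · obtain ⟨hs, h1, -⟩ := H k e hk hf.pos.le hf.le_one
      have hpt := exp_dist_mul_norm_transfer_pow_le h hf hk hs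
      have hsum : Real.exp (e ^ 2 * k) * ∑ c, heatClass h M₁ e k c ≤
          max C 1 * Real.exp ((γ + 1) * (e ^ 2 * k)) := by
        rw [sum_heatClass h hs, ← hexp]
        calc _ ≤ Real.exp (e ^ 2 * k) * (C * Real.exp (γ * (e ^ 2 * k))) := by gcongr
          _ = C * (Real.exp (e ^ 2 * k) * Real.exp (γ * (e ^ 2 * k))) := by ring
          _ ≤ _ := by gcongr
      constructor
      · intro x
        refine le_trans ?_ hsum
        refine (Finset.sum_le_sum fun y _ => hpt x y).trans (le_of_eq ?_)
        rw [Fintype.sum_prod_type_right]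
        simp only [Finset.sum_ite_eq', Finset.mem_univ, if_true]
        rw [← Finset.mul_sum]
        congr 1
        exact (Equiv.subLeft x.2).sum_comp (heatClass h M₁ e k)
      · intro y
        refine le_trans ?_ hsum
        refine (Finset.sum_le_sum fun x _ => hpt x y).trans (le_of_eq ?_)
        rw [Fintype.sum_prod_type_right]
        have e1 : ∀ a : ZMod M₀, (y.1 = a + k) = (a = y.1 - k) := by
          intro a; rw [eq_iff_iff, eq_sub_iff_add_eq, eq_comm]
        simp only [e1, Finset.sum_ite_eq', Finset.mem_univ, if_true]
        rw [← Finset.mul_sum]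
        congr 1
        exact (Equiv.subRight y.2).sum_comp (heatClass h M₁ e k)
  · intro hk x y
    obtain ⟨hs, -, h2⟩ := H k e hk hf.pos.le hf.le_one
    refine (exp_dist_mul_norm_transfer_pow_le h hf hk hs x y).trans ?_
    split_ifs
    · rw [← hexp]
      calc _ ≤ Real.exp (e ^ 2 * k) * (C * (√(k : ℝ))⁻¹ ^ 3 * Real.exp (γ * (e ^ 2 * k))) := by
            gcongr; exact h2 M₁ hf.space _
        _ = C * ((√(k : ℝ))⁻¹ ^ 3 * (Real.exp (e ^ 2 * k) * Real.exp (γ * (e ^ 2 * k)))) := by ring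
        _ ≤ max C 1 * ((√(k : ℝ))⁻¹ ^ 3 * (Real.exp (e ^ 2 * k) * Real.exp (γ * (e ^ 2 * k)))) := by
            gcongr
        _ = _ := by ring
    · exact le_rfl

theorem exp_le_one_add_mul {κ s : ℝ} (hs : 0 ≤ s) (hs1 : s ≤ 1) :
    Real.exp (κ * s) ≤ 1 + (Real.exp κ - 1) * s := by
  have h3 := convexOn_exp.2 (Set.mem_univ 0) (Set.mem_univ κ) (sub_nonneg.2 hs1) hs (by ring)
  simp only [smul_eq_mul, mul_zero, zero_add, Real.exp_zero, mul_one] at h3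
  rw [mul_comm κ s]
  linarith

/-- The generator `e⁻² (1 - T)` of the discrete semigroup. -/
def generator (M₀ M₁ : ℕ) [NeZero M₀] [NeZero M₁] (e : ℝ) :
    Matrix (Tor M₀ M₁) (Tor M₀ M₁) ℂ := (((e ^ 2)⁻¹ : ℝ) : ℂ) • (1 - transfer h M₀ M₁)

theorem exists_massive_bounds : ∃ μ CG CP : ℝ, 0 ≤ μ ∧ 0 ≤ CG ∧ 0 ≤ CP ∧
    ∀ (M₀ M₁ : ℕ) [NeZero M₀] [NeZero M₁] (P : Type) [PseudoMetricSpace P] (f : Tor M₀ M₁ → P)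
      (e : ℝ), TorusGeom f e → ∃ G : Matrix (Tor M₀ M₁) (Tor M₀ M₁) ℂ,
      G * (generator h M₀ M₁ e + (μ : ℂ) • 1) = 1 ∧ (generator h M₀ M₁ e + (μ : ℂ) • 1) * G = 1 ∧
      SchurBd 1 f G CG ∧ PtBd 1 f f (G ^ 3) (CP * e ^ 5) := by
  obtain ⟨C, γ, hC, hγ, H⟩ := exists_transfer_pow_bounds h
  have hμ : 0 < Real.exp (γ + 2) - 1 := by
    have := Real.add_one_lt_exp (x := γ + 2) (by positivity); linarith
  refine ⟨Real.exp (γ + 2) - 1, 2 * C, 1 + 18 * C, hμ.le, by positivity,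
    by positivity, ?_⟩
  intro M₀ M₁ _ _ P _ f e hf
  set μ := Real.exp (γ + 2) - 1 with hμdef
  set T := transfer h M₀ M₁ with hT
  have he := hf.pos
  set β : ℝ := (1 + μ * e ^ 2)⁻¹ with hβ
  have hβ0 : 0 < β := by positivity
  have hβ1 : β < 1 := inv_lt_one_of_one_lt₀ (by nlinarith [pow_pos he 2])
  have hβe : β ≤ Real.exp (-((γ + 2) * e ^ 2)) := by
    rw [hβ, Real.exp_neg]
    exact inv_anti₀ (Real.exp_pos _)
      (exp_le_one_add_mul (by positivity) (pow_le_one₀ he.le hf.le_one))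
  have hβk : ∀ k : ℕ, β ^ k * Real.exp (γ * (e ^ 2 * k)) ≤ Real.exp (-(2 * (e ^ 2 * k))) := by
    intro k
    calc _ ≤ Real.exp (-((γ + 2) * e ^ 2)) ^ k * Real.exp (γ * (e ^ 2 * k)) := by gcongr
      _ = _ := by rw [← Real.exp_nat_mul, ← Real.exp_add]; congr 1; ring
  set A : Matrix (Tor M₀ M₁) (Tor M₀ M₁) ℂ := (β : ℂ) • T with hA
  have hA2 : ∀ φ, l2 (A *ᵥ φ) ≤ β * l2 φ := by
    intro φ
    rw [hA, Matrix.smul_mulVec, l2_smul, Complex.norm_real, Real.norm_eq_abs, abs_of_pos hβ0]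
    gcongr
    exact l2_transfer_le h φ
  have hU := isUnit_one_sub_of_l2 hβ0.le hβ1 hA2
  have hUd := (Matrix.isUnit_iff_isUnit_det _).1 hU
  set G : Matrix (Tor M₀ M₁) (Tor M₀ M₁) ℂ := ((e ^ 2 * β : ℝ) : ℂ) • (1 - A)⁻¹ with hG
  have hgen : generator h M₀ M₁ e + (μ : ℂ) • 1 = (((e ^ 2 * β)⁻¹ : ℝ) : ℂ) • (1 - A) := by
    have e1 : (e ^ 2 * β)⁻¹ = (e ^ 2)⁻¹ + μ := by rw [hβ]; field_simp
    have e2 : (e ^ 2 * β)⁻¹ * β = (e ^ 2)⁻¹ := by field_simp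
    rw [generator, hA, smul_sub, smul_sub, smul_smul, ← Complex.ofReal_mul, e2, e1]
    push_cast
    rw [add_smul]
    abel
  have hc1 : ((e ^ 2 * β : ℝ) : ℂ) * (((e ^ 2 * β)⁻¹ : ℝ) : ℂ) = 1 := by
    rw [← Complex.ofReal_mul, mul_inv_cancel₀ (by positivity), Complex.ofReal_one]
  have hterm : ∀ (k : ℕ) x y, ‖(A ^ k) x y‖ = β ^ k * ‖(T ^ k) x y‖ := by
    intro k x y
    rw [hA, smul_pow, Matrix.smul_apply, smul_eq_mul, norm_mul, norm_pow, Complex.norm_real,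
      Real.norm_eq_abs, abs_of_pos hβ0]
  refine ⟨G, ?_, ?_, ?_, ?_⟩
  · rw [hgen, hG, smul_mul_smul_comm, hc1, Matrix.nonsing_inv_mul _ hUd, one_smul]
  · rw [hgen, hG, smul_mul_smul_comm, mul_comm, hc1, Matrix.mul_nonsing_inv _ hUd, one_smul]
  · have hsum : HasSum (fun k : ℕ => C * Real.exp (-(2 * (e ^ 2 * k))))
        (C * (1 - Real.exp (-(2 * e ^ 2)))⁻¹) := by
      have := (hasSum_geometric_of_lt_one (Real.exp_pos (-(2 * e ^ 2))).le
        (Real.exp_lt_one_iff.2 (by linarith [pow_pos he 2]))).mul_left C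
      have e1 : (fun k : ℕ => C * Real.exp (-(2 * (e ^ 2 * k)))) =
          fun k => C * Real.exp (-(2 * e ^ 2)) ^ k := by
        funext k; rw [← Real.exp_nat_mul]; congr 2; ring
      rw [e1]
      exact this
    have hpow : ∀ k : ℕ, SchurBd 1 f (A ^ k) (C * Real.exp (-(2 * (e ^ 2 * k)))) := by
      intro k
      have h1 := (H M₀ M₁ P f e hf k).1.smul ((β : ℂ) ^ k)
      rw [← smul_pow, ← hT, ← hA] at h1
      refine h1.mono le_rfl ?_
      rw [norm_pow, Complex.norm_real, Real.norm_eq_abs, abs_of_pos hβ0]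
      calc _ = C * (β ^ k * Real.exp (γ * (e ^ 2 * k))) := by ring
        _ ≤ _ := by gcongr; exact hβk k
    have hent : ∀ x y, HasSum (fun k => (A ^ k) x y) ((1 - A)⁻¹ x y) := by
      intro x y
      simpa using hasSum_choose_mul_pow_apply hβ0.le hβ1 hA2 0 x y
    have hinv : SchurBd 1 f (1 - A)⁻¹ (C * (1 - Real.exp (-(2 * e ^ 2)))⁻¹) :=
      ⟨RowBd.of_hasSum hent (fun k => (hpow k).1) hsum,
        ColBd.of_hasSum hent (fun k => (hpow k).2) hsum⟩
    refine (hinv.smul ((e ^ 2 * β : ℝ) : ℂ)).mono le_rfl ?_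
    rw [Complex.norm_real, Real.norm_eq_abs, abs_of_pos (by positivity)]
    have h2 := one_sub_exp_neg_inv_le (α := 2 * e ^ 2) (by positivity)
    have he2 : e ^ 2 ≤ 1 := pow_le_one₀ he.le hf.le_one
    have h3 : 0 ≤ (1 - Real.exp (-(2 * e ^ 2)))⁻¹ :=
      inv_nonneg.2 (sub_nonneg.2 (Real.exp_le_one_iff.2 (by linarith [pow_pos he 2])))
    calc _ ≤ e ^ 2 * 1 * (C * (1 + 1 / (2 * e ^ 2))) := by gcongr
      _ = C * (e ^ 2 + 1 / 2) := by field_simp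
      _ ≤ 2 * C := by nlinarith
  · intro x y
    set cc : ZMod M₀ := y.1 - x.1 with hcc
    obtain ⟨hcs, hc6⟩ := tsum_nat_cosetExp_le (M := M₀) (α := e ^ 2) (by positivity) hf.time cc
    have hent := hasSum_choose_mul_pow_apply hβ0.le hβ1 hA2 2 x y
    have hg : HasSum (fun k : ℕ => (if k = 0 then (1 : ℝ) else 0) +
        3 * C / e * cosetExp M₀ (e ^ 2) cc k)
        (1 + 3 * C / e * ∑' k : ℕ, cosetExp M₀ (e ^ 2) cc k) :=
      (hasSum_ite_eq 0 (1 : ℝ)).add (hcs.hasSum.mul_left _)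
    have hbound : ∀ k : ℕ, ‖(Real.exp (1 * dist (f x) (f y)) : ℂ) *
        (((k + 2).choose 2 : ℂ) * (A ^ k) x y)‖ ≤ (if k = 0 then (1 : ℝ) else 0) +
        3 * C / e * cosetExp M₀ (e ^ 2) cc k := by
      intro k
      rw [norm_mul, norm_mul, Complex.norm_real, Real.norm_eq_abs, Real.abs_exp, hterm,
        Complex.norm_natCast]
      rcases Nat.eq_zero_or_pos k with rfl | hk
      · have h1 : 0 ≤ 3 * C / e * cosetExp M₀ (e ^ 2) cc ((0 : ℕ) : ℤ) :=
          mul_nonneg (by positivity) (cosetExp_nonneg _ _ _)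
        have h2 : Real.exp (1 * dist (f x) (f y)) *
            ‖(1 : Matrix (Tor M₀ M₁) (Tor M₀ M₁) ℂ) x y‖ ≤ 1 := by
          by_cases hxy : x = y
          · subst hxy; simp
          · simp [Matrix.one_apply_ne hxy]
        simp only [pow_zero, one_mul, if_true]
        norm_num
        norm_num at h2 h1
        linarith
      · rw [if_neg (by omega), zero_add]
        have hpt := (H M₀ M₁ P f e hf k).2 hk x y
        have hk1 : (1 : ℝ) ≤ k := by exact_mod_cast hk
        have hsk : 1 ≤ √(k : ℝ) := Real.one_le_sqrt.2 hk1
        have hchoose : (((k + 2).choose 2 : ℕ) : ℝ) ≤ 3 * k ^ 2 := by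
          rw [Nat.cast_choose_two]
          push_cast
          nlinarith
        have hcos : (if y.1 = x.1 + k then Real.exp (-(e ^ 2 * k)) else 0) =
            cosetExp M₀ (e ^ 2) cc k := by
          unfold cosetExp
          have : (y.1 = x.1 + k) = ((((k : ℕ) : ℤ) : ZMod M₀) = cc) := by
            rw [eq_iff_iff, hcc, eq_sub_iff_add_eq, Int.cast_natCast, add_comm, eq_comm]
          simp only [this]
          simp
        have hroot : e * √(k : ℝ) ≤ Real.exp (e ^ 2 * k) := by
          have h1 := Real.add_one_le_exp (e ^ 2 * k)
          have h2 : (e * √(k : ℝ)) ^ 2 = e ^ 2 * k := by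
            rw [mul_pow, Real.sq_sqrt (by positivity)]
          nlinarith [sq_nonneg (e * √(k : ℝ) - 1)]
        have hkk : (k : ℝ) ^ 2 * (√(k : ℝ))⁻¹ ^ 3 = √(k : ℝ) := by
          have : (k : ℝ) ^ 2 = √(k : ℝ) ^ 4 := by
            rw [show √(k : ℝ) ^ 4 = (√(k : ℝ) ^ 2) ^ 2 by ring, Real.sq_sqrt (by positivity)]
          rw [this]; field_simp
        calc Real.exp (1 * dist (f x) (f y)) * ((((k + 2).choose 2 : ℕ) : ℝ) *
              (β ^ k * ‖(T ^ k) x y‖))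
            = (((k + 2).choose 2 : ℕ) : ℝ) * β ^ k *
              (Real.exp (1 * dist (f x) (f y)) * ‖(T ^ k) x y‖) := by ring
          _ ≤ 3 * k ^ 2 * β ^ k * (if y.1 = x.1 + k then
              C * (√(k : ℝ))⁻¹ ^ 3 * Real.exp (γ * (e ^ 2 * k)) else 0) := by
              gcongr
          _ = 3 * C / e * (if y.1 = x.1 + k then
              (e * (k ^ 2 * (√(k : ℝ))⁻¹ ^ 3)) * (β ^ k * Real.exp (γ * (e ^ 2 * k))) else 0) := by
              split_ifs
              · field_simp
              · simp
          _ ≤ 3 * C / e * (if y.1 = x.1 + k then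
              Real.exp (e ^ 2 * k) * Real.exp (-(2 * (e ^ 2 * k))) else 0) := by
              rw [hkk]
              refine mul_le_mul_of_nonneg_left ?_ (by positivity)
              split_ifs
              · exact mul_le_mul hroot (hβk k) (by positivity) (by positivity)
              · exact le_rfl
          _ = _ := by
              rw [← hcos]
              congr 2
              rw [← Real.exp_add]; congr 1; ring
    have hnorm : ‖(Real.exp (1 * dist (f x) (f y)) : ℂ) * ((1 - A)⁻¹ ^ (2 + 1)) x y‖ ≤
        1 + 3 * C / e * ∑' k : ℕ, cosetExp M₀ (e ^ 2) cc k := by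
      rw [← (hent.mul_left (Real.exp (1 * dist (f x) (f y)) : ℂ)).tsum_eq]
      exact tsum_of_norm_bounded hg hbound
    rw [norm_mul, Complex.norm_real, Real.norm_eq_abs, Real.abs_exp] at hnorm
    have hG3 : G ^ 3 = ((e ^ 2 * β : ℝ) : ℂ) ^ 3 • ((1 - A)⁻¹ ^ 3) := by rw [hG, smul_pow]
    rw [hG3, Matrix.smul_apply, smul_eq_mul, norm_mul, norm_pow, Complex.norm_real,
      Real.norm_eq_abs, abs_of_pos (by positivity : 0 < e ^ 2 * β)]
    have he1 := hf.le_one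
    calc _ = (e ^ 2 * β) ^ 3 * (Real.exp (1 * dist (f x) (f y)) * ‖((1 - A)⁻¹ ^ (2 + 1)) x y‖) := by
          ring
      _ ≤ (e ^ 2 * 1) ^ 3 * (1 + 3 * C / e * 6) := by
          gcongr
          exact hnorm.trans (by gcongr)
      _ = e ^ 5 * (e + 18 * C) := by field_simp; ring
      _ ≤ e ^ 5 * (1 + 18 * C) := by gcongr
      _ = _ := by ring

end Transfer

end ParabolicBlockSpin

namespace ParabolicBlockSpin

open Matrix

/-- `Q` is a block averaging matrix from functions on a fine torus to functions on a coarse torus: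
it has nonnegative entries, row sums `1`, column sums `(s₀ s₁³)⁻¹`, where `s₀` and `s₁` are the
ratios of the lattice spacings, and the range of `r / 2` coarse lattice spacings. -/
structure BlockAvg {N₀ N₁ M₀ M₁ : ℕ} [NeZero N₀] [NeZero N₁] [NeZero M₀] [NeZero M₁]
    (Q : Matrix (Tor N₀ N₁) (Tor M₀ M₁) ℂ) (s₀ s₁ r : ℕ) : Prop where
  re_nonneg : ∀ y u, 0 ≤ (Q y u).re
  im_eq_zero : ∀ y u, (Q y u).im = 0
  row_sum : ∀ y, ∑ u, Q y u = 1
  col_sum : ∀ u, ∑ y, Q y u = ((((s₀ : ℝ) * (s₁ : ℝ) ^ 3)⁻¹ : ℝ) : ℂ)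
  supp : ∀ y u, Q y u ≠ 0 → ∃ (t : ℤ) (z : Fin 3 → ℤ), 2 * |t| ≤ r * ((s₀ : ℤ) - 1) ∧
    (∀ ν, 2 * |z ν| ≤ r * ((s₁ : ℤ) - 1)) ∧
    u = ((((s₀ : ℤ) * (y.1.val : ℤ) + t : ℤ) : ZMod M₀),
      fun ν => (((s₁ : ℤ) * ((y.2 ν).val : ℤ) + z ν : ℤ) : ZMod M₁))

namespace BlockAvg

variable {N₀ N₁ M₀ M₁ K₀ K₁ : ℕ} [NeZero N₀] [NeZero N₁] [NeZero M₀] [NeZero M₁] [NeZero K₀]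
  [NeZero K₁] {Q : Matrix (Tor N₀ N₁) (Tor M₀ M₁) ℂ} {Q' : Matrix (Tor M₀ M₁) (Tor K₀ K₁) ℂ}
  {s₀ s₁ s₀' s₁' r : ℕ}

theorem eq_re (hQ : BlockAvg Q s₀ s₁ r) (y : Tor N₀ N₁) (u : Tor M₀ M₁) :
    Q y u = (((Q y u).re : ℝ) : ℂ) := by
  apply Complex.ext
  · simp
  · simpa using hQ.im_eq_zero y u

theorem one : BlockAvg (1 : Matrix (Tor M₀ M₁) (Tor M₀ M₁) ℂ) 1 1 r where
  re_nonneg y u := by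
    by_cases h : y = u
    · subst h; simp
    · simp [Matrix.one_apply_ne h]
  im_eq_zero y u := by
    by_cases h : y = u
    · subst h; simp
    · simp [Matrix.one_apply_ne h]
  row_sum y := by simp [Matrix.one_apply]
  col_sum u := by simp [Matrix.one_apply]
  supp y u h := by
    have : y = u := by
      by_contra hcon
      exact h (Matrix.one_apply_ne hcon)
    subst this
    refine ⟨0, 0, by simp, by simp, ?_⟩
    ext <;> simp

theorem cast_val_step {M K s' : ℕ} [NeZero M] (hK : K = s' * M) (a : ZMod M) (b t : ℤ)
    (h : a = ((b : ℤ) : ZMod M)) :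
    (((s' : ℤ) * (a.val : ℤ) + t : ℤ) : ZMod K) = (((s' : ℤ) * b + t : ℤ) : ZMod K) := by
  have h1 : ((a.val : ℤ) : ZMod M) = ((b : ℤ) : ZMod M) := by
    rw [← h]; simp
  rw [ZMod.intCast_eq_intCast_iff_dvd_sub] at h1 ⊢
  obtain ⟨c, hc⟩ := h1
  refine ⟨c, ?_⟩
  rw [hK]; push_cast
  linear_combination (s' : ℤ) * hc

theorem mul (hQ : BlockAvg Q s₀ s₁ r) (hQ' : BlockAvg Q' s₀' s₁' r) (hK₀ : K₀ = s₀' * M₀)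
    (hK₁ : K₁ = s₁' * M₁) : BlockAvg (Q * Q') (s₀' * s₀) (s₁' * s₁) r where
  re_nonneg y u := by
    rw [Matrix.mul_apply, Complex.re_sum]
    refine Finset.sum_nonneg fun x _ => ?_
    rw [Complex.mul_re, hQ.im_eq_zero, zero_mul, sub_zero]
    exact mul_nonneg (hQ.re_nonneg _ _) (hQ'.re_nonneg _ _)
  im_eq_zero y u := by
    rw [Matrix.mul_apply, Complex.im_sum]
    refine Finset.sum_eq_zero fun x _ => ?_
    rw [Complex.mul_im, hQ.im_eq_zero, hQ'.im_eq_zero]; simp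
  row_sum y := by
    simp only [Matrix.mul_apply]
    rw [Finset.sum_comm]
    simp only [← Finset.mul_sum, hQ'.row_sum, mul_one, hQ.row_sum]
  col_sum u := by
    simp only [Matrix.mul_apply]
    rw [Finset.sum_comm]
    simp only [← Finset.sum_mul, hQ.col_sum]
    rw [← Finset.mul_sum, hQ'.col_sum, ← Complex.ofReal_mul]
    congr 1
    push_cast
    rw [← mul_inv]
    congr 1
    ring
  supp y u h := by
    rw [Matrix.mul_apply] at h
    obtain ⟨x, -, hx⟩ := Finset.exists_ne_zero_of_sum_ne_zero h
    obtain ⟨t, z, ht, hz, hxe⟩ := hQ.supp y x (left_ne_zero_of_mul hx)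
    obtain ⟨t', z', ht', hz', hue⟩ := hQ'.supp x u (right_ne_zero_of_mul hx)
    have key : ∀ (s s' : ℕ) (a b : ℤ), 2 * |a| ≤ r * ((s : ℤ) - 1) →
        2 * |b| ≤ r * ((s' : ℤ) - 1) →
        2 * |(s' : ℤ) * a + b| ≤ r * (((s' * s : ℕ) : ℤ) - 1) := by
      intro s s' a b ha hb
      have h1 : |(s' : ℤ) * a + b| ≤ s' * |a| + |b| := by
        refine (abs_add_le _ _).trans ?_
        rw [abs_mul, Nat.abs_cast]
      have h2 : (s' : ℤ) * (2 * |a|) ≤ s' * (r * ((s : ℤ) - 1)) :=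
        mul_le_mul_of_nonneg_left ha (by positivity)
      push_cast
      linarith
    refine ⟨(s₀' : ℤ) * t + t', fun ν => (s₁' : ℤ) * z ν + z' ν, key _ _ _ _ ht ht',
      fun ν => key _ _ _ _ (hz ν) (hz' ν), ?_⟩
    rw [hue]
    refine Prod.ext ?_ (funext fun ν => ?_)
    · simp only
      rw [cast_val_step hK₀ x.1 _ t' (by rw [hxe])]
      congr 1; push_cast; ring
    · simp only
      rw [cast_val_step hK₁ (x.2 ν) _ (z' ν) (by rw [hxe])]
      congr 1; push_cast; ring

theorem norm_eq (hQ : BlockAvg Q s₀ s₁ r) (y : Tor N₀ N₁) (u : Tor M₀ M₁) :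
    ‖Q y u‖ = (Q y u).re := by
  conv_lhs => rw [hQ.eq_re y u]
  rw [Complex.norm_real, Real.norm_eq_abs, abs_of_nonneg (hQ.re_nonneg y u)]

theorem sum_norm_row (hQ : BlockAvg Q s₀ s₁ r) (y : Tor N₀ N₁) : ∑ u, ‖Q y u‖ = 1 := by
  simp only [hQ.norm_eq]
  rw [← Complex.re_sum, hQ.row_sum, Complex.one_re]

theorem sum_norm_col (hQ : BlockAvg Q s₀ s₁ r) (u : Tor M₀ M₁) :
    ∑ y, ‖Q y u‖ = ((s₀ : ℝ) * (s₁ : ℝ) ^ 3)⁻¹ := by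
  simp only [hQ.norm_eq]
  rw [← Complex.re_sum, hQ.col_sum, Complex.ofReal_re]

theorem norm_le (hQ : BlockAvg Q s₀ s₁ r) (y : Tor N₀ N₁) (u : Tor M₀ M₁) :
    ‖Q y u‖ ≤ ((s₀ : ℝ) * (s₁ : ℝ) ^ 3)⁻¹ := by
  rw [← hQ.sum_norm_col u]
  exact Finset.single_le_sum (f := fun y => ‖Q y u‖) (fun _ _ => norm_nonneg _) (Finset.mem_univ y)

end BlockAvg

section Profile

variable {L : ℕ}

theorem boxConv_nonneg (r : ℕ) (x : ℤ × (Fin 3 → ℤ)) : 0 ≤ boxConv L r x := by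
  induction r generalizing x with
  | zero => rw [boxConv]; split_ifs <;> norm_num
  | succ r ih => rw [boxConv]; exact Finset.sum_nonneg fun y _ => ih _

theorem two_mul_abs_le_of_mem_box {b : ℤ × (Fin 3 → ℤ)} (hb : b ∈ box L) :
    2 * |b.1| ≤ ((L ^ 2 : ℕ) : ℤ) - 1 ∧ ∀ ν, 2 * |b.2 ν| ≤ (L : ℤ) - 1 := by
  rw [box, Finset.mem_product, Finset.mem_Icc, Fintype.mem_piFinset] at hb
  obtain ⟨hb1, hb2⟩ := hb
  refine ⟨?_, fun ν => ?_⟩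
  · have := abs_le.2 hb1
    push_cast
    omega
  · have := abs_le.2 (Finset.mem_Icc.1 (hb2 ν))
    omega

theorem supp_boxConv {r : ℕ} {x : ℤ × (Fin 3 → ℤ)} (h : boxConv L r x ≠ 0) :
    2 * |x.1| ≤ r * (((L ^ 2 : ℕ) : ℤ) - 1) ∧ ∀ ν, 2 * |x.2 ν| ≤ r * ((L : ℤ) - 1) := by
  induction r generalizing x with
  | zero =>
    rw [boxConv] at h
    have : x = 0 := by
      by_contra hcon
      simp [hcon] at h
    subst this; simp
  | succ r ih =>
    rw [boxConv] at h
    obtain ⟨b, hb, hxb⟩ := Finset.exists_ne_zero_of_sum_ne_zero h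
    obtain ⟨h1, h2⟩ := ih hxb
    obtain ⟨h3, h4⟩ := two_mul_abs_le_of_mem_box hb
    refine ⟨?_, fun ν => ?_⟩
    · have : |x.1| ≤ |(x - b).1| + |b.1| := by
        have : x.1 = (x - b).1 + b.1 := by simp
        conv_lhs => rw [this]
        exact abs_add_le _ _
      push_cast at *
      linarith
    · have : |x.2 ν| ≤ |(x - b).2 ν| + |b.2 ν| := by
        have : x.2 ν = (x - b).2 ν + b.2 ν := by simp
        conv_lhs => rw [this]
        exact abs_add_le _ _
      have h5 := h2 ν
      have h6 := h4 ν
      push_cast at *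
      linarith

theorem finite_support_boxConv (r : ℕ) : (Function.support (boxConv L r)).Finite := by
  refine Set.Finite.subset (Finset.finite_toSet
    ((Finset.Icc (-(r * (((L ^ 2 : ℕ) : ℤ) - 1))) (r * (((L ^ 2 : ℕ) : ℤ) - 1))) ×ˢ
      Fintype.piFinset fun _ : Fin 3 =>
        Finset.Icc (-(r * ((L : ℤ) - 1))) (r * ((L : ℤ) - 1)))) fun x hx => ?_
  obtain ⟨h1, h2⟩ := supp_boxConv hx
  rw [Finset.mem_coe, Finset.mem_product, Finset.mem_Icc, Fintype.mem_piFinset]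
  refine ⟨abs_le.1 (by linarith [abs_nonneg x.1]), fun ν => ?_⟩
  rw [Finset.mem_Icc]
  exact abs_le.1 (by linarith [h2 ν, abs_nonneg (x.2 ν)])

theorem summable_boxConv_mul (r : ℕ) (c : ℤ × (Fin 3 → ℤ) → ℝ) :
    Summable fun x => boxConv L r x * c x := by
  refine summable_of_hasFiniteSupport ((finite_support_boxConv (L := L) r).subset ?_)
  intro x hx
  exact left_ne_zero_of_mul hx

theorem tsum_boxConv_succ_mul (r : ℕ) (c : ℤ × (Fin 3 → ℤ) → ℝ) :
    ∑' x, boxConv L (r + 1) x * c x = ∑' x, boxConv L r x * ∑ b ∈ box L, c (x + b) := by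
  have h1 : ∀ b, ∑' x, boxConv L r (x - b) * c x = ∑' x, boxConv L r x * c (x + b) := by
    intro b
    rw [← (Equiv.addRight b).tsum_eq (fun x => boxConv L r (x - b) * c x)]
    simp
  have hs : ∀ b, Summable fun x => boxConv L r (x - b) * c x := by
    intro b
    rw [← (Equiv.addRight b).summable_iff]
    have := summable_boxConv_mul (L := L) r (fun x => c (x + b))
    refine this.congr fun x => ?_
    simp
  simp only [boxConv, Finset.sum_mul, Finset.mul_sum]
  rw [Summable.tsum_finsetSum fun b _ => hs b, Summable.tsum_finsetSum fun b _ =>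
    summable_boxConv_mul r (fun x => c (x + b))]
  exact Finset.sum_congr rfl fun b _ => h1 b

theorem card_box (hL : Odd L) : (box L).card = L ^ 5 := by
  obtain ⟨l, rfl⟩ := hL
  have h1 : (((2 * l + 1 : ℕ) : ℤ) ^ 2 - 1) / 2 = 2 * (l : ℤ) ^ 2 + 2 * l := by
    push_cast
    have : (2 * (l : ℤ) + 1) ^ 2 - 1 = 2 * (2 * (l : ℤ) ^ 2 + 2 * l) := by ring
    rw [this]; exact Int.mul_ediv_cancel_left _ (by norm_num)
  have h2 : (((2 * l + 1 : ℕ) : ℤ) - 1) / 2 = l := by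
    push_cast; omega
  rw [box, Finset.card_product, Fintype.card_piFinset, h1, h2]
  simp only [Int.card_Icc, Finset.prod_const, Finset.card_univ, Fintype.card_fin]
  have e1 : (2 * (l : ℤ) ^ 2 + 2 * l + 1 - -(2 * (l : ℤ) ^ 2 + 2 * l)).toNat = (2 * l + 1) ^ 2 := by
    have : (2 * (l : ℤ) ^ 2 + 2 * l + 1 - -(2 * (l : ℤ) ^ 2 + 2 * l)) =
        (((2 * l + 1) ^ 2 : ℕ) : ℤ) := by push_cast; ring
    rw [this, Int.toNat_natCast]
  have e2 : ((l : ℤ) + 1 - -(l : ℤ)).toNat = 2 * l + 1 := by omega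
  rw [e1, e2]; ring

theorem tsum_boxConv (hL : Odd L) (r : ℕ) : ∑' x, boxConv L r x = (L : ℝ) ^ (5 * r) := by
  induction r with
  | zero => simp [boxConv]
  | succ r ih =>
    have := tsum_boxConv_succ_mul (L := L) r (fun _ => 1)
    simp only [mul_one, Finset.sum_const, card_box hL, nsmul_eq_mul] at this
    rw [this, tsum_mul_right, ih]
    push_cast
    ring

theorem tsum_boxConv_succ_mul_of_tiling (hL : Odd L) (r : ℕ) (c : ℤ × (Fin 3 → ℤ) → ℝ)
    (hc : ∀ x, ∑ b ∈ box L, c (x + b) = 1) :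
    ∑' x, boxConv L (r + 1) x * c x = (L : ℝ) ^ (5 * r) := by
  rw [tsum_boxConv_succ_mul]
  simp only [hc, mul_one, tsum_boxConv hL]

/-- Division with remainder, with a symmetric range of remainders. -/
theorem existsUnique_block {s N M : ℕ} [NeZero N] [NeZero M] (hs : Odd s) (hM : M = s * N)
    (w : ZMod M) : ∃ (j₀ : ZMod N) (b₀ : ℤ), 2 * |b₀| ≤ (s : ℤ) - 1 ∧
      ∀ (j : ZMod N) (b : ℤ), 2 * |b| ≤ (s : ℤ) - 1 →
        ((((s : ℤ) * (j.val : ℤ) + b : ℤ) : ZMod M) = w ↔ j = j₀ ∧ b = b₀) := by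
  obtain ⟨l, rfl⟩ := hs
  set W : ℤ := (w.val : ℤ) + l with hW
  have hw : ((w.val : ℤ) : ZMod M) = w := by simp
  have hspos : (0 : ℤ) < ((2 * l + 1 : ℕ) : ℤ) := by positivity
  have hr0 := Int.emod_nonneg W hspos.ne'
  have hr1 := Int.emod_lt_of_pos W hspos
  have hdiv := Int.mul_ediv_add_emod W ((2 * l + 1 : ℕ) : ℤ)
  set q := W / ((2 * l + 1 : ℕ) : ℤ) with hq
  set ρ := W % ((2 * l + 1 : ℕ) : ℤ) with hρ
  refine ⟨(q : ZMod N), ρ - l, ?_, fun j b hb => ?_⟩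
  · have : |ρ - l| ≤ l := abs_le.2 ⟨by linarith, by push_cast at hr1; linarith⟩
    push_cast; linarith
  have hbl : |b| ≤ l := by push_cast at hb; linarith
  have hb' := abs_le.1 hbl
  have hiff : ((((2 * l + 1 : ℕ) : ℤ) * (j.val : ℤ) + b : ℤ) : ZMod M) = w ↔
      ((2 * l + 1 : ℕ) : ℤ) * N ∣ ((2 * l + 1 : ℕ) : ℤ) * (q - j.val) + (ρ - l - b) := by
    conv_lhs => rw [← hw]
    rw [ZMod.intCast_eq_intCast_iff_dvd_sub]
    have hM' : (M : ℤ) = ((2 * l + 1 : ℕ) : ℤ) * N := by rw [hM]; push_cast; ring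
    have e1 : (w.val : ℤ) - (((2 * l + 1 : ℕ) : ℤ) * (j.val : ℤ) + b) =
        ((2 * l + 1 : ℕ) : ℤ) * (q - j.val) + (ρ - l - b) := by
      rw [hW] at hdiv
      linear_combination -hdiv
    rw [e1, hM']
  rw [hiff]
  have hjq : j = (q : ZMod N) ↔ (N : ℤ) ∣ q - j.val := by
    rw [← ZMod.intCast_eq_intCast_iff_dvd_sub]
    simp
  constructor
  · intro hd
    have h1 : ((2 * l + 1 : ℕ) : ℤ) ∣ ρ - l - b := by
      have h2 : ((2 * l + 1 : ℕ) : ℤ) ∣ ((2 * l + 1 : ℕ) : ℤ) * (q - j.val) + (ρ - l - b) :=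
        (Dvd.intro _ rfl).trans hd
      exact (Int.dvd_add_right (Dvd.intro _ rfl)).1 h2
    have h3 : ρ - l - b = 0 := by
      refine Int.eq_zero_of_abs_lt_dvd h1 ?_
      rw [abs_lt]
      push_cast at *
      constructor <;> linarith
    refine ⟨?_, by linarith⟩
    rw [h3, add_zero] at hd
    rw [hjq]
    exact Int.dvd_of_mul_dvd_mul_left hspos.ne' hd
  · rintro ⟨h1, h2⟩
    rw [h2, sub_self, add_zero]
    exact mul_dvd_mul_left _ (hjq.1 h1)

end Profile

section AvgQ

variable {L A B : ℕ} [NeZero L] {n : ℕ}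

theorem mem_box_iff (b : ℤ × (Fin 3 → ℤ)) :
    b ∈ box L ↔ 2 * |b.1| ≤ ((L ^ 2 : ℕ) : ℤ) - 1 ∧ ∀ ν, 2 * |b.2 ν| ≤ (L : ℤ) - 1 := by
  refine ⟨two_mul_abs_le_of_mem_box, fun ⟨h1, h2⟩ => ?_⟩
  rw [box, Finset.mem_product, Finset.mem_Icc, Fintype.mem_piFinset]
  refine ⟨abs_le.1 ?_, fun ν => ?_⟩
  · push_cast at h1; omega
  · rw [Finset.mem_Icc]
    refine abs_le.1 ?_
    have := h2 ν
    omega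

theorem incl_add_cls (y : Lat L A B (-1) (n + 1)) (x : ℤ × (Fin 3 → ℤ)) :
    incl L A B n y + cls L A B n x =
      (((((L ^ 2 : ℕ) : ℤ) * (y.1.val : ℤ) + x.1 : ℤ) : ZMod (L ^ (A - 2 * n))),
        fun ν => (((L : ℤ) * ((y.2 ν).val : ℤ) + x.2 ν : ℤ) : ZMod (L ^ (B - n)))) := by
  unfold incl cls
  refine Prod.ext ?_ (funext fun ν => ?_)
  · simp only [Prod.fst_add]; push_cast; rfl
  · simp only [Prod.snd_add, Pi.add_apply]; push_cast; rfl

theorem pow_time_eq (hA : 2 * (n + 1) ≤ A) : L ^ (A - 2 * n) = L ^ 2 * L ^ (A - 2 * (n + 1)) := by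
  rw [← pow_add]; congr 1; omega

theorem pow_space_eq (hB : n + 1 ≤ B) : L ^ (B - n) = L * L ^ (B - (n + 1)) := by
  rw [← pow_succ']; congr 1; omega

theorem sum_box_sum_incl (hL : Odd L) (hA : 2 * (n + 1) ≤ A) (hB : n + 1 ≤ B)
    (z : Lat L A B 0 n) (x : ℤ × (Fin 3 → ℤ)) :
    ∑ b ∈ box L, ∑ y : Lat L A B (-1) (n + 1),
      (if incl L A B n y + cls L A B n (x + b) = z then (1 : ℝ) else 0) = 1 := by
  obtain ⟨j₀, b₀, hb₀, H₀⟩ := existsUnique_block (s := L ^ 2) (hL.pow) (pow_time_eq (L := L) hA)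
    (z.1 - (x.1 : ZMod (L ^ (A - 2 * n))))
  have H1 := fun ν => existsUnique_block (s := L) hL (pow_space_eq (L := L) hB)
    (z.2 ν - (x.2 ν : ZMod (L ^ (B - n))))
  choose j₁ b₁ hb₁ H₁ using H1
  have key : ∀ b ∈ box L, ∀ y : Lat L A B (-1) (n + 1),
      (if incl L A B n y + cls L A B n (x + b) = z then (1 : ℝ) else 0) =
        if y = (j₀, j₁) then (if b = (b₀, b₁) then 1 else 0) else 0 := by
    intro b hb y
    obtain ⟨hb1, hb2⟩ := two_mul_abs_le_of_mem_box hb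
    rw [← ite_and]
    refine if_congr ?_ rfl rfl
    rw [incl_add_cls, Prod.ext_iff, Prod.ext_iff, Prod.ext_iff, funext_iff, funext_iff, funext_iff]
    have h0 := H₀ y.1 b.1 hb1
    have h1 := fun ν => H₁ ν (y.2 ν) (b.2 ν) (hb2 ν)
    rw [eq_sub_iff_add_eq] at h0
    have e0 : ((((L ^ 2 : ℕ) : ℤ) * (y.1.val : ℤ) + (x + b).1 : ℤ) : ZMod (L ^ (A - 2 * n))) =
        ((((L ^ 2 : ℕ) : ℤ) * (y.1.val : ℤ) + b.1 : ℤ) : ZMod (L ^ (A - 2 * n))) +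
          (x.1 : ZMod (L ^ (A - 2 * n))) := by
      rw [Prod.fst_add]; push_cast; ring
    have e1 : ∀ ν, ((((L : ℕ) : ℤ) * ((y.2 ν).val : ℤ) + (x + b).2 ν : ℤ) : ZMod (L ^ (B - n))) =
        ((((L : ℕ) : ℤ) * ((y.2 ν).val : ℤ) + b.2 ν : ℤ) : ZMod (L ^ (B - n))) +
          (x.2 ν : ZMod (L ^ (B - n))) := by
      intro ν; rw [Prod.snd_add, Pi.add_apply]; push_cast; ring
    simp only [e0, e1]
    rw [h0]
    have h1' : ∀ ν, (((((L : ℕ) : ℤ) * ((y.2 ν).val : ℤ) + b.2 ν : ℤ) : ZMod (L ^ (B - n))) +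
          (x.2 ν : ZMod (L ^ (B - n))) = z.2 ν ↔ y.2 ν = j₁ ν ∧ b.2 ν = b₁ ν) := by
      intro ν; rw [← h1 ν, eq_sub_iff_add_eq]
    simp only [h1', forall_and]
    tauto
  rw [Finset.sum_congr rfl fun b hb => Finset.sum_congr rfl fun y _ => key b hb y]
  simp only [Finset.sum_ite_eq', Finset.mem_univ, if_true]
  rw [if_pos]
  rw [mem_box_iff]
  exact ⟨hb₀, hb₁⟩

theorem avgQ_eq (qq : ℕ) (y : Lat L A B (-1) (n + 1)) (z : Lat L A B 0 n) :
    avgQ L A B qq n y z = ((((L : ℝ) ^ (5 * qq))⁻¹ * ∑' x, boxConv L qq x *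
      (if incl L A B n y + cls L A B n x = z then 1 else 0) : ℝ) : ℂ) := by
  rw [avgQ, Matrix.of_apply, ← tsum_mul_left, Complex.ofReal_tsum]
  refine tsum_congr fun x => ?_
  split_ifs
  · simp [profile]
  · simp

theorem blockAvg_avgQ (hL : Odd L) (hA : 2 * (n + 1) ≤ A) (hB : n + 1 ≤ B) {qq : ℕ}
    (hqq : 1 ≤ qq) :
    BlockAvg (N₀ := L ^ (A - 2 * (n + 1))) (N₁ := L ^ (B - (n + 1))) (M₀ := L ^ (A - 2 * n))
      (M₁ := L ^ (B - n)) (avgQ L A B qq n) (L ^ 2) L qq where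
  re_nonneg y u := by
    rw [avgQ_eq, Complex.ofReal_re]
    refine mul_nonneg (by positivity) (tsum_nonneg fun x => mul_nonneg (boxConv_nonneg _ _) ?_)
    split_ifs <;> norm_num
  im_eq_zero y u := by rw [avgQ_eq, Complex.ofReal_im]
  row_sum y := by
    have hL0 : (L : ℝ) ≠ 0 := by exact_mod_cast NeZero.ne L
    simp only [avgQ_eq]
    rw [← Complex.ofReal_sum, ← Finset.mul_sum, ← Summable.tsum_finsetSum
      fun z _ => summable_boxConv_mul _ _]
    simp only [← Finset.mul_sum, Finset.sum_ite_eq, Finset.mem_univ, if_true, mul_one]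
    rw [tsum_boxConv hL, inv_mul_cancel₀ (pow_ne_zero _ hL0), Complex.ofReal_one]
  col_sum u := by
    have hL0 : (L : ℝ) ≠ 0 := by exact_mod_cast NeZero.ne L
    obtain ⟨r, rfl⟩ : ∃ r, qq = r + 1 := ⟨qq - 1, by omega⟩
    simp only [avgQ_eq]
    rw [← Complex.ofReal_sum, ← Finset.mul_sum, ← Summable.tsum_finsetSum
      fun z _ => summable_boxConv_mul _ _]
    simp only [← Finset.mul_sum]
    rw [tsum_boxConv_succ_mul_of_tiling hL]
    · congr 1
      push_cast
      field_simp
      ring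
    · intro x
      exact sum_box_sum_incl hL hA hB u x
  supp y u h := by
    rw [avgQ_eq] at h
    have h1 := right_ne_zero_of_mul (Complex.ofReal_ne_zero.1 h)
    obtain ⟨x, hx⟩ : ∃ x, boxConv L qq x *
        (if incl L A B n y + cls L A B n x = u then 1 else 0) ≠ 0 := by
      by_contra hcon
      push Not at hcon
      exact h1 (by simp only [hcon, tsum_zero])
    obtain ⟨h2, h3⟩ := supp_boxConv (left_ne_zero_of_mul hx)
    have h4 : incl L A B n y + cls L A B n x = u := by
      by_contra hcon
      simp [hcon] at hx
    exact ⟨x.1, x.2, h2, h3, by rw [← h4, incl_add_cls]⟩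

theorem blockAvg_iterQ (hL : Odd L) {qq : ℕ} (hqq : 1 ≤ qq) (a j : ℕ) (hA : 2 * (a + j) ≤ A)
    (hB : a + j ≤ B) :
    BlockAvg (N₀ := L ^ (A - 2 * (a + j))) (N₁ := L ^ (B - (a + j))) (M₀ := L ^ (A - 2 * a))
      (M₁ := L ^ (B - a)) (iterQ L A B qq a j) (L ^ (2 * j)) (L ^ j) qq := by
  induction j with
  | zero => exact BlockAvg.one
  | succ j ih =>
    have h1 := blockAvg_avgQ (L := L) (A := A) (B := B) (n := a + j) hL hA hB hqq
    have h2 := h1.mul (ih (by omega) (by omega))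
      (by rw [← pow_add]; congr 1; omega) (by rw [← pow_add]; congr 1; omega)
    have e1 : L ^ (2 * j) * L ^ 2 = L ^ (2 * (j + 1)) := by rw [← pow_add]; congr 1
    have e2 : L ^ j * L = L ^ (j + 1) := (pow_succ _ _).symm
    rw [e1, e2] at h2
    exact h2

theorem relevel_self (j : ℤ) (n : ℕ) : relevel L A B j n n = id := by
  funext u
  unfold relevel
  refine Prod.ext ?_ (funext fun ν => ?_)
  · simp
  · simp

theorem blockAvg_Qn (hL : Odd L) {qq : ℕ} (hqq : 1 ≤ qq) (n : ℕ) (hA : 2 * n ≤ A) (hB : n ≤ B) :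
    BlockAvg (N₀ := L ^ (A - 2 * n)) (N₁ := L ^ (B - n)) (M₀ := L ^ (A - 2 * 0))
      (M₁ := L ^ (B - 0)) (Qn L A B qq n) (L ^ (2 * n)) (L ^ n) qq := by
  have key : ∀ m, m = 0 + n → BlockAvg (N₀ := L ^ (A - 2 * m)) (N₁ := L ^ (B - m))
      (M₀ := L ^ (A - 2 * 0)) (M₁ := L ^ (B - 0))
      ((iterQ L A B qq 0 n).submatrix (relevel L A B 0 m (0 + n)) id) (L ^ (2 * n)) (L ^ n) qq := by
    rintro m rfl
    rw [relevel_self, Matrix.submatrix_id_id]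
    exact blockAvg_iterQ hL hqq 0 n (by omega) (by omega)
  exact key n (by omega)

theorem blockAvg_checkQ (hL : Odd L) {qq : ℕ} (hqq : 1 ≤ qq) (n : ℕ) (hA : 2 * (n + 1) ≤ A)
    (hB : n + 1 ≤ B) :
    BlockAvg (N₀ := L ^ (A - 2 * (n + 1))) (N₁ := L ^ (B - (n + 1))) (M₀ := L ^ (A - 2 * 0))
      (M₁ := L ^ (B - 0)) (checkQ L A B qq n) (L ^ (2 * (n + 1))) (L ^ (n + 1)) qq := by
  have h2 := (blockAvg_avgQ hL hA hB hqq).mul (blockAvg_Qn (L := L) (A := A) (B := B) hL hqq n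
    (by omega) (by omega)) (by rw [← pow_add]; congr 1; omega)
    (by rw [← pow_add]; congr 1; omega)
  have e1 : L ^ (2 * n) * L ^ 2 = L ^ (2 * (n + 1)) := by rw [← pow_add]; congr 1
  have e2 : L ^ n * L = L ^ (n + 1) := (pow_succ _ _).symm
  rw [e1, e2] at h2
  exact h2

theorem gramQ_eq (qq b j n : ℕ) (hn : b + j = n) :
    ∃ Q : Matrix (Lat L A B 0 n) (Lat L A B j b) ℂ,
      gramQ L A B qq n j = (((L : ℝ) ^ (5 * j) : ℝ) : ℂ) • (Q * Qᵀ) ∧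
      ((Odd L → 1 ≤ qq → 2 * n ≤ A → n ≤ B →
        BlockAvg (N₀ := L ^ (A - 2 * n)) (N₁ := L ^ (B - n)) (M₀ := L ^ (A - 2 * b))
          (M₁ := L ^ (B - b)) Q (L ^ (2 * j)) (L ^ j) qq)) := by
  have hb : n - j = b := by omega
  subst hn
  have key : ∀ c, c = b → gramQ L A B qq (b + j) j = (iterQ L A B qq c j *
      adj L A B j c 0 (c + j) (iterQ L A B qq c j)).submatrix
      (relevel L A B 0 (b + j) (c + j)) (relevel L A B 0 (b + j) (c + j)) := by
    intro c hc
    have h1 : ∀ d, d = c → (iterQ L A B qq d j *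
        adj L A B j d 0 (d + j) (iterQ L A B qq d j)).submatrix
        (relevel L A B 0 (b + j) (d + j)) (relevel L A B 0 (b + j) (d + j)) =
        (iterQ L A B qq c j * adj L A B j c 0 (c + j) (iterQ L A B qq c j)).submatrix
        (relevel L A B 0 (b + j) (c + j)) (relevel L A B 0 (b + j) (c + j)) := by
      rintro d rfl; rfl
    exact h1 _ (by omega)
  refine ⟨iterQ L A B qq b j, ?_, fun hL hqq hA hB => blockAvg_iterQ hL hqq b j hA hB⟩
  rw [key b rfl, relevel_self, Matrix.submatrix_id_id, adj, Matrix.mul_smul]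
  congr 2
  simp only [eps]
  have hL0 : (L : ℝ) ≠ 0 := by exact_mod_cast NeZero.ne L
  rw [neg_zero, zpow_zero, _root_.zpow_neg, one_div, inv_inv, zpow_natCast, ← pow_mul, mul_comm]

end AvgQ

end ParabolicBlockSpin

namespace ParabolicBlockSpin

open Matrix

section NeumannInverse

variable {P : Type*} [PseudoMetricSpace P] {ι : Type*} [Fintype ι] [DecidableEq ι]
  {m : ℝ} {f : ι → P} {A X : Matrix ι ι ℂ}

theorem RowBd.of_eq_one_sub_mul (hm : 0 ≤ m) (hA : RowBd m f f A (1 / 2))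
    (hX : X = 1 - A * X) : RowBd m f f X 2 := by
  intro i₁
  have : Nonempty ι := ⟨i₁⟩
  obtain ⟨i₀, -, hi₀⟩ := Finset.exists_max_image Finset.univ
    (fun i => ∑ j, Real.exp (m * dist (f i) (f j)) * ‖X i j‖) Finset.univ_nonempty
  set C := ∑ j, Real.exp (m * dist (f i₀) (f j)) * ‖X i₀ j‖ with hC
  have hC0 : 0 ≤ C := Finset.sum_nonneg fun j _ => by positivity
  have h1 : RowBd m f f X C := fun i => hi₀ i (Finset.mem_univ i)
  have h2 : RowBd m f f (1 - A * X) (1 + 1 / 2 * C) := RowBd.one.sub (hA.mul hm hC0 h1)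
  rw [← hX] at h2
  have h3 : C ≤ 1 + 1 / 2 * C := h2 i₀
  exact (h1 i₁).trans (by linarith)

theorem SchurBd.of_one_add_mul_eq_one (hm : 0 ≤ m) (hA : SchurBd m f A (1 / 2))
    (hX : (1 + A) * X = 1) (hX' : X * (1 + A) = 1) : SchurBd m f X 2 := by
  refine ⟨RowBd.of_eq_one_sub_mul hm hA.1 ?_, ?_⟩
  · rw [eq_sub_iff_add_eq, ← hX]; noncomm_ring
  · rw [← rowBd_transpose]
    refine RowBd.of_eq_one_sub_mul hm (A := Aᵀ) (rowBd_transpose.2 hA.2) ?_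
    have : X = 1 - X * A := by rw [eq_sub_iff_add_eq, ← hX']; noncomm_ring
    conv_lhs => rw [this]
    rw [Matrix.transpose_sub, Matrix.transpose_one, Matrix.transpose_mul]

theorem SchurBd.isUnit_one_add (hm : 0 ≤ m) (hA : SchurBd m f A (1 / 2)) : IsUnit (1 + A) := by
  have := isUnit_one_sub_of_l2 (A := -A) (c := 1 / 2) (by norm_num) (by norm_num) fun φ => by
    rw [Matrix.neg_mulVec]
    have h := hA.l2_mulVec_le hm (by norm_num) φ
    have h2 : l2 (-(A *ᵥ φ)) = l2 (A *ᵥ φ) := by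
      rw [← neg_one_smul ℂ, l2_smul, norm_neg, norm_one, one_mul]
    rw [h2]; exact h
  rwa [sub_neg_eq_add] at this

theorem SchurBd.le_re_dotProduct_inverse (hm : 0 ≤ m) (hA : SchurBd m f A (1 / 2))
    (hX : (1 + A) * X = 1) (ψ : ι → ℂ) : 2 / 9 * l2 ψ ^ 2 ≤ (star ψ ⬝ᵥ (X *ᵥ ψ)).re := by
  set χ := X *ᵥ ψ with hχ
  have hψ : ψ = χ + A *ᵥ χ := by
    have : (1 + A) *ᵥ χ = ψ := by rw [hχ, Matrix.mulVec_mulVec, hX, Matrix.one_mulVec]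
    rw [Matrix.add_mulVec, Matrix.one_mulVec] at this
    exact this.symm
  have h1 := hA.l2_mulVec_le hm (by norm_num) χ
  have h2 : l2 ψ ≤ 3 / 2 * l2 χ := by
    have := l2_add_le χ (A *ᵥ χ)
    rw [← hψ] at this; linarith
  have h3 : (star ψ ⬝ᵥ χ).re = l2 χ ^ 2 + (star (A *ᵥ χ) ⬝ᵥ χ).re := by
    rw [hψ, star_add, add_dotProduct, star_dotProduct_self, Complex.add_re,
      Complex.ofReal_re]
  have h4 : |(star (A *ᵥ χ) ⬝ᵥ χ).re| ≤ l2 (A *ᵥ χ) * l2 χ :=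
    (Complex.abs_re_le_norm _).trans (norm_dotProduct_le _ _)
  have h5 := neg_le_of_abs_le h4
  have h6 := mul_le_mul_of_nonneg_right h1 (l2_nonneg χ)
  have h7 : l2 ψ ^ 2 ≤ (3 / 2 * l2 χ) ^ 2 := pow_le_pow_left₀ (l2_nonneg _) h2 2
  rw [h3]
  nlinarith

end NeumannInverse

section BlockBounds

variable {P : Type*} [PseudoMetricSpace P] {N₀ N₁ M₀ M₁ : ℕ} [NeZero N₀] [NeZero N₁] [NeZero M₀]
  [NeZero M₁] {Q : Matrix (Tor N₀ N₁) (Tor M₀ M₁) ℂ} {s₀ s₁ r : ℕ} {m R : ℝ}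
  {g : Tor N₀ N₁ → P} {f : Tor M₀ M₁ → P}

theorem exp_dist_mul_norm_le_of_near (hm : 0 ≤ m)
    (hR : ∀ y u, Q y u ≠ 0 → dist (g y) (f u) ≤ R) (y : Tor N₀ N₁) (u : Tor M₀ M₁) :
    Real.exp (m * dist (g y) (f u)) * ‖Q y u‖ ≤ Real.exp (m * R) * ‖Q y u‖ := by
  by_cases h : Q y u = 0
  · simp [h]
  · have := hR y u h
    gcongr

theorem BlockAvg.rowBd (hQ : BlockAvg Q s₀ s₁ r) (hm : 0 ≤ m)
    (hR : ∀ y u, Q y u ≠ 0 → dist (g y) (f u) ≤ R) : RowBd m g f Q (Real.exp (m * R)) := by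
  intro y
  refine (Finset.sum_le_sum fun u _ => exp_dist_mul_norm_le_of_near hm hR y u).trans ?_
  rw [← Finset.mul_sum, hQ.sum_norm_row, mul_one]

theorem BlockAvg.colBd (hQ : BlockAvg Q s₀ s₁ r) (hm : 0 ≤ m)
    (hR : ∀ y u, Q y u ≠ 0 → dist (g y) (f u) ≤ R) :
    ColBd m g f Q (Real.exp (m * R) * ((s₀ : ℝ) * (s₁ : ℝ) ^ 3)⁻¹) := by
  intro u
  refine (Finset.sum_le_sum fun y _ => exp_dist_mul_norm_le_of_near hm hR y u).trans ?_
  rw [← Finset.mul_sum, hQ.sum_norm_col]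

theorem BlockAvg.ptBd (hQ : BlockAvg Q s₀ s₁ r) (hm : 0 ≤ m)
    (hR : ∀ y u, Q y u ≠ 0 → dist (g y) (f u) ≤ R) :
    PtBd m g f Q (Real.exp (m * R) * ((s₀ : ℝ) * (s₁ : ℝ) ^ 3)⁻¹) := fun y u =>
  (exp_dist_mul_norm_le_of_near hm hR y u).trans
    (mul_le_mul_of_nonneg_left (hQ.norm_le y u) (Real.exp_nonneg _))

theorem BlockAvg.schurBd_gram (hQ : BlockAvg Q s₀ s₁ r) (hm : 0 ≤ m) (hs₀ : 0 < s₀)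
    (hs₁ : 0 < s₁) (hR : ∀ y u, Q y u ≠ 0 → dist (g y) (f u) ≤ R) :
    SchurBd m g ((((s₀ : ℝ) * (s₁ : ℝ) ^ 3 : ℝ) : ℂ) • (Q * Qᵀ)) (Real.exp (2 * (m * R))) := by
  have hc : (0 : ℝ) < (s₀ : ℝ) * (s₁ : ℝ) ^ 3 := by positivity
  have h1 := hQ.rowBd hm hR
  have h2 := hQ.colBd hm hR
  have e : ‖(((s₀ : ℝ) * (s₁ : ℝ) ^ 3 : ℝ) : ℂ)‖ * (Real.exp (m * R) *
      (Real.exp (m * R) * ((s₀ : ℝ) * (s₁ : ℝ) ^ 3)⁻¹)) = Real.exp (2 * (m * R)) := by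
    rw [Complex.norm_real, Real.norm_eq_abs, abs_of_pos hc, two_mul, Real.exp_add]
    field_simp
  refine ⟨?_, ?_⟩
  · have := (h1.mul hm (by positivity) (rowBd_transpose.2 h2)).smul
      (((s₀ : ℝ) * (s₁ : ℝ) ^ 3 : ℝ) : ℂ)
    rwa [e] at this
  · have := (h2.mul hm (by positivity) (colBd_transpose.2 h1)).smul
      (((s₀ : ℝ) * (s₁ : ℝ) ^ 3 : ℝ) : ℂ)
    rw [mul_comm (Real.exp (m * R) * ((s₀ : ℝ) * (s₁ : ℝ) ^ 3)⁻¹), e] at this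
    exact this

/-- The operator `Q* F Q`, with the adjoint with respect to the measures on the two lattices. -/
def sandwich (Q : Matrix (Tor N₀ N₁) (Tor M₀ M₁) ℂ) (s₀ s₁ : ℕ)
    (F : Matrix (Tor N₀ N₁) (Tor N₀ N₁) ℂ) : Matrix (Tor M₀ M₁) (Tor M₀ M₁) ℂ :=
  (((s₀ : ℝ) * (s₁ : ℝ) ^ 3 : ℝ) : ℂ) • (Qᵀ * F * Q)

variable {F : Matrix (Tor N₀ N₁) (Tor N₀ N₁) ℂ} {CF : ℝ}

theorem BlockAvg.schurBd_sandwich (hQ : BlockAvg Q s₀ s₁ r) (hm : 0 ≤ m) (hs₀ : 0 < s₀)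
    (hs₁ : 0 < s₁) (hR : ∀ y u, Q y u ≠ 0 → dist (g y) (f u) ≤ R) (hCF : 0 ≤ CF)
    (hF : SchurBd m g F CF) :
    SchurBd m f (sandwich Q s₀ s₁ F) (CF * Real.exp (2 * (m * R))) := by
  have hc : (0 : ℝ) < (s₀ : ℝ) * (s₁ : ℝ) ^ 3 := by positivity
  have h1 := hQ.rowBd hm hR
  have h2 := hQ.colBd hm hR
  refine ⟨?_, ?_⟩
  · refine (((RowBd.mul hm hCF (rowBd_transpose.2 h2) hF.1).mul hm (Real.exp_nonneg _) h1).smul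
      (((s₀ : ℝ) * (s₁ : ℝ) ^ 3 : ℝ) : ℂ)).mono le_rfl (le_of_eq ?_)
    rw [Complex.norm_real, Real.norm_eq_abs, abs_of_pos hc, two_mul, Real.exp_add]
    field_simp
  · refine (((ColBd.mul hm (Real.exp_nonneg _) (colBd_transpose.2 h1) hF.2).mul hm (by positivity)
      h2).smul (((s₀ : ℝ) * (s₁ : ℝ) ^ 3 : ℝ) : ℂ)).mono le_rfl (le_of_eq ?_)
    rw [Complex.norm_real, Real.norm_eq_abs, abs_of_pos hc, two_mul, Real.exp_add]
    field_simp

theorem BlockAvg.ptBd_sandwich (hQ : BlockAvg Q s₀ s₁ r) (hm : 0 ≤ m) (hs₀ : 0 < s₀)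
    (hs₁ : 0 < s₁) (hR : ∀ y u, Q y u ≠ 0 → dist (g y) (f u) ≤ R) (hCF : 0 ≤ CF)
    (hF : SchurBd m g F CF) :
    PtBd m f f (sandwich Q s₀ s₁ F)
      (CF * Real.exp (2 * (m * R)) * ((s₀ : ℝ) * (s₁ : ℝ) ^ 3)⁻¹) := by
  have hc : (0 : ℝ) < (s₀ : ℝ) * (s₁ : ℝ) ^ 3 := by positivity
  have h2 := hQ.colBd hm hR
  refine (((RowBd.mul hm hCF (rowBd_transpose.2 h2) hF.1).mul_ptBd hm (by positivity)
    (hQ.ptBd hm hR)).smul (((s₀ : ℝ) * (s₁ : ℝ) ^ 3 : ℝ) : ℂ)).mono le_rfl (le_of_eq ?_)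
  rw [Complex.norm_real, Real.norm_eq_abs, abs_of_pos hc, two_mul, Real.exp_add]
  field_simp

end BlockBounds

end ParabolicBlockSpin

namespace ParabolicBlockSpin

open Matrix

section Increments

variable {M₀ M₁ : ℕ} [NeZero M₀] [NeZero M₁]

theorem shiftM_mul_shiftM (v w : Tor M₀ M₁) : shiftM v * shiftM w = shiftM (v + w) := by
  ext x y
  rw [mul_shiftM_apply]
  simp only [shiftM, Matrix.of_apply, sub_eq_iff_eq_add, add_assoc]

theorem shiftM_zero : shiftM (0 : Tor M₀ M₁) = 1 := by
  ext x y
  simp [shiftM, Matrix.one_apply, eq_comm]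

theorem l2_shiftM_mulVec (v : Tor M₀ M₁) (φ : Tor M₀ M₁ → ℂ) : l2 (shiftM v *ᵥ φ) = l2 φ := by
  have h : l2 (shiftM v *ᵥ φ) ^ 2 = l2 φ ^ 2 := by
    rw [l2_sq, l2_sq]
    simp only [shiftM_mulVec]
    exact Equiv.sum_comp (Equiv.addRight v) (fun x => ‖φ x‖ ^ 2)
  exact (pow_left_inj₀ (l2_nonneg _) (l2_nonneg _) two_ne_zero).1 h

/-- The norm of the increment of a function under a translation. -/
def increment (φ : Tor M₀ M₁ → ℂ) (v : Tor M₀ M₁) : ℝ := l2 ((1 - shiftM v) *ᵥ φ)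

variable (φ : Tor M₀ M₁ → ℂ)

theorem increment_nonneg (v : Tor M₀ M₁) : 0 ≤ increment φ v := l2_nonneg _

theorem increment_zero : increment φ 0 = 0 := by
  rw [increment, shiftM_zero, sub_self, Matrix.zero_mulVec]
  simp [l2]

theorem increment_add_le (v w : Tor M₀ M₁) :
    increment φ (v + w) ≤ increment φ v + increment φ w := by
  have h : (1 - shiftM (v + w)) *ᵥ φ =
      (1 - shiftM v) *ᵥ φ + shiftM v *ᵥ ((1 - shiftM w) *ᵥ φ) := by
    rw [Matrix.mulVec_mulVec, ← Matrix.add_mulVec, mul_sub, mul_one, shiftM_mul_shiftM]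
    congr 1; abel
  rw [increment, h]
  refine (l2_add_le _ _).trans ?_
  rw [l2_shiftM_mulVec]; rfl

theorem increment_neg (v : Tor M₀ M₁) : increment φ (-v) = increment φ v := by
  have h : (1 - shiftM (-v)) *ᵥ φ = -(shiftM (-v) *ᵥ ((1 - shiftM v) *ᵥ φ)) := by
    rw [Matrix.mulVec_mulVec, ← Matrix.neg_mulVec, mul_sub, mul_one, shiftM_mul_shiftM,
      neg_add_cancel, shiftM_zero, neg_sub]
  have h2 : ∀ ψ : Tor M₀ M₁ → ℂ, l2 (-ψ) = l2 ψ := fun ψ => by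
    rw [← neg_one_smul ℂ, l2_smul, norm_neg, norm_one, one_mul]
  rw [increment, h, h2, l2_shiftM_mulVec]; rfl

theorem increment_nsmul_le (n : ℕ) (v : Tor M₀ M₁) :
    increment φ (n • v) ≤ n * increment φ v := by
  induction n with
  | zero => simp [increment_zero]
  | succ n ih =>
    rw [succ_nsmul]
    refine (increment_add_le φ _ _).trans ?_
    push_cast; linarith

theorem increment_zsmul_le (t : ℤ) (v : Tor M₀ M₁) :
    increment φ (t • v) ≤ |(t : ℝ)| * increment φ v := by
  obtain ⟨n, rfl | rfl⟩ := t.eq_nat_or_neg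
  · simpa using increment_nsmul_le φ n v
  · rw [neg_smul, increment_neg]
    simpa using increment_nsmul_le φ n v

theorem increment_sum_le {κ : Type*} (s : Finset κ) (v : κ → Tor M₀ M₁) :
    increment φ (∑ i ∈ s, v i) ≤ ∑ i ∈ s, increment φ (v i) := by
  classical
  induction s using Finset.induction_on with
  | empty => simp [increment_zero]
  | insert i s hi ih =>
    rw [Finset.sum_insert hi, Finset.sum_insert hi]
    exact (increment_add_le φ _ _).trans (by linarith)

/-- The class of an integer vector in a discrete torus. -/
def torCls (M₀ M₁ : ℕ) (s : ℤ × (Fin 3 → ℤ)) : Tor M₀ M₁ :=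
  ((s.1 : ZMod M₀), fun ν => ((s.2 ν : ℤ) : ZMod M₁))

theorem torCls_eq (s : ℤ × (Fin 3 → ℤ)) : torCls M₀ M₁ s =
    s.1 • ((1, 0) : Tor M₀ M₁) + ∑ ν, s.2 ν • ((0, Pi.single ν 1) : Tor M₀ M₁) := by
  refine Prod.ext ?_ (funext fun μ => ?_)
  · simp [torCls, Prod.fst_sum]
  · simp [torCls, Prod.snd_sum, Finset.sum_apply, Pi.single_apply]

theorem increment_torCls_sq_le {a b : ℝ} {s : ℤ × (Fin 3 → ℤ)} (ha : |(s.1 : ℝ)| ≤ a)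
    (hb : ∀ ν, |(s.2 ν : ℝ)| ≤ b) : increment φ (torCls M₀ M₁ s) ^ 2 ≤
      4 * ((a * increment φ (1, 0)) ^ 2 + ∑ ν, (b * increment φ (0, Pi.single ν 1)) ^ 2) := by
  have h1 : increment φ (torCls M₀ M₁ s) ≤
      a * increment φ (1, 0) + ∑ ν, b * increment φ (0, Pi.single ν 1) := by
    rw [torCls_eq]
    refine (increment_add_le φ _ _).trans (add_le_add ?_ ?_)
    · exact (increment_zsmul_le φ _ _).trans
        (mul_le_mul_of_nonneg_right ha (increment_nonneg φ _))
    · refine (increment_sum_le φ _ _).trans (Finset.sum_le_sum fun ν _ => ?_)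
      exact (increment_zsmul_le φ _ _).trans
        (mul_le_mul_of_nonneg_right (hb ν) (increment_nonneg φ _))
  refine (pow_le_pow_left₀ (increment_nonneg φ _) h1 2).trans ?_
  simp only [Fin.sum_univ_three]
  set w := a * increment φ (1, 0)
  set x := b * increment φ (0, Pi.single 0 1)
  set y := b * increment φ (0, Pi.single 1 1)
  set z := b * increment φ (0, Pi.single 2 1)
  nlinarith [sq_nonneg (w - x), sq_nonneg (w - y), sq_nonneg (w - z), sq_nonneg (x - y),
    sq_nonneg (x - z), sq_nonneg (y - z)]

end Increments

section Poincare

theorem sum_mul_sq_norm_eq {ι : Type*} [Fintype ι] (q : ι → ℝ) (hq : ∑ u, q u = 1) (φ : ι → ℂ) :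
    ∑ u, q u * ‖φ u‖ ^ 2 = ‖∑ u, (q u : ℂ) * φ u‖ ^ 2 +
      1 / 2 * ∑ u, ∑ u', q u * q u' * ‖φ u - φ u'‖ ^ 2 := by
  have h1 : ∀ z : ℂ, ‖z‖ ^ 2 = z.re ^ 2 + z.im ^ 2 := fun z => by
    rw [← Complex.normSq_eq_norm_sq, Complex.normSq_apply]; ring
  have key : ∀ x : ι → ℝ, ∑ u, ∑ u', q u * q u' * (x u - x u') ^ 2 =
      2 * ∑ u, q u * x u ^ 2 - 2 * (∑ u, q u * x u) ^ 2 := by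
    intro x
    have e : ∀ u u', q u * q u' * (x u - x u') ^ 2 = (q u * x u ^ 2) * q u' +
        q u * (q u' * x u' ^ 2) - 2 * ((q u * x u) * (q u' * x u')) := fun u u' => by ring
    simp only [e, Finset.sum_sub_distrib, Finset.sum_add_distrib, ← Finset.mul_sum,
      ← Finset.sum_mul, hq]
    ring
  simp only [h1, Complex.sub_re, Complex.sub_im, mul_add, Finset.sum_add_distrib, key,
    Complex.re_sum, Complex.im_sum, Complex.re_ofReal_mul, Complex.im_ofReal_mul]
  ring

variable {N₀ N₁ M₀ M₁ : ℕ} [NeZero N₀] [NeZero N₁] [NeZero M₀] [NeZero M₁]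
  {Q : Matrix (Tor N₀ N₁) (Tor M₀ M₁) ℂ} {s₀ s₁ r : ℕ}

/-- The integer vectors by which two points of one block may differ. -/
def diffBox (s₀ s₁ r : ℕ) : Finset (ℤ × (Fin 3 → ℤ)) :=
  Finset.Icc (-((r * s₀ : ℕ) : ℤ)) ((r * s₀ : ℕ) : ℤ) ×ˢ
    Fintype.piFinset fun _ => Finset.Icc (-((r * s₁ : ℕ) : ℤ)) ((r * s₁ : ℕ) : ℤ)

theorem card_diffBox_le (hr : 1 ≤ r) (hs₀ : 1 ≤ s₀) (hs₁ : 1 ≤ s₁) :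
    ((diffBox s₀ s₁ r).card : ℝ) ≤ (3 * r : ℝ) ^ 4 * ((s₀ : ℝ) * (s₁ : ℝ) ^ 3) := by
  rw [diffBox, Finset.card_product, Fintype.card_piFinset]
  simp only [Int.card_Icc, Finset.prod_const, Finset.card_univ, Fintype.card_fin]
  have e : ∀ k : ℕ, ((k : ℤ) + 1 - -(k : ℤ)).toNat = 2 * k + 1 := fun k => by omega
  rw [e, e]
  have h : ∀ s : ℕ, 1 ≤ s → (((2 * (r * s) + 1 : ℕ)) : ℝ) ≤ 3 * r * s := by
    intro s hs
    have : 1 ≤ r * s := Nat.one_le_iff_ne_zero.2 (by positivity)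
    have h2 : (1 : ℝ) ≤ r * s := by exact_mod_cast this
    push_cast; linarith
  rw [Nat.cast_mul, Nat.cast_pow]
  calc (((2 * (r * s₀) + 1 : ℕ)) : ℝ) * (((2 * (r * s₁) + 1 : ℕ)) : ℝ) ^ 3
      ≤ (3 * r * s₀) * (3 * r * s₁) ^ 3 := by
        gcongr
        · exact h s₀ hs₀
        · exact h s₁ hs₁
    _ = _ := by ring

theorem BlockAvg.exists_eq_add_torCls (hQ : BlockAvg Q s₀ s₁ r) {y : Tor N₀ N₁}
    {u u' : Tor M₀ M₁} (h : Q y u ≠ 0) (h' : Q y u' ≠ 0) :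
    ∃ s ∈ diffBox s₀ s₁ r, u' = u + torCls M₀ M₁ s := by
  obtain ⟨t, z, ht, hz, hu⟩ := hQ.supp y u h
  obtain ⟨t', z', ht', hz', hu'⟩ := hQ.supp y u' h'
  have key : ∀ (s : ℕ) (a b : ℤ), 2 * |a| ≤ r * ((s : ℤ) - 1) → 2 * |b| ≤ r * ((s : ℤ) - 1) →
      b - a ∈ Finset.Icc (-((r * s : ℕ) : ℤ)) ((r * s : ℕ) : ℤ) := by
    intro s a b ha hb
    have h1 := abs_sub b a
    rw [Finset.mem_Icc, ← abs_le]
    have h2 : (0 : ℤ) ≤ r := by positivity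
    push_cast
    nlinarith
  refine ⟨(t' - t, fun ν => z' ν - z ν), ?_, ?_⟩
  · rw [diffBox, Finset.mem_product, Fintype.mem_piFinset]
    exact ⟨key _ _ _ ht ht', fun ν => key _ _ _ (hz ν) (hz' ν)⟩
  · rw [hu, hu', torCls]
    refine Prod.ext ?_ (funext fun ν => ?_)
    · simp only [Prod.fst_add]; push_cast; ring
    · simp only [Prod.snd_add, Pi.add_apply]; push_cast; ring

/-- A Poincaré inequality: control by block averages and by increments. -/
theorem BlockAvg.l2_sq_le (hQ : BlockAvg Q s₀ s₁ r) (hr : 1 ≤ r) (hs₀ : 1 ≤ s₀) (hs₁ : 1 ≤ s₁)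
    (φ : Tor M₀ M₁ → ℂ) {Δ : ℝ} (hΔ : 0 ≤ Δ)
    (hφ : ∀ s ∈ diffBox s₀ s₁ r, increment φ (torCls M₀ M₁ s) ^ 2 ≤ Δ) :
    l2 φ ^ 2 ≤ ((s₀ : ℝ) * (s₁ : ℝ) ^ 3) * l2 (Q *ᵥ φ) ^ 2 + (3 * r : ℝ) ^ 4 * Δ := by
  set c : ℝ := (s₀ : ℝ) * (s₁ : ℝ) ^ 3 with hc
  have hc0 : 0 < c := by positivity
  have e1 : l2 φ ^ 2 = c * ∑ y, ∑ u, (Q y u).re * ‖φ u‖ ^ 2 := by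
    rw [Finset.sum_comm]
    simp only [← Finset.sum_mul, ← hQ.norm_eq, hQ.sum_norm_col]
    rw [← Finset.mul_sum, ← l2_sq, ← mul_assoc, mul_inv_cancel₀ hc0.ne', one_mul]
  have hrow : ∀ y, ∑ u, (Q y u).re = 1 := fun y => by
    rw [← Complex.re_sum, hQ.row_sum, Complex.one_re]
  have e2 : ∀ y, ∑ u, ((Q y u).re : ℂ) * φ u = (Q *ᵥ φ) y := fun y =>
    Finset.sum_congr rfl fun u _ => by rw [← hQ.eq_re]
  simp only [sum_mul_sq_norm_eq _ (hrow _), e2] at e1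
  rw [Finset.sum_add_distrib, ← l2_sq, mul_add] at e1
  rw [e1]
  refine add_le_add le_rfl ?_
  have h3 : ∀ u u', c * ∑ y, (Q y u).re * (Q y u').re ≤ c⁻¹ := by
    intro u u'
    have : ∑ y, (Q y u).re * (Q y u').re ≤ ∑ y, ‖Q y u‖ * c⁻¹ := by
      refine Finset.sum_le_sum fun y _ => ?_
      rw [← hQ.norm_eq, ← hQ.norm_eq]
      exact mul_le_mul_of_nonneg_left (hQ.norm_le y u') (norm_nonneg _)
    rw [← Finset.sum_mul, hQ.sum_norm_col, ← hc] at this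
    calc _ ≤ c * (c⁻¹ * c⁻¹) := mul_le_mul_of_nonneg_left this hc0.le
      _ = c⁻¹ := by field_simp
  have h4 : ∀ u u', (c * ∑ y, (Q y u).re * (Q y u').re) * ‖φ u - φ u'‖ ^ 2 ≤
      ∑ s ∈ diffBox s₀ s₁ r,
        if u' = u + torCls M₀ M₁ s then c⁻¹ * ‖φ u - φ u'‖ ^ 2 else 0 := by
    intro u u'
    have hpos : ∀ s ∈ diffBox s₀ s₁ r,
        0 ≤ if u' = u + torCls M₀ M₁ s then c⁻¹ * ‖φ u - φ u'‖ ^ 2 else 0 := by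
      intro s _; split_ifs <;> positivity
    by_cases hz : ∑ y, (Q y u).re * (Q y u').re = 0
    · rw [hz, mul_zero, zero_mul]
      exact Finset.sum_nonneg hpos
    · obtain ⟨y, -, hy⟩ := Finset.exists_ne_zero_of_sum_ne_zero hz
      have g1 : Q y u ≠ 0 := fun h => hy (by rw [h]; simp)
      have g2 : Q y u' ≠ 0 := fun h => hy (by rw [h]; simp)
      obtain ⟨s, hs, hus⟩ := hQ.exists_eq_add_torCls g1 g2
      refine le_trans ?_ (Finset.single_le_sum hpos hs)
      rw [if_pos hus]
      exact mul_le_mul_of_nonneg_right (h3 u u') (sq_nonneg _)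
  have h5 : c * ∑ y, 1 / 2 * ∑ u, ∑ u', (Q y u).re * (Q y u').re * ‖φ u - φ u'‖ ^ 2 =
      1 / 2 * ∑ u, ∑ u', (c * ∑ y, (Q y u).re * (Q y u').re) * ‖φ u - φ u'‖ ^ 2 := by
    rw [← Finset.mul_sum, Finset.sum_comm]
    simp only [Finset.mul_sum, Finset.sum_mul]
    refine Finset.sum_congr rfl fun u _ => ?_
    rw [Finset.sum_comm]
    refine Finset.sum_congr rfl fun u' _ => Finset.sum_congr rfl fun y _ => ?_
    ring
  rw [h5]
  have h6 : ∑ u, ∑ u', (c * ∑ y, (Q y u).re * (Q y u').re) * ‖φ u - φ u'‖ ^ 2 ≤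
      (3 * r : ℝ) ^ 4 * Δ := by
    calc _ ≤ ∑ u, ∑ u', ∑ s ∈ diffBox s₀ s₁ r,
          if u' = u + torCls M₀ M₁ s then c⁻¹ * ‖φ u - φ u'‖ ^ 2 else 0 :=
          Finset.sum_le_sum fun u _ => Finset.sum_le_sum fun u' _ => h4 u u'
      _ = ∑ s ∈ diffBox s₀ s₁ r, c⁻¹ * increment φ (torCls M₀ M₁ s) ^ 2 := by
          have : ∀ u, (∑ u', ∑ s ∈ diffBox s₀ s₁ r,
              if u' = u + torCls M₀ M₁ s then c⁻¹ * ‖φ u - φ u'‖ ^ 2 else 0) =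
              ∑ s ∈ diffBox s₀ s₁ r, c⁻¹ * ‖φ u - φ (u + torCls M₀ M₁ s)‖ ^ 2 := by
            intro u
            rw [Finset.sum_comm]
            refine Finset.sum_congr rfl fun s _ => ?_
            rw [Finset.sum_ite_eq' Finset.univ (u + torCls M₀ M₁ s), if_pos (Finset.mem_univ _)]
          simp only [this]
          rw [Finset.sum_comm]
          refine Finset.sum_congr rfl fun s _ => ?_
          rw [← Finset.mul_sum, increment, l2_sq]
          simp only [Matrix.sub_mulVec, Matrix.one_mulVec, Pi.sub_apply, shiftM_mulVec]
      _ ≤ ∑ s ∈ diffBox s₀ s₁ r, c⁻¹ * Δ :=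
          Finset.sum_le_sum fun s hs => mul_le_mul_of_nonneg_left (hφ s hs) (by positivity)
      _ = (diffBox s₀ s₁ r).card * (c⁻¹ * Δ) := by rw [Finset.sum_const, nsmul_eq_mul]
      _ ≤ ((3 * r : ℝ) ^ 4 * c) * (c⁻¹ * Δ) :=
          mul_le_mul_of_nonneg_right (card_diffBox_le hr hs₀ hs₁) (by positivity)
      _ = (3 * r : ℝ) ^ 4 * Δ := by field_simp
  have h7 : 0 ≤ (3 * r : ℝ) ^ 4 * Δ := by positivity
  linarith

end Poincare

end ParabolicBlockSpin

namespace ParabolicBlockSpin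

open Matrix

section Coercivity

theorem le_of_coercivity {p F d x κ a C : ℝ} (hp : 0 ≤ p) (hF : 0 ≤ F) (hd : 0 ≤ d)
    (hC : 0 ≤ C) (hκ : 0 ≤ κ) (h1 : x ^ 2 ≤ κ * (p * F)) (h2 : d ≤ F + a * x)
    (h3 : p ^ 2 ≤ x ^ 2 + C * (d ^ 2 + p * d)) :
    p ≤ (2 * (C + C ^ 2) * 2 + ((2 + 4 * (C + C ^ 2) * a ^ 2) * κ) ^ 2 + 1) * F := by
  have h4 : d ^ 2 ≤ 2 * F ^ 2 + 2 * a ^ 2 * x ^ 2 := by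
    have : d ^ 2 ≤ (F + a * x) ^ 2 := pow_le_pow_left₀ hd h2 2
    nlinarith [sq_nonneg (F - a * x)]
  have h5 : p ^ 2 ≤ 2 * x ^ 2 + 2 * (C + C ^ 2) * d ^ 2 := by
    nlinarith [sq_nonneg (p - C * d), mul_nonneg hC (sq_nonneg d)]
  have hCC : 0 ≤ C + C ^ 2 := by positivity
  set B := C + C ^ 2
  have h6 : p ^ 2 ≤ (2 + 4 * B * a ^ 2) * x ^ 2 + 4 * B * F ^ 2 := by
    nlinarith [mul_le_mul_of_nonneg_left h4 hCC]
  set W := 2 + 4 * B * a ^ 2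
  have hW : 0 ≤ W := by positivity
  have h7 : p ^ 2 ≤ (W * κ) * (p * F) + 4 * B * F ^ 2 := by
    nlinarith [mul_le_mul_of_nonneg_left h1 hW]
  set Z := W * κ
  have hZ : 0 ≤ Z := by positivity
  by_contra hcon
  push Not at hcon
  have hk : 0 ≤ 4 * B + Z ^ 2 := by positivity
  have h8 : (2 * B * 2 + Z ^ 2 + 1) * F = (4 * B + Z ^ 2 + 1) * F := by ring
  rw [h8] at hcon
  have hFp : F ≤ p := by nlinarith
  have h9 : (4 * B + Z ^ 2 + 1) * F * p ≤ p * p := mul_le_mul_of_nonneg_right hcon.le hp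
  have hp0 : 0 < p := lt_of_le_of_lt (by positivity) hcon
  nlinarith [mul_nonneg hF hp, sq_nonneg (Z - 1), mul_nonneg hF hF,
    mul_nonneg hCC (mul_nonneg hF (sub_nonneg.2 hFp)), mul_lt_mul_of_pos_right hcon hp0,
    mul_nonneg (sq_nonneg (Z - 1)) (mul_nonneg hF hp)]

variable {M₀ M₁ N₀ N₁ : ℕ} [NeZero M₀] [NeZero M₁] [NeZero N₀] [NeZero N₁]

theorem re_dotProduct_generator_nonneg (h : SingleParticle) (e : ℝ) (φ : Tor M₀ M₁ → ℂ) :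
    0 ≤ (star φ ⬝ᵥ (generator h M₀ M₁ e *ᵥ φ)).re := by
  rw [generator, Matrix.smul_mulVec, dotProduct_smul, smul_eq_mul, Complex.re_ofReal_mul,
    Matrix.sub_mulVec, Matrix.one_mulVec, dotProduct_sub, star_dotProduct_self, Complex.sub_re,
    Complex.ofReal_re]
  refine mul_nonneg (by positivity) ?_
  have h1 := (Complex.re_le_norm _).trans (norm_dotProduct_le φ (transfer h M₀ M₁ *ᵥ φ))
  have h2 := mul_le_mul_of_nonneg_left (l2_transfer_le h φ) (l2_nonneg φ)
  nlinarith

theorem l2_generator_mulVec (h : SingleParticle) (e : ℝ) (φ : Tor M₀ M₁ → ℂ) :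
    l2 (generator h M₀ M₁ e *ᵥ φ) = (e ^ 2)⁻¹ * l2 ((1 - transfer h M₀ M₁) *ᵥ φ) := by
  rw [generator, Matrix.smul_mulVec, l2_smul, Complex.norm_real, Real.norm_eq_abs,
    abs_of_nonneg (by positivity)]

variable {Q : Matrix (Tor N₀ N₁) (Tor M₀ M₁) ℂ} {s₀ s₁ r : ℕ}

theorem BlockAvg.l2_transpose_mulVec_sq_le (hQ : BlockAvg Q s₀ s₁ r) (ψ : Tor N₀ N₁ → ℂ) :
    l2 (Qᵀ *ᵥ ψ) ^ 2 ≤ ((s₀ : ℝ) * (s₁ : ℝ) ^ 3)⁻¹ * l2 ψ ^ 2 := by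
  have h1 : RowBd 0 (fun _ : Tor N₀ N₁ => (0 : ℝ)) (fun _ : Tor M₀ M₁ => (0 : ℝ)) Q 1 := by
    intro y; simp [hQ.sum_norm_row]
  have h2 : ColBd 0 (fun _ : Tor N₀ N₁ => (0 : ℝ)) (fun _ : Tor M₀ M₁ => (0 : ℝ)) Q
      ((s₀ : ℝ) * (s₁ : ℝ) ^ 3)⁻¹ := by
    intro u
    simp only [zero_mul, Real.exp_zero, one_mul]
    exact (hQ.sum_norm_col u).le
  have := l2_mulVec_sq_le_of_rowBd_colBd le_rfl (by positivity) (rowBd_transpose.2 h2)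
    (colBd_transpose.2 h1) ψ
  rwa [mul_one] at this

theorem BlockAvg.dotProduct_transpose_mulVec (hQ : BlockAvg Q s₀ s₁ r) (φ : Tor M₀ M₁ → ℂ)
    (ψ : Tor N₀ N₁ → ℂ) : star φ ⬝ᵥ (Qᵀ *ᵥ ψ) = star (Q *ᵥ φ) ⬝ᵥ ψ := by
  have : Qᵀ = Qᴴ := by
    ext u y
    rw [Matrix.transpose_apply, Matrix.conjTranspose_apply, hQ.eq_re y u, RCLike.star_def,
      Complex.conj_ofReal]
  rw [this, Matrix.star_mulVec, Matrix.dotProduct_mulVec]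

/-- The fundamental coercivity estimate: the operator `D + Q* 𝔔 Q` has an inverse whose norm is
bounded uniformly in the lattices. -/
theorem exists_l2_le (h : SingleParticle) {r : ℕ} (hr : 1 ≤ r) {a : ℝ} (ha : 0 < a) :
    ∃ CS : ℝ, 0 ≤ CS ∧ ∀ (M₀ M₁ N₀ N₁ : ℕ) [NeZero M₀] [NeZero M₁] [NeZero N₀] [NeZero N₁]
      (Q : Matrix (Tor N₀ N₁) (Tor M₀ M₁) ℂ) (X : Matrix (Tor N₀ N₁) (Tor N₀ N₁) ℂ) (s₀ s₁ : ℕ),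
      BlockAvg Q s₀ s₁ r → s₀ = s₁ ^ 2 → 1 ≤ s₁ →
      (∀ ψ, 2 / 9 * l2 ψ ^ 2 ≤ (star ψ ⬝ᵥ (X *ᵥ ψ)).re) → (∀ ψ, l2 (X *ᵥ ψ) ≤ 2 * l2 ψ) →
      ∀ φ, l2 φ ≤ CS *
        l2 ((generator h M₀ M₁ (s₁ : ℝ)⁻¹ + sandwich Q s₀ s₁ ((a : ℂ) • X)) *ᵥ φ) := by
  obtain ⟨C, hC, H⟩ := exists_transfer_gradient_bounds h
  set C' : ℝ := (3 * r : ℝ) ^ 4 * (4 * (r ^ 2 * (C ^ 2 + 3 * C))) with hC'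
  have hC'0 : 0 ≤ C' := by positivity
  refine ⟨2 * (C' + C' ^ 2) * 2 + ((2 + 4 * (C' + C' ^ 2) * (2 * a) ^ 2) * (9 / (2 * a))) ^ 2 + 1,
    by positivity, ?_⟩
  intro M₀ M₁ N₀ N₁ _ _ _ _ Q X s₀ s₁ hQ hs hs₁ hX hX2 φ
  have hs₀ : 1 ≤ s₀ := by rw [hs]; exact Nat.one_le_pow _ _ hs₁
  set K := sandwich Q s₀ s₁ ((a : ℂ) • X) with hK
  set D := generator h M₀ M₁ (s₁ : ℝ)⁻¹ with hD
  set c : ℝ := (s₀ : ℝ) * (s₁ : ℝ) ^ 3 with hc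
  have hc0 : 0 < c := by positivity
  have hKφ : K *ᵥ φ = ((c * a : ℝ) : ℂ) • (Qᵀ *ᵥ (X *ᵥ (Q *ᵥ φ))) := by
    rw [hK, sandwich, Matrix.mul_smul, Matrix.smul_mul, Matrix.smul_mulVec, Matrix.smul_mulVec,
      smul_smul, ← Matrix.mulVec_mulVec, ← Matrix.mulVec_mulVec]
    rw [← Complex.ofReal_mul]
  have hx : (√c * l2 (Q *ᵥ φ)) ^ 2 = c * l2 (Q *ᵥ φ) ^ 2 := by
    rw [mul_pow, Real.sq_sqrt hc0.le]
  refine le_of_coercivity (d := l2 (D *ᵥ φ)) (x := √c * l2 (Q *ᵥ φ)) (l2_nonneg _) (l2_nonneg _)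
    (l2_nonneg _) hC'0 (by positivity) ?_ ?_ ?_
  · have h1 : (star φ ⬝ᵥ ((D + K) *ᵥ φ)).re ≤ l2 φ * l2 ((D + K) *ᵥ φ) :=
      (Complex.re_le_norm _).trans (norm_dotProduct_le _ _)
    rw [Matrix.add_mulVec, dotProduct_add, Complex.add_re, ← Matrix.add_mulVec] at h1
    have h2 := re_dotProduct_generator_nonneg h (s₁ : ℝ)⁻¹ φ
    rw [← hD] at h2
    have h3 : (star φ ⬝ᵥ (K *ᵥ φ)).re =
        c * a * (star (Q *ᵥ φ) ⬝ᵥ (X *ᵥ (Q *ᵥ φ))).re := by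
      rw [hKφ, dotProduct_smul, smul_eq_mul, Complex.re_ofReal_mul, hQ.dotProduct_transpose_mulVec]
    have h4 := mul_le_mul_of_nonneg_left (hX (Q *ᵥ φ)) (mul_nonneg hc0.le ha.le)
    rw [← h3] at h4
    rw [hx]
    have h5 : c * a * (2 / 9 * l2 (Q *ᵥ φ) ^ 2) ≤ l2 φ * l2 ((D + K) *ᵥ φ) := by linarith
    rw [div_mul_eq_mul_div, le_div_iff₀ (by positivity)]
    linarith
  · have h1 : l2 (K *ᵥ φ) ≤ 2 * a * (√c * l2 (Q *ᵥ φ)) := by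
      refine (pow_le_pow_iff_left₀ (l2_nonneg _)
        (mul_nonneg (by positivity) (mul_nonneg (by positivity) (l2_nonneg _))) two_ne_zero).1 ?_
      rw [mul_pow, hx, hKφ, l2_smul, Complex.norm_real, Real.norm_eq_abs,
        abs_of_nonneg (by positivity), mul_pow]
      have h2 := hQ.l2_transpose_mulVec_sq_le (X *ᵥ (Q *ᵥ φ))
      have h3 : l2 (X *ᵥ (Q *ᵥ φ)) ^ 2 ≤ (2 * l2 (Q *ᵥ φ)) ^ 2 :=
        pow_le_pow_left₀ (l2_nonneg _) (hX2 _) 2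
      calc (c * a) ^ 2 * l2 (Qᵀ *ᵥ (X *ᵥ (Q *ᵥ φ))) ^ 2
          ≤ (c * a) ^ 2 * (c⁻¹ * (2 * l2 (Q *ᵥ φ)) ^ 2) := by
            refine mul_le_mul_of_nonneg_left (h2.trans ?_) (by positivity)
            exact mul_le_mul_of_nonneg_left h3 (by positivity)
        _ = (2 * a) ^ 2 * (c * l2 (Q *ᵥ φ) ^ 2) := by field_simp
    have h2 : D *ᵥ φ = (D + K) *ᵥ φ - K *ᵥ φ := by rw [Matrix.add_mulVec, add_sub_cancel_right]
    calc l2 (D *ᵥ φ) ≤ l2 ((D + K) *ᵥ φ) + l2 (K *ᵥ φ) := by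
          conv_lhs => rw [h2]
          exact l2_sub_le _ _
      _ ≤ _ := by linarith
  · set d := l2 (D *ᵥ φ) with hd
    have hd0 : 0 ≤ d := l2_nonneg _
    have hp0 : 0 ≤ l2 φ := l2_nonneg _
    have hds : d = s₀ * l2 ((1 - transfer h M₀ M₁) *ᵥ φ) := by
      rw [hd, hD, l2_generator_mulVec, inv_pow, inv_inv, hs]; push_cast; rfl
    have g0 : (s₀ : ℝ) * increment φ (1, 0) ≤ C * d := by
      rw [hds]
      have := mul_le_mul_of_nonneg_left (H M₀ M₁ φ).1 (Nat.cast_nonneg (α := ℝ) s₀)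
      calc _ ≤ _ := this
        _ = _ := by ring
    have g1 : ∀ ν, ((s₁ : ℝ) * increment φ (0, Pi.single ν 1)) ^ 2 ≤ C * (l2 φ * d) := by
      intro ν
      rw [hds]
      have := mul_le_mul_of_nonneg_left ((H M₀ M₁ φ).2 ν) (Nat.cast_nonneg (α := ℝ) s₀)
      calc ((s₁ : ℝ) * increment φ (0, Pi.single ν 1)) ^ 2
          = s₀ * increment φ (0, Pi.single ν 1) ^ 2 := by rw [hs, mul_pow]; push_cast; rfl
        _ ≤ _ := this
        _ = _ := by ring
    have hΔ : ∀ s ∈ diffBox s₀ s₁ r, increment φ (torCls M₀ M₁ s) ^ 2 ≤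
        4 * (r ^ 2 * (C ^ 2 + 3 * C)) * (d ^ 2 + l2 φ * d) := by
      intro s hsm
      rw [diffBox, Finset.mem_product, Fintype.mem_piFinset, Finset.mem_Icc, ← abs_le] at hsm
      have b0 : |(s.1 : ℝ)| ≤ r * s₀ := by exact_mod_cast hsm.1
      have b1 : ∀ ν, |(s.2 ν : ℝ)| ≤ r * s₁ := fun ν => by
        have := hsm.2 ν
        rw [Finset.mem_Icc, ← abs_le] at this
        exact_mod_cast this
      refine (increment_torCls_sq_le φ b0 b1).trans ?_
      have k0 : ((r * s₀ : ℝ) * increment φ (1, 0)) ^ 2 ≤ r ^ 2 * (C * d) ^ 2 := by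
        rw [mul_assoc, mul_pow]
        refine mul_le_mul_of_nonneg_left (pow_le_pow_left₀ ?_ g0 2) (by positivity)
        exact mul_nonneg (by positivity) (increment_nonneg φ _)
      have k1 : ∑ ν : Fin 3, ((r * s₁ : ℝ) * increment φ (0, Pi.single ν 1)) ^ 2 ≤
          ∑ ν : Fin 3, r ^ 2 * (C * (l2 φ * d)) := by
        refine Finset.sum_le_sum fun ν _ => ?_
        rw [mul_assoc, mul_pow]
        exact mul_le_mul_of_nonneg_left (g1 ν) (by positivity)
      simp only [Finset.sum_const, Finset.card_univ, Fintype.card_fin, nsmul_eq_mul] at k1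
      push_cast at k1
      have q1 : 0 ≤ (r : ℝ) ^ 2 * C ^ 2 * (l2 φ * d) := by positivity
      have q2 : 0 ≤ (r : ℝ) ^ 2 * C * d ^ 2 := by positivity
      calc _ ≤ 4 * (r ^ 2 * (C * d) ^ 2 + 3 * (r ^ 2 * (C * (l2 φ * d)))) := by
            linarith
        _ ≤ _ := by nlinarith
    have := hQ.l2_sq_le hr hs₀ hs₁ φ (by positivity) hΔ
    rw [hx]
    calc _ ≤ _ := this
      _ = _ := by rw [hC']; ring

end Coercivity

end ParabolicBlockSpin

namespace ParabolicBlockSpin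

open Matrix

section Circle

theorem norm_coe_addCircle_le (p x : ℝ) : ‖(x : AddCircle p)‖ ≤ |x| := by
  exact QuotientAddGroup.norm_mk_le_norm

theorem coe_addCircle_eq_of_cast_eq {M : ℕ} {η p : ℝ} (hp : η * M = p) {k l : ℤ}
    (h : (k : ZMod M) = (l : ZMod M)) : ((η * k : ℝ) : AddCircle p) = ((η * l : ℝ) : AddCircle p) := by
  rw [ZMod.intCast_eq_intCast_iff_dvd_sub] at h
  obtain ⟨c, hc⟩ := h
  have h1 : η * (l : ℝ) = η * k + c • p := by
    have : (l : ℝ) = k + M * c := by exact_mod_cast (by linarith : l = k + M * c)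
    rw [this, ← hp, zsmul_eq_mul]; ring
  rw [h1, AddCircle.coe_add, AddCircle.coe_zsmul, AddCircle.coe_period, smul_zero, add_zero]

theorem sum_exp_neg_norm_addCircle_le {M : ℕ} [NeZero M] {η p β : ℝ} (hη : 0 < η) (hη1 : η ≤ 1)
    (hβ : 0 < β) (hp : η * M = p) (w : ZMod M) :
    ∑ i : ZMod M, η * Real.exp (-(β * ‖((η * (i.val : ℝ) - η * (w.val : ℝ) : ℝ) : AddCircle p)‖)) ≤
      2 + 2 / β := by
  set k : ZMod M → ℤ := fun i => (i.val : ℤ) - (w.val : ℤ) with hk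
  set g : ZMod M → ℤ := fun i => k i - round (p⁻¹ * (η * (k i : ℝ))) * (M : ℤ) with hg
  have h1 : ∀ i, ‖((η * (i.val : ℝ) - η * (w.val : ℝ) : ℝ) : AddCircle p)‖ = η * |(g i : ℝ)| := by
    intro i
    have e : η * (i.val : ℝ) - η * (w.val : ℝ) = η * (k i : ℝ) := by
      rw [hk]; push_cast; ring
    rw [e, AddCircle.norm_eq, ← abs_of_pos hη, ← abs_mul, abs_of_pos hη]
    congr 1
    rw [hg]
    push_cast
    rw [← hp]; ring
  have hinj : Function.Injective g := by
    intro i j hij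
    have : ((g i : ℤ) : ZMod M) = ((g j : ℤ) : ZMod M) := by rw [hij]
    simpa [hg, hk] using this
  have hβη : 0 < β * η := by positivity
  have h2 : ∑ i : ZMod M, Real.exp (-(β * η * |(g i : ℝ)|)) ≤ 2 + 2 / (β * η) := by
    refine le_trans ?_ (tsum_exp_neg_mul_abs_int_le hβη)
    rw [← Finset.sum_image (f := fun z : ℤ => Real.exp (-(β * η * |(z : ℝ)|)))
      (fun i _ j _ hij => hinj hij)]
    exact (summable_exp_neg_mul_abs_int hβη).sum_le_tsum _ fun z _ => (Real.exp_pos _).le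
  rw [← Finset.mul_sum]
  simp only [h1, ← mul_assoc]
  calc _ ≤ η * (2 + 2 / (β * η)) := mul_le_mul_of_nonneg_left h2 hη.le
    _ = 2 * η + 2 / β := by field_simp
    _ ≤ 2 + 2 / β := by linarith

end Circle

section Torus

/-- The torus with the periods `period L A B N`. -/
abbrev Torus (L A B : ℕ) (N : ℤ) : Type := PiLp 2 fun ν : Fin 4 => AddCircle (period L A B N ν)

variable {L A B : ℕ} {N : ℤ}

/-- The projection of `ℝ⁴` onto the torus. -/
def toTorus (L A B : ℕ) (N : ℤ) (x : Fin 4 → ℝ) : Torus L A B N :=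
  WithLp.toLp 2 fun ν => (x ν : AddCircle (period L A B N ν))

theorem dist_toTorus (x y : Fin 4 → ℝ) :
    dist (toTorus L A B N x) (toTorus L A B N y) = torusDist L A B N x y := by
  rw [PiLp.dist_eq_of_L2, torusDist]
  congr 1
  refine Finset.sum_congr rfl fun ν _ => ?_
  rw [dist_eq_norm, toTorus, toTorus, AddCircle.coe_sub]

theorem torusDist_le (x y : Fin 4 → ℝ) : torusDist L A B N x y ≤ ∑ ν, |x ν - y ν| := by
  refine Real.sqrt_le_iff.2 ⟨Finset.sum_nonneg fun ν _ => abs_nonneg _, ?_⟩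
  calc ∑ ν, ‖((x ν - y ν : ℝ) : AddCircle (period L A B N ν))‖ ^ 2
      ≤ ∑ ν, |x ν - y ν| ^ 2 := Finset.sum_le_sum fun ν _ =>
        pow_le_pow_left₀ (norm_nonneg _) (norm_coe_addCircle_le _ _) 2
    _ ≤ (∑ ν, |x ν - y ν|) ^ 2 := Finset.sum_sq_le_sq_sum_of_nonneg fun ν _ => abs_nonneg _

theorem sum_norm_le_two_mul_torusDist (x y : Fin 4 → ℝ) :
    ∑ ν, ‖((x ν - y ν : ℝ) : AddCircle (period L A B N ν))‖ ≤ 2 * torusDist L A B N x y := by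
  refine (pow_le_pow_iff_left₀ (Finset.sum_nonneg fun ν _ => norm_nonneg _)
    (mul_nonneg zero_le_two (Real.sqrt_nonneg _)) two_ne_zero).1 ?_
  rw [mul_pow, Real.sq_sqrt (Finset.sum_nonneg fun ν _ => sq_nonneg _)]
  refine sq_sum_le_card_mul_sum_sq.trans ?_
  norm_num

variable [NeZero L]

theorem eps_pos (j : ℤ) : 0 < eps L j := by
  have : (0 : ℝ) < L := by exact_mod_cast NeZero.pos L
  exact zpow_pos this _

theorem eps_mul_pow {j N : ℤ} {b : ℕ} (hj : j + b = N) {C : ℕ} (hb : b ≤ C) :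
    eps L j * ((L ^ (C - b) : ℕ) : ℝ) = eps L N * (L : ℝ) ^ C := by
  have hL0 : (L : ℝ) ≠ 0 := by exact_mod_cast NeZero.ne L
  rw [eps, eps, Nat.cast_pow, ← zpow_natCast, ← zpow_natCast, ← zpow_add₀ hL0, ← zpow_add₀ hL0]
  congr 1
  push_cast [hb]
  omega

theorem eps_sq_mul_pow {j N : ℤ} {b : ℕ} (hj : j + b = N) {C : ℕ} (hb : 2 * b ≤ C) :
    eps L j ^ 2 * ((L ^ (C - 2 * b) : ℕ) : ℝ) = eps L N ^ 2 * (L : ℝ) ^ C := by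
  have hL0 : (L : ℝ) ≠ 0 := by exact_mod_cast NeZero.ne L
  rw [eps, eps, Nat.cast_pow, ← zpow_natCast, ← zpow_natCast, ← zpow_natCast, ← zpow_natCast,
    ← _root_.zpow_mul, ← _root_.zpow_mul, ← zpow_add₀ hL0, ← zpow_add₀ hL0]
  congr 1
  push_cast [hb]
  omega

/-- The position in the torus of an integer vector, in units of the lattice spacing. -/
def intPos (L : ℕ) (j : ℤ) (s : ℤ × (Fin 3 → ℤ)) : Fin 4 → ℝ :=
  Fin.cons (eps L j ^ 2 * (s.1 : ℝ)) fun ν => eps L j * (s.2 ν : ℝ)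

theorem toTorus_pos_torCls {j : ℤ} {b : ℕ} (hj : j + b = N) (hA : 2 * b ≤ A) (hB : b ≤ B)
    (s : ℤ × (Fin 3 → ℤ)) :
    toTorus L A B N (pos L A B j b (torCls (L ^ (A - 2 * b)) (L ^ (B - b)) s)) =
      toTorus L A B N (intPos L j s) := by
  unfold toTorus
  congr 1
  funext ν
  refine Fin.cases ?_ (fun μ => ?_) ν
  · change ((eps L j ^ 2 * (((s.1 : ZMod (L ^ (A - 2 * b))).val : ℕ) : ℝ) : ℝ) :
      AddCircle (eps L N ^ 2 * (L : ℝ) ^ A)) = ((eps L j ^ 2 * (s.1 : ℝ) : ℝ) : AddCircle _)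
    have := coe_addCircle_eq_of_cast_eq (eps_sq_mul_pow (L := L) hj hA)
      (k := (((s.1 : ℤ) : ZMod (L ^ (A - 2 * b))).val : ℤ)) (l := s.1) (by simp)
    simpa using this
  · change ((eps L j * (((s.2 μ : ZMod (L ^ (B - b))).val : ℕ) : ℝ) : ℝ) :
      AddCircle (eps L N * (L : ℝ) ^ B)) = ((eps L j * (s.2 μ : ℝ) : ℝ) : AddCircle _)
    have := coe_addCircle_eq_of_cast_eq (eps_mul_pow (L := L) hj hB)
      (k := (((s.2 μ : ℤ) : ZMod (L ^ (B - b))).val : ℤ)) (l := s.2 μ) (by simp)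
    simpa using this

theorem pos_eq_intPos {j : ℤ} {b : ℕ} (u : Lat L A B j b) : pos L A B j b u =
    intPos L j ((u.1.val : ℤ), fun ν => ((u.2 ν).val : ℤ)) := by
  simp [pos, intPos]

theorem torCls_val {M₀ M₁ : ℕ} [NeZero M₀] [NeZero M₁] (u : Tor M₀ M₁) :
    torCls M₀ M₁ ((u.1.val : ℤ), fun ν => ((u.2 ν).val : ℤ)) = u := by
  refine Prod.ext ?_ (funext fun ν => ?_) <;> simp [torCls]

theorem torCls_add {M₀ M₁ : ℕ} (s t : ℤ × (Fin 3 → ℤ)) :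
    torCls M₀ M₁ (s + t) = torCls M₀ M₁ s + torCls M₀ M₁ t := by
  refine Prod.ext ?_ (funext fun ν => ?_) <;> simp [torCls]

theorem torusDist_intPos_le {j k : ℤ} (s t : ℤ × (Fin 3 → ℤ)) :
    torusDist L A B N (intPos L j s) (intPos L k t) ≤
      |eps L j ^ 2 * s.1 - eps L k ^ 2 * t.1| + ∑ ν, |eps L j * s.2 ν - eps L k * t.2 ν| := by
  refine (torusDist_le _ _).trans (le_of_eq ?_)
  rw [Fin.sum_univ_succ]
  simp [intPos]

/-- The position of a lattice point in the torus. -/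
def place (A B : ℕ) (N : ℤ) (j : ℤ) (b : ℕ) (u : Tor (L ^ (A - 2 * b)) (L ^ (B - b))) :
    Torus L A B N := toTorus L A B N (pos L A B j b u)

theorem torusGeom_place {N : ℕ} (hA : 2 * N ≤ A) (hB : N ≤ B) :
    TorusGeom (place (L := L) A B N N 0) (eps L N) where
  pos := eps_pos _
  le_one := by
    have h1 : (1 : ℝ) ≤ L := by exact_mod_cast NeZero.one_le
    rw [eps]
    exact zpow_le_one_of_nonpos₀ h1 (by simp)
  time := by
    have h1 : (1 : ℝ) ≤ L := by exact_mod_cast NeZero.one_le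
    have := eps_sq_mul_pow (L := L) (j := 0) (N := N) (b := N) (by simp) hA
    have h2 := eps_sq_mul_pow (L := L) (j := N) (N := N) (b := 0) (by simp) (Nat.zero_le A)
    rw [h2, ← this]
    simp only [eps, neg_zero, zpow_zero, one_pow, one_mul, Nat.cast_pow]
    exact one_le_pow₀ h1
  space := by
    have h1 : (1 : ℝ) ≤ L := by exact_mod_cast NeZero.one_le
    have := eps_mul_pow (L := L) (j := 0) (N := N) (b := N) (by simp) hB
    have h2 := eps_mul_pow (L := L) (j := N) (N := N) (b := 0) (by simp) (Nat.zero_le B)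
    rw [h2, ← this]
    simp only [eps, neg_zero, zpow_zero, one_mul, Nat.cast_pow]
    exact one_le_pow₀ h1
  dist_le x t z := by
    have e1 : x + ((t : ZMod (L ^ (A - 2 * 0))), fun ν => ((z ν : ℤ) : ZMod (L ^ (B - 0)))) =
        torCls _ _ (((x.1.val : ℤ), fun ν => ((x.2 ν).val : ℤ)) + (t, z)) := by
      rw [torCls_add, torCls_val]; rfl
    rw [e1, place, place, toTorus_pos_torCls (by simp) (by omega) (by omega), pos_eq_intPos,
      dist_toTorus]
    refine (torusDist_intPos_le _ _).trans (le_of_eq ?_)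
    have he := eps_pos (L := L) (N : ℤ)
    rw [Finset.mul_sum]
    congr 1
    · rw [← abs_of_pos (pow_pos he 2), ← abs_mul, abs_of_pos (pow_pos he 2), ← abs_neg]
      congr 1; push_cast [Prod.fst_add]; ring
    · refine Finset.sum_congr rfl fun ν _ => ?_
      rw [← abs_of_pos he, ← abs_mul, abs_of_pos he, ← abs_neg]
      congr 1; push_cast [Prod.snd_add, Pi.add_apply]; ring

theorem dist_place_le_of_supp {N₀ j b r : ℕ} (hN : j + b = N₀) (hA : 2 * N₀ ≤ A) (hB : N₀ ≤ B)
    {Q : Matrix (Tor (L ^ (A - 2 * N₀)) (L ^ (B - N₀))) (Tor (L ^ (A - 2 * b)) (L ^ (B - b))) ℂ}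
    (hQ : BlockAvg Q (L ^ (2 * j)) (L ^ j) r) (y : Tor (L ^ (A - 2 * N₀)) (L ^ (B - N₀)))
    (u : Tor (L ^ (A - 2 * b)) (L ^ (B - b))) (h : Q y u ≠ 0) :
    dist (place A B N₀ 0 N₀ y) (place A B N₀ j b u) ≤ 2 * r := by
  obtain ⟨t, z, ht, hz, hu⟩ := hQ.supp y u h
  have hL0 : (L : ℝ) ≠ 0 := by exact_mod_cast NeZero.ne L
  have e1 : u = torCls _ _ ((((L ^ (2 * j) : ℕ) : ℤ) * (y.1.val : ℤ) + t : ℤ),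
      fun ν => (((L ^ j : ℕ) : ℤ) * ((y.2 ν).val : ℤ) + z ν : ℤ)) := hu
  have he : 0 < eps L j := eps_pos _
  have hej : eps L j * (L : ℝ) ^ j = 1 := by
    rw [eps, _root_.zpow_neg, zpow_natCast, inv_mul_cancel₀ (pow_ne_zero _ hL0)]
  have he2 : eps L j ^ 2 * (L : ℝ) ^ (2 * j) = 1 := by
    rw [pow_mul', ← mul_pow, hej, one_pow]
  have h0 : eps L 0 = 1 := by simp [eps]
  rw [place, place, e1, toTorus_pos_torCls (by exact_mod_cast hN) (by omega) (by omega),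
    pos_eq_intPos, dist_toTorus]
  refine (torusDist_intPos_le _ _).trans ?_
  have k0 : |eps L 0 ^ 2 * (((y.1.val : ℤ)) : ℝ) - eps L j ^ 2 *
      ((((L ^ (2 * j) : ℕ) : ℤ) * (y.1.val : ℤ) + t : ℤ) : ℝ)| ≤ r / 2 := by
    have e : eps L 0 ^ 2 * (((y.1.val : ℤ)) : ℝ) - eps L j ^ 2 *
      ((((L ^ (2 * j) : ℕ) : ℤ) * (y.1.val : ℤ) + t : ℤ) : ℝ) = -(eps L j ^ 2 * t) := by
      rw [h0]; push_cast
      linear_combination -(y.1.val : ℝ) * he2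
    rw [e, abs_neg, abs_mul, abs_of_pos (pow_pos he 2)]
    have ht' : 2 * |(t : ℝ)| ≤ r * ((L : ℝ) ^ (2 * j) - 1) := by exact_mod_cast ht
    have := mul_le_mul_of_nonneg_left ht' (pow_pos he 2).le
    have hr : 0 ≤ eps L j ^ 2 * r := by positivity
    linear_combination (1 / 2) * this + (r / 2 : ℝ) * he2 + (1 / 2) * hr
  have k1 : ∀ ν, |eps L 0 * ((((y.2 ν).val : ℤ)) : ℝ) - eps L j *
      ((((L ^ j : ℕ) : ℤ) * ((y.2 ν).val : ℤ) + z ν : ℤ) : ℝ)| ≤ r / 2 := by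
    intro ν
    have e : eps L 0 * ((((y.2 ν).val : ℤ)) : ℝ) - eps L j *
      ((((L ^ j : ℕ) : ℤ) * ((y.2 ν).val : ℤ) + z ν : ℤ) : ℝ) = -(eps L j * z ν) := by
      rw [h0]; push_cast
      linear_combination -((y.2 ν).val : ℝ) * hej
    rw [e, abs_neg, abs_mul, abs_of_pos he]
    have ht' : 2 * |(z ν : ℝ)| ≤ r * ((L : ℝ) ^ j - 1) := by exact_mod_cast hz ν
    have := mul_le_mul_of_nonneg_left ht' he.le
    have hr : 0 ≤ eps L j * r := by positivity
    linear_combination (1 / 2) * this + (r / 2 : ℝ) * hej + (1 / 2) * hr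
  have k2 := Finset.sum_le_sum fun ν (_ : ν ∈ (Finset.univ : Finset (Fin 3))) => k1 ν
  simp only [Finset.sum_const, Finset.card_univ, Fintype.card_fin, nsmul_eq_mul] at k2
  push_cast at k0 k2 ⊢
  linarith

theorem sum_exp_neg_dist_place_le {N : ℕ} {α : ℝ} (hα : 0 < α)
    (v : Tor (L ^ (A - 2 * 0)) (L ^ (B - 0))) :
    ∑ u, eps L N ^ 5 * Real.exp (-(α * dist (place A B N N 0 u) (place A B N N 0 v))) ≤
      (2 + 4 / α) ^ 4 := by
  have hβ : 0 < α / 2 := by positivity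
  have he : 0 < eps L N := eps_pos _
  have he1 : eps L N ≤ 1 := by
    have h1 : (1 : ℝ) ≤ L := by exact_mod_cast NeZero.one_le
    rw [eps]
    exact zpow_le_one_of_nonpos₀ h1 (by simp)
  have h0 := sum_exp_neg_norm_addCircle_le (pow_pos he 2) (pow_le_one₀ he.le he1) hβ
    (eps_sq_mul_pow (L := L) (j := N) (N := N) (b := 0) (by simp) (Nat.zero_le A)) v.1
  have h1 := fun ν => sum_exp_neg_norm_addCircle_le he he1 hβ
    (eps_mul_pow (L := L) (j := N) (N := N) (b := 0) (by simp) (Nat.zero_le B)) (v.2 ν)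
  set F : ZMod (L ^ (A - 2 * 0)) → ℝ := fun i => eps L N ^ 2 * Real.exp (-(α / 2 *
    ‖((eps L N ^ 2 * (i.val : ℝ) - eps L N ^ 2 * (v.1.val : ℝ) : ℝ) :
      AddCircle (eps L N ^ 2 * (L : ℝ) ^ A))‖)) with hF
  set G : Fin 3 → ZMod (L ^ (B - 0)) → ℝ := fun ν i => eps L N * Real.exp (-(α / 2 *
    ‖((eps L N * (i.val : ℝ) - eps L N * ((v.2 ν).val : ℝ) : ℝ) :
      AddCircle (eps L N * (L : ℝ) ^ B))‖)) with hG
  have key : ∀ u : Tor (L ^ (A - 2 * 0)) (L ^ (B - 0)), eps L N ^ 5 *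
      Real.exp (-(α * dist (place A B N N 0 u) (place A B N N 0 v))) ≤
      F u.1 * ∏ ν, G ν (u.2 ν) := by
    intro u
    have hd : ‖((eps L N ^ 2 * (u.1.val : ℝ) - eps L N ^ 2 * (v.1.val : ℝ) : ℝ) :
        AddCircle (eps L N ^ 2 * (L : ℝ) ^ A))‖ +
        ∑ ν, ‖((eps L N * ((u.2 ν).val : ℝ) - eps L N * ((v.2 ν).val : ℝ) : ℝ) :
          AddCircle (eps L N * (L : ℝ) ^ B))‖ ≤
        2 * torusDist L A B N (pos L A B N 0 u) (pos L A B N 0 v) := by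
      have := sum_norm_le_two_mul_torusDist (L := L) (A := A) (B := B) (N := N)
        (pos L A B N 0 u) (pos L A B N 0 v)
      rw [Fin.sum_univ_succ] at this
      exact this
    rw [place, place, dist_toTorus]
    simp only [hF, hG]
    rw [Finset.prod_mul_distrib, ← Real.exp_sum, Finset.prod_const, Finset.card_univ,
      Fintype.card_fin, mul_mul_mul_comm, ← Real.exp_add, ← pow_add]
    refine mul_le_mul_of_nonneg_left (Real.exp_le_exp.2 ?_) (by positivity)
    rw [Finset.sum_neg_distrib, ← Finset.mul_sum]
    have := mul_le_mul_of_nonneg_left hd hβ.le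
    linarith
  refine (Finset.sum_le_sum fun u _ => key u).trans ?_
  rw [Fintype.sum_prod_type]
  simp only [← Finset.mul_sum]
  rw [← Finset.sum_mul, ← Fintype.prod_sum]
  have e : 2 / (α / 2) = 4 / α := by field_simp; norm_num
  rw [e] at h0 h1
  have hG0 : ∀ ν, 0 ≤ ∑ i, G ν i := fun ν => Finset.sum_nonneg fun i _ => by
    simp only [hG]; positivity
  have hp : ∏ ν, ∑ i, G ν i ≤ ∏ ν : Fin 3, (2 + 4 / α) :=
    Finset.prod_le_prod (fun ν _ => hG0 ν) fun ν _ => h1 ν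
  rw [Finset.prod_const, Finset.card_univ, Fintype.card_fin] at hp
  calc _ ≤ (2 + 4 / α) * (2 + 4 / α) ^ 3 :=
        mul_le_mul h0 hp (Finset.prod_nonneg fun ν _ => hG0 ν) (by positivity)
    _ = _ := by ring

end Torus

end ParabolicBlockSpin

namespace ParabolicBlockSpin

open Matrix

section CoarseOperator

theorem SchurBd.zero {P ι : Type*} [PseudoMetricSpace P] [Fintype ι] {m : ℝ} {f : ι → P} :
    SchurBd m f (0 : Matrix ι ι ℂ) 0 := by
  constructor <;> intro i <;> simp

theorem SchurBd.sum {P ι κ : Type*} [PseudoMetricSpace P] [Fintype ι] {m : ℝ} {f : ι → P}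
    (s : Finset κ) {A : κ → Matrix ι ι ℂ} {C : κ → ℝ} (h : ∀ j ∈ s, SchurBd m f (A j) (C j)) :
    SchurBd m f (∑ j ∈ s, A j) (∑ j ∈ s, C j) := by
  classical
  induction s using Finset.induction_on with
  | empty => simpa using SchurBd.zero
  | insert i s hi ih =>
    rw [Finset.sum_insert hi, Finset.sum_insert hi]
    exact (h i (Finset.mem_insert_self i s)).add
      (ih fun j hj => h j (Finset.mem_insert_of_mem hj))

variable (L A B : ℕ) [NeZero L]

/-- The perturbation `∑_{j=1}^{n-1} L^{-2j} Q_j Q_j^*` of the identity in the definition of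
`𝔔_n`. -/
def gramSum (qq n : ℕ) : Matrix (Lat L A B 0 n) (Lat L A B 0 n) ℂ :=
  ∑ j ∈ Finset.Ico 1 n, ((L : ℂ) ^ (2 * j))⁻¹ • gramQ L A B qq n j

variable {L A B}

theorem schurBd_gramQ (hL : Odd L) {qq : ℕ} (hqq : 1 ≤ qq) {N j : ℕ} (hj : j ≤ N)
    (hA : 2 * N ≤ A) (hB : N ≤ B) :
    SchurBd 1 (place A B N 0 N) (gramQ L A B qq N j) (Real.exp (4 * qq)) := by
  have hL1 : 0 < L := NeZero.pos L
  obtain ⟨Q, hgram, hQ⟩ := gramQ_eq (L := L) (A := A) (B := B) qq (N - j) j N (by omega)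
  have hQ' := hQ hL hqq hA hB
  have h := hQ'.schurBd_gram (m := 1) zero_le_one (by positivity) (by positivity)
    (dist_place_le_of_supp (by omega) hA hB hQ')
  have e1 : (((L ^ (2 * j) : ℕ) : ℝ)) * (((L ^ j : ℕ) : ℝ)) ^ 3 = (L : ℝ) ^ (5 * j) := by
    push_cast; ring
  have e2 : 2 * (1 * (2 * (qq : ℝ))) = 4 * qq := by ring
  rw [e1, e2, ← hgram] at h
  exact h

theorem schurBd_gramSum (hL : Odd L) {qq : ℕ} (hqq : 1 ≤ qq) {N : ℕ}
    (hA : 2 * N ≤ A) (hB : N ≤ B) (hlarge : 4 * Real.exp (4 * qq) < L) :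
    SchurBd 1 (place A B N 0 N) (gramSum L A B qq N) (1 / 2) := by
  have hE : (1 : ℝ) ≤ Real.exp (4 * qq) := Real.one_le_exp (by positivity)
  have hL4 : (4 : ℝ) < L := by linarith
  have hL0 : (0 : ℝ) < L := by linarith
  have h := SchurBd.sum (m := 1) (f := place (L := L) A B N 0 N) (Finset.Ico 1 N)
    fun j hj => (schurBd_gramQ (L := L) (A := A) (B := B) hL hqq
      (Finset.mem_Ico.1 hj).2.le hA hB).smul ((L : ℂ) ^ (2 * j))⁻¹
  refine h.mono le_rfl ?_
  have e : ∀ j, ‖((L : ℂ) ^ (2 * j))⁻¹‖ = (((L : ℝ) ^ 2)⁻¹) ^ j := by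
    intro j
    rw [norm_inv, norm_pow, Complex.norm_natCast, pow_mul, inv_pow]
  simp only [e]
  rw [← Finset.sum_mul]
  have hx0 : (0 : ℝ) ≤ ((L : ℝ) ^ 2)⁻¹ := by positivity
  have hx1 : ((L : ℝ) ^ 2)⁻¹ ≤ (4 * (L : ℝ))⁻¹ := by
    apply inv_anti₀ (by positivity)
    nlinarith
  have hx2 : (4 * (L : ℝ))⁻¹ ≤ 1 / 2 := by
    rw [inv_eq_one_div, div_le_div_iff₀ (by positivity) (by norm_num)]
    linarith
  have hgeo := geom_sum_Ico_le_of_lt_one (m := 1) (n := N) hx0 (by linarith)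
  rw [pow_one] at hgeo
  have h2 : ((L : ℝ) ^ 2)⁻¹ / (1 - ((L : ℝ) ^ 2)⁻¹) ≤ 2 * (4 * (L : ℝ))⁻¹ := by
    rw [div_le_iff₀ (by linarith)]
    nlinarith [mul_nonneg (inv_nonneg.2 (by positivity : (0 : ℝ) ≤ 4 * L)) (by linarith :
      (0 : ℝ) ≤ 1 / 2 - ((L : ℝ) ^ 2)⁻¹)]
  calc _ ≤ 2 * (4 * (L : ℝ))⁻¹ * Real.exp (4 * qq) := by
        gcongr
        exact hgeo.trans h2
    _ = Real.exp (4 * qq) / (2 * L) := by field_simp; norm_num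
    _ ≤ 1 / 2 := by
        rw [div_le_div_iff₀ (by positivity) (by norm_num)]
        linarith

end CoarseOperator

section FineOperator

variable (L A B : ℕ) [NeZero L]

/-- The operator `L² (D_n + Q̌* 𝔔̌ Q̌)`, in the scale of the lattice `X_{n+1}`. -/
def scaledOperator (h : SingleParticle) (qq : ℕ) (a : ℝ) (n : ℕ) :
    Matrix (Tor (L ^ (A - 2 * 0)) (L ^ (B - 0))) (Tor (L ^ (A - 2 * 0)) (L ^ (B - 0))) ℂ :=
  generator h (L ^ (A - 2 * 0)) (L ^ (B - 0)) (((L ^ (n + 1) : ℕ) : ℝ)⁻¹) +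
    sandwich (checkQ L A B qq n) (L ^ (2 * (n + 1))) (L ^ (n + 1))
      ((a : ℂ) • (1 + gramSum L A B qq (n + 1))⁻¹)

variable {L A B}

theorem eps_natCast (N : ℕ) : eps L N = (((L ^ N : ℕ) : ℝ))⁻¹ := by
  rw [eps, _root_.zpow_neg, zpow_natCast, Nat.cast_pow]

/-- Exponential decay of the inverse of the scaled operator, uniformly in the scale. -/
theorem exists_schurBd_scaledOperator (h : SingleParticle) {qq : ℕ} (hqq : 1 ≤ qq) {a : ℝ}
    (ha : 0 < a) : ∃ m Γ : ℝ, 0 < m ∧ m ≤ 1 ∧ 0 ≤ Γ ∧ ∀ (L : ℕ) [NeZero L], Odd L →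
      4 * Real.exp (4 * qq) < L → ∀ n A B : ℕ, 2 * (n + 1) ≤ A → n + 1 ≤ B →
      IsUnit (scaledOperator L A B h qq a n) ∧
      SchurBd m (place A B (n + 1 : ℕ) (n + 1 : ℕ) 0) (scaledOperator L A B h qq a n)⁻¹ Γ := by
  obtain ⟨μ, CG, CP, hμ, hCG, hCP, HG⟩ := exists_massive_bounds h
  obtain ⟨CS, hCS, HS⟩ := exists_l2_le h hqq ha
  set E : ℝ := Real.exp (2 * (1 * (2 * (qq : ℝ)))) with hE
  set CK : ℝ := 2 * a * E with hCK
  have hCK0 : 0 ≤ CK := by positivity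
  set m := greenRate μ CG CK CS 1 with hm
  have hm0 : 0 < m := by rw [hm, greenRate]; positivity
  have hm1 : m ≤ 1 := by
    rw [hm, greenRate]
    rw [div_le_one (by positivity)]
    have : 0 ≤ CG * (μ + CK) * (1 + CS * (μ + CK)) := by positivity
    linarith
  refine ⟨m, greenConst μ CG CK CS CP CK ((2 + 4 / m) ^ 4), hm0, hm1, ?_, ?_⟩
  · simp only [greenConst]; positivity
  intro L _ hL hlarge n A B hA hB
  have hL1 : 0 < L := NeZero.pos L
  have hP := schurBd_gramSum (L := L) hL hqq hA hB hlarge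
  set f := place (L := L) A B (n + 1 : ℕ) (n + 1 : ℕ) 0 with hf
  set g := place (L := L) A B (n + 1 : ℕ) 0 (n + 1) with hg
  set Γs := gramSum L A B qq (n + 1) with hΓs
  have hunit := (Matrix.isUnit_iff_isUnit_det _).1 (hP.isUnit_one_add zero_le_one)
  have hX := Matrix.mul_nonsing_inv _ hunit
  have hX' := Matrix.nonsing_inv_mul _ hunit
  have hXb := hP.of_one_add_mul_eq_one zero_le_one hX hX'
  have hQ := blockAvg_checkQ (L := L) (A := A) (B := B) hL hqq n hA hB
  have hR := dist_place_le_of_supp (N₀ := n + 1) (j := n + 1) (b := 0) (by omega) hA hB hQ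
  have hF : SchurBd 1 g ((a : ℂ) • (1 + Γs)⁻¹) (2 * a) := by
    have := hXb.smul (a : ℂ)
    rwa [Complex.norm_real, Real.norm_eq_abs, abs_of_pos ha, mul_comm a] at this
  have hK := hQ.schurBd_sandwich (f := f) (g := g) zero_le_one (by positivity) (by positivity) hR
    (by positivity) hF
  have hKp := hQ.ptBd_sandwich (f := f) (g := g) zero_le_one (by positivity) (by positivity) hR
    (by positivity) hF
  have hgeom := torusGeom_place (L := L) hA hB
  obtain ⟨G, hG1, hG2, hGb, hG3⟩ := HG _ _ _ f (eps L (n + 1 : ℕ)) hgeom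
  have hl2 := HS _ _ _ _ (checkQ L A B qq n) (1 + Γs)⁻¹ (L ^ (2 * (n + 1))) (L ^ (n + 1)) hQ
    (by rw [← pow_mul, mul_comm]) (Nat.one_le_pow _ _ hL1)
    (fun ψ => hP.le_re_dotProduct_inverse zero_le_one hX ψ)
    (fun ψ => hXb.l2_mulVec_le zero_le_one zero_le_two ψ)
  change ∀ φ, l2 φ ≤ CS * l2 (scaledOperator L A B h qq a n *ᵥ φ) at hl2
  have hM : IsUnit (scaledOperator L A B h qq a n) := by
    rw [← Matrix.mulVec_injective_iff_isUnit]
    intro φ ψ hφψ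
    have h1 := hl2 (φ - ψ)
    have h2 : scaledOperator L A B h qq a n *ᵥ (φ - ψ) = 0 := by
      rw [Matrix.mulVec_sub, sub_eq_zero]; exact hφψ
    have h3 : l2 (0 : Tor (L ^ (A - 2 * 0)) (L ^ (B - 0)) → ℂ) = 0 := by simp [l2]
    rw [h2, h3, mul_zero CS] at h1
    have h4 : l2 (φ - ψ) = 0 := le_antisymm h1 (l2_nonneg _)
    have h5 : (WithLp.toLp 2 (φ - ψ) : EuclideanSpace ℂ _) = 0 := norm_eq_zero.1 h4
    have h6 : φ - ψ = 0 := by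
      funext x
      exact congrArg (fun w : EuclideanSpace ℂ _ => w x) h5
    exact sub_eq_zero.1 h6
  refine ⟨hM, ?_⟩
  have hdet := (Matrix.isUnit_iff_isUnit_det _).1 hM
  have hS1 := Matrix.nonsing_inv_mul _ hdet
  have hS2 := Matrix.mul_nonsing_inv _ hdet
  have he : eps L (n + 1 : ℕ) = (((L ^ (n + 1) : ℕ) : ℝ))⁻¹ := eps_natCast _
  have hv : (((L ^ (2 * (n + 1)) : ℕ) : ℝ) * ((L ^ (n + 1) : ℕ) : ℝ) ^ 3)⁻¹ =
      eps L (n + 1 : ℕ) ^ 5 := by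
    rw [he, inv_pow]; congr 1; push_cast; ring
  rw [he] at hG1 hG2
  rw [hv] at hKp
  refine schurBd_green (CQ := CK) (v := eps L (n + 1 : ℕ) ^ 5) zero_lt_one hμ hCG hCK0 hCS hCP
    hCK0 (pow_pos hgeom.pos 5).le hG1 hG2 hS1 hS2 hGb hK hG3 hKp ?_ ?_
  · intro φ
    have := hl2 ((scaledOperator L A B h qq a n)⁻¹ *ᵥ φ)
    rwa [Matrix.mulVec_mulVec, hS2, Matrix.one_mulVec] at this
  · intro v
    exact sum_exp_neg_dist_place_le hm0 v

end FineOperator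

section Definitions

variable (L A B : ℕ) [NeZero L] (h : SingleParticle) (qq : ℕ) (a : ℝ) (n : ℕ)

theorem D0_eq : D0 L A B h = 1 - transfer h (L ^ (A - 2 * 0)) (L ^ (B - 0)) := by
  have h1 : timeDeriv L A B = shiftM (1, 0) - 1 := by
    ext x y
    simp [timeDeriv, shiftM, Matrix.one_apply, eq_comm]
  have h2 : h0 L A B h = periodM h.kernel := rfl
  rw [D0, h1, h2, transfer]
  noncomm_ring

theorem Dn_eq : Dn L A B h n =
    ((L : ℂ) ^ (2 * n)) • (1 - transfer h (L ^ (A - 2 * 0)) (L ^ (B - 0))) := by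
  induction n with
  | zero =>
    have e : (L : ℂ) ^ (2 * 0) = 1 := by simp
    rw [e, one_smul, ← D0_eq]; rfl
  | succ n ih =>
    have e : (L : ℂ) ^ (2 * (n + 1)) = (L : ℂ) ^ 2 * (L : ℂ) ^ (2 * n) := by ring
    rw [Dn, ih, e, mul_smul]
    rfl

theorem checkQadj_eq : checkQadj L A B qq n =
    ((((L ^ (2 * (n + 1)) : ℕ) : ℝ) * ((L ^ (n + 1) : ℕ) : ℝ) ^ 3 : ℝ) : ℂ) •
      (checkQ L A B qq n)ᵀ := by
  have hL0' : (L : ℝ) ≠ 0 := by exact_mod_cast NeZero.ne L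
  rw [checkQadj, adj]
  congr 2
  rw [eps_natCast, eps, neg_neg, zpow_one]
  push_cast
  field_simp
  ring

theorem checkSinv_eq :
    checkSinv L A B h qq a n = ((L : ℂ) ^ 2)⁻¹ • scaledOperator L A B h qq a n := by
  have hL0 : (L : ℂ) ≠ 0 := by exact_mod_cast NeZero.ne L
  have hL0' : (L : ℝ) ≠ 0 := by exact_mod_cast NeZero.ne L
  have e1 : checkfQ L A B qq a n =
      ((L : ℂ) ^ 2)⁻¹ • ((a : ℂ) • (1 + gramSum L A B qq (n + 1))⁻¹) := rfl
  have e2 := checkQadj_eq L A B qq n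
  have e3 : (((((((L ^ (n + 1) : ℕ) : ℝ))⁻¹ ^ 2)⁻¹ : ℝ)) : ℂ) = (L : ℂ) ^ 2 * (L : ℂ) ^ (2 * n) := by
    push_cast
    rw [inv_pow, inv_inv]; ring
  rw [checkSinv, Dn_eq, e1, e2, scaledOperator, sandwich, generator, smul_add, e3]
  congr 1
  · rw [smul_smul, inv_mul_cancel_left₀ (pow_ne_zero 2 hL0)]
  · simp only [Matrix.mul_smul, Matrix.smul_mul]
    rw [smul_comm (a : ℂ)]

theorem checkS_eq (hM : IsUnit (scaledOperator L A B h qq a n)) :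
    checkS L A B h qq a n = ((L : ℂ) ^ 2) • (scaledOperator L A B h qq a n)⁻¹ := by
  have hL0 : (L : ℂ) ^ 2 ≠ 0 := pow_ne_zero 2 (by exact_mod_cast NeZero.ne L)
  rw [checkS, checkSinv_eq]
  refine Matrix.inv_eq_left_inv ?_
  rw [Matrix.smul_mul, Matrix.mul_smul, smul_smul, mul_inv_cancel₀ hL0, one_smul,
    Matrix.nonsing_inv_mul _ ((Matrix.isUnit_iff_isUnit_det _).1 hM)]

variable {L A B}

theorem opNorm_le {m C : ℝ} {j k j' k' N : ℤ} {b c : ℕ} (hj : j = j') (hk : k = k')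
    (hN : j + b = N) {M : Matrix (Tor (L ^ (A - 2 * c)) (L ^ (B - c)))
      (Tor (L ^ (A - 2 * b)) (L ^ (B - b))) ℂ}
    (hrow : RowBd m (place A B N k' c) (place A B N j' b) M C)
    (hcol : ColBd m (place A B N k' c) (place A B N j' b) M ((eps L j / eps L k) ^ 5 * C)) :
    opNorm L A B m j b k c M ≤ C := by
  subst hj hk hN
  have hej := eps_pos (L := L) j
  have hek := eps_pos (L := L) k
  have e : ∀ u u', ‖opKernel L A B j b k c M u u'‖ = (eps L j ^ 5)⁻¹ * ‖M u u'‖ := by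
    intro u u'
    rw [opKernel, norm_mul, Complex.norm_real, Real.norm_eq_abs, abs_of_pos (by positivity)]
  refine max_le (ciSup_le fun u => ?_) (ciSup_le fun u' => ?_)
  · refine le_trans (le_of_eq ?_) (hrow u)
    rw [Finset.mul_sum]
    refine Finset.sum_congr rfl fun u' _ => ?_
    rw [e, place, place, dist_toTorus]
    field_simp
  · have h1 := mul_le_mul_of_nonneg_left (hcol u')
      (by positivity : 0 ≤ eps L k ^ 5 * (eps L j ^ 5)⁻¹)
    refine le_trans (le_of_eq ?_) (h1.trans (le_of_eq ?_))
    · rw [Finset.mul_sum, Finset.mul_sum]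
      refine Finset.sum_congr rfl fun u _ => ?_
      rw [e, place, place, dist_toTorus]
      ring
    · field_simp

end Definitions

end ParabolicBlockSpin

end

theorem mainTheorem11 (qq : ℕ) (hqq : 4 ≤ qq) (hqq_even : Even qq) :
    ∃ Γ₁₇ : ℝ, ∀ (a : ℝ), 0 < a → ∀ h : ParabolicBlockSpin.SingleParticle,
      ∃ m₉ Γ₁₈ : ℝ, 0 < m₉ ∧
        ∀ (L : ℕ) [NeZero L], Odd L → Γ₁₇ < (L : ℝ) →
          ∀ n A B : ℕ, 2 * (n + 1) ≤ A → n + 1 ≤ B →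
            IsUnit (ParabolicBlockSpin.checkSinv L A B h qq a n) ∧
            ParabolicBlockSpin.opNorm L A B m₉ ((n : ℤ) + 1) 0 ((n : ℤ) + 1) 0
                (ParabolicBlockSpin.scaledCheckS L A B h qq a n) ≤ (L : ℝ) ^ 2 * Γ₁₈ ∧
            ParabolicBlockSpin.opNorm L A B m₉ 0 (n + 1) ((n : ℤ) + 1) 0
                (ParabolicBlockSpin.scaledCheckSQadj L A B h qq a n) ≤ (L : ℝ) ^ 2 * Γ₁₈ := by
  open ParabolicBlockSpin in
  have hqq1 : 1 ≤ qq := by omega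
  refine ⟨4 * Real.exp (4 * qq), fun a ha h => ?_⟩
  obtain ⟨m, Γ, hm0, hm1, hΓ, H⟩ := exists_schurBd_scaledOperator h hqq1 ha
  set E : ℝ := Real.exp (m * (2 * qq)) with hE
  have hE1 : 1 ≤ E := Real.one_le_exp (by positivity)
  refine ⟨m, Γ * E, hm0, fun L _ hL hlarge n A B hA hB => ?_⟩
  obtain ⟨hM, hS⟩ := H L hL hlarge n A B hA hB
  have hL1 : 0 < L := NeZero.pos L
  have hL0 : (L : ℂ) ^ 2 ≠ 0 := pow_ne_zero 2 (by exact_mod_cast NeZero.ne L)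
  have hcast : ((n : ℤ) + 1) = ((n + 1 : ℕ) : ℤ) := by push_cast; rfl
  have hnorm : ‖(L : ℂ) ^ 2‖ = (L : ℝ) ^ 2 := by rw [norm_pow, Complex.norm_natCast]
  have hS2 := hS.smul ((L : ℂ) ^ 2)
  rw [hnorm] at hS2
  have hle : (L : ℝ) ^ 2 * Γ ≤ (L : ℝ) ^ 2 * (Γ * E) := by
    refine mul_le_mul_of_nonneg_left ?_ (by positivity)
    exact le_mul_of_one_le_right hΓ hE1
  refine ⟨?_, ?_, ?_⟩
  · rw [checkSinv_eq]
    exact hM.smul (Units.mk0 _ (inv_ne_zero hL0))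
  · have e : scaledCheckS L A B h qq a n =
        ((L : ℂ) ^ 2) • (scaledOperator L A B h qq a n)⁻¹ := by
      rw [scaledCheckS, checkS_eq L A B h qq a n hM]; rfl
    rw [e]
    refine (opNorm_le (N := (n + 1 : ℕ)) hcast hcast (by push_cast; ring) hS2.1 ?_).trans hle
    rw [div_self (eps_pos _).ne', one_pow, one_mul]
    exact hS2.2
  · have e : scaledCheckSQadj L A B h qq a n =
        ((L : ℂ) ^ 2) • (scaledOperator L A B h qq a n)⁻¹ * checkQadj L A B qq n := by
      rw [scaledCheckSQadj, checkS_eq L A B h qq a n hM]; rfl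
    have hQ := blockAvg_checkQ (L := L) (A := A) (B := B) hL hqq1 n hA hB
    have hR := dist_place_le_of_supp (N₀ := n + 1) (j := n + 1) (b := 0) (by omega) hA hB hQ
    set c : ℝ := ((L ^ (2 * (n + 1)) : ℕ) : ℝ) * ((L ^ (n + 1) : ℕ) : ℝ) ^ 3 with hc
    have hc0 : 0 < c := by positivity
    have hcn : ‖(c : ℂ)‖ = c := by rw [Complex.norm_real, Real.norm_eq_abs, abs_of_pos hc0]
    have h1 := (rowBd_transpose.2 (hQ.colBd hm0.le hR)).smul (c : ℂ)
    have h2 := (colBd_transpose.2 (hQ.rowBd hm0.le hR)).smul (c : ℂ)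
    rw [← hc, hcn, ← checkQadj_eq] at h1
    rw [hcn, ← checkQadj_eq] at h2
    rw [e]
    refine opNorm_le (j' := 0) (N := (n + 1 : ℕ)) rfl hcast (by push_cast; ring) ?_ ?_
    · refine (RowBd.mul hm0.le (by positivity) hS2.1 h1).mono le_rfl (le_of_eq ?_)
      have : c * (E * c⁻¹) = E := by field_simp
      change (L : ℝ) ^ 2 * Γ * (c * (E * c⁻¹)) = _
      rw [this, mul_assoc]
    · refine (ColBd.mul hm0.le (by positivity) hS2.2 h2).mono le_rfl (le_of_eq ?_)
      have : (eps L 0 / eps L ((n : ℤ) + 1)) ^ 5 = c := by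
        rw [hcast, eps_natCast, hc]
        simp only [eps, neg_zero, zpow_zero]
        push_cast
        field_simp
        ring
      rw [this]
      ring
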